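/- Let $n\ge 1$, $0<\alpha\le 2$, $\langle x\rangle=(1+|x|^2)^{1/2}$, and let $p_\alpha(x)=\ln\langle x\rangle$ if $\alpha=2$ and $p_\alpha(x)=\langle x\rangle^{1-\alpha/2}$ if $0<\alpha<2$. Let $V_\alpha=V_\alpha^1+V_\alpha^2$ be a real-valued potential on $\mathbb R^n$ such that * $V_\alpha^1$ is measurable, real-valued, compactly supported and $\Delta$-compact (multiplication by $V_\alpha^1$ is compact from $H^2(\mathbb R^n)=D(\Delta)$, with the graph norm, to $L^2(\mathbb R^n)$); * $V_\alpha^2\in L^\infty(\mathbb R^n;\mathbb R)$, and for some $\varepsilon>0$ and $C$ one has $|V_\alpha^2(x)|\le C\,p_\alpha(x)^{-1-\varepsilon}$ for almost every $x$; * $\langle x\rangle^{1-\alpha/2}\,\ln\langle x\rangle\,|V_\alpha^2(x)|\to 0$ as $|x|\to\infty$ (as an essential limit). A Schrödinger operator $H=-\Delta+W$ on $L^2(\mathbb R^n)$ with domain $\{u\in H^2(\mathbb R^n): Wu\in L^2(\mathbb R^n)\}$ is said to have the unique continuation property if every $u$ in its domain that satisfies $Hu=0$ and vanishes almost everywhere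 outside a compact subset of $\mathbb R^n$ is identically zero. Assume that for every $E\in\mathbb R$ the operator $$-\Delta+\bigl(V_\alpha(x)-\langle x\rangle^\alpha-E\bigr)\mathbf 1_{|x|<R}$$ has the unique continuation property for all $R$ large enough (how large may depend on $E$). Let $H_\alpha$ be the closure in $L^2(\mathbb R^n)$ of the operator $-\Delta-\langle x\rangle^\alpha+V_\alpha$ with domain $\{u\in H^2(\mathbb R^n):\langle x\rangle^2u\in L^2(\mathbb R^n)\}$, the domain of the harmonic oscillator. Then $H_\alpha$ has no eigenvalue. -/

import Mathlib

open MeasureTheory Filter Topology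
open scoped ENNReal SchwartzMap Laplacian

noncomputable section

namespace Repulsive

/-- Euclidean space `ℝⁿ`. -/
abbrev Space (n : ℕ) : Type := EuclideanSpace ℝ (Fin n)

/-- The complex Hilbert space `L²(ℝⁿ)`. -/
abbrev L2 (n : ℕ) : Type := Lp ℂ 2 (volume : Measure (Space n))

variable {n : ℕ}

/-- The Japanese bracket `⟨x⟩ = (1 + |x|²)^{1/2}`. -/
def bracket (x : Space n) : ℝ := Real.sqrt (1 + ‖x‖ ^ 2)

/-- The position variable `p_α`: `ln ⟨x⟩` if `α = 2`, and `⟨x⟩^{1 - α/2}` otherwise. -/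
def position (α : ℝ) (x : Space n) : ℝ :=
  if α = 2 then Real.log (bracket x) else bracket x ^ (1 - α / 2)

/-- The embedding of `L²(ℝⁿ)` into the tempered distributions. -/
def embed (n : ℕ) : L2 n →ₗ[ℂ] 𝓢'(Space n, ℂ) :=
  (Lp.toTemperedDistributionCLM ℂ (volume : Measure (Space n)) 2).toLinearMap

theorem embed_apply (u : L2 n) : embed n u = (u : 𝓢'(Space n, ℂ)) := rfl

/-- An `L²` function is determined by the tempered distribution it defines. -/
theorem embed_injective : Function.Injective (embed n) :=
  LinearMap.ker_eq_bot.mp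
    (Lp.ker_toTemperedDistributionCLM_eq_bot (F := ℂ)
      (μ := (volume : Measure (Space n))) (p := 2))

/-- The Sobolev space `H²(ℝⁿ)`, as a subspace of `L²(ℝⁿ)`. -/
def sobolevTwo (n : ℕ) : Submodule ℂ (L2 n) where
  carrier := {u | TemperedDistribution.MemSobolev 2 2 (embed n u)}
  add_mem' := by
    intro u v hu hv
    change TemperedDistribution.MemSobolev 2 2 (embed n (u + v))
    rw [map_add]
    exact TemperedDistribution.MemSobolev.add hu hv
  zero_mem' := by
    change TemperedDistribution.MemSobolev 2 2 (embed n 0)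
    rw [map_zero]
    exact TemperedDistribution.memSobolev_fun_zero (Space n) ℂ 2 2
  smul_mem' := by
    intro c u hu
    change TemperedDistribution.MemSobolev 2 2 (embed n (c • u))
    rw [map_smul]
    exact TemperedDistribution.MemSobolev.smul c hu

/-- The distributional Laplacian of an `H²` function is an `L²` function. -/
theorem exists_laplacian (u : sobolevTwo n) :
    ∃ f : L2 n, Δ (embed n u) = embed n f := by
  have h := TemperedDistribution.MemSobolev.laplacian u.2
  rw [sub_self] at h
  exact TemperedDistribution.memSobolev_zero_iff.mp h

/-- The `L²` function which represents the distributional Laplacian of an `H²` function. -/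
def laplacianFun (u : sobolevTwo n) : L2 n := (exists_laplacian u).choose

theorem laplacianFun_spec (u : sobolevTwo n) : Δ (embed n u) = embed n (laplacianFun u) :=
  (exists_laplacian u).choose_spec

/-- The Laplacian `Δ` on `L²(ℝⁿ)`, with domain the Sobolev space `H²(ℝⁿ)`. -/
def laplacian (n : ℕ) : L2 n →ₗ.[ℂ] L2 n where
  domain := sobolevTwo n
  toFun :=
    { toFun := laplacianFun
      map_add' := by
        intro u v
        apply embed_injective
        rw [map_add, ← laplacianFun_spec, ← laplacianFun_spec, ← laplacianFun_spec,
          Submodule.coe_add, map_add, ← TemperedDistribution.laplacianCLM_apply, map_add,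
          TemperedDistribution.laplacianCLM_apply, TemperedDistribution.laplacianCLM_apply]
      map_smul' := by
        intro c u
        apply embed_injective
        rw [RingHom.id_apply, map_smul, ← laplacianFun_spec, ← laplacianFun_spec,
          Submodule.coe_smul, map_smul, ← TemperedDistribution.laplacianCLM_apply, map_smul,
          TemperedDistribution.laplacianCLM_apply] }

theorem mul_add_ae (g : Space n → ℝ) (u v : L2 n) :
    (fun x => (g x : ℂ) * u x) + (fun x => (g x : ℂ) * v x)
      =ᵐ[volume] fun x => (g x : ℂ) * (u + v : L2 n) x := by
  filter_upwards [Lp.coeFn_add u v] with x hx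
  rw [hx, Pi.add_apply, Pi.add_apply, mul_add]

theorem mul_smul_ae (g : Space n → ℝ) (c : ℂ) (u : L2 n) :
    c • (fun x => (g x : ℂ) * u x) =ᵐ[volume] fun x => (g x : ℂ) * (c • u : L2 n) x := by
  filter_upwards [Lp.coeFn_smul c u] with x hx
  rw [hx, Pi.smul_apply, Pi.smul_apply, smul_eq_mul, smul_eq_mul, mul_left_comm]

/-- The subspace `{u ∈ L² : g u ∈ L²}`. -/
def mulDomain (g : Space n → ℝ) : Submodule ℂ (L2 n) where
  carrier := {u | MemLp (fun x => (g x : ℂ) * u x) 2 volume}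
  add_mem' := by
    intro u v hu hv
    exact (MemLp.add hu hv).ae_eq (mul_add_ae g u v)
  zero_mem' := by
    refine (MemLp.zero (ε := ℂ)).ae_eq ?_
    filter_upwards [Lp.coeFn_zero ℂ 2 (volume : Measure (Space n))] with x hx
    rw [hx, Pi.zero_apply, mul_zero]
  smul_mem' := by
    intro c u hu
    exact (MemLp.const_smul hu c).ae_eq (mul_smul_ae g c u)

theorem memLp_of_mem_mulDomain {g : Space n → ℝ} (u : mulDomain g) :
    MemLp (fun x => (g x : ℂ) * (u : L2 n) x) 2 volume := u.2

/-- The maximal operator of multiplication by the real function `g` on `L²(ℝⁿ)`, with domain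
`{u ∈ L² : g u ∈ L²}`. -/
def mulOp (g : Space n → ℝ) : L2 n →ₗ.[ℂ] L2 n where
  domain := mulDomain g
  toFun :=
    { toFun := fun u => (memLp_of_mem_mulDomain u).toLp
      map_add' := fun u v =>
        (MemLp.toLp_congr _ ((memLp_of_mem_mulDomain u).add (memLp_of_mem_mulDomain v))
          (mul_add_ae g u v).symm).trans (MemLp.toLp_add _ _)
      map_smul' := fun c u =>
        (MemLp.toLp_congr _ ((memLp_of_mem_mulDomain u).const_smul c)
          (mul_smul_ae g c u).symm).trans (MemLp.toLp_const_smul c _) }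

/-- The Schrödinger operator `-Δ + W`, with domain `{u ∈ H² : W u ∈ L²}`. -/
def schrodinger (W : Space n → ℝ) : L2 n →ₗ.[ℂ] L2 n := -laplacian n + mulOp W

/-- The domain `{u ∈ H² : ⟨x⟩² u ∈ L²}` of the harmonic oscillator `-Δ + ⟨x⟩²`. -/
def oscillatorDomain (n : ℕ) : Submodule ℂ (L2 n) :=
  (laplacian n).domain ⊓ (mulOp (fun x : Space n => bracket x ^ 2)).domain

/-- The Hamiltonian `H_α = -Δ - ⟨x⟩^α + V`: the closure of this operator acting on the domain of
the harmonic oscillator. -/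
def hamiltonian (α : ℝ) (V : Space n → ℝ) : L2 n →ₗ.[ℂ] L2 n :=
  ((schrodinger fun x => -bracket x ^ α + V x).domRestrict (oscillatorDomain n)).closure

/-- `B` is `A`-compact: `D(A) ⊆ D(B)`, and `B` maps every sequence of `D(A)` which is bounded for
the graph norm of `A` to a sequence with a convergent subsequence. -/
def IsRelativelyCompact (B A : L2 n →ₗ.[ℂ] L2 n) : Prop :=
  ∃ h : A.domain ≤ B.domain, ∀ u : ℕ → A.domain,
    (∃ C : ℝ, ∀ k, ‖(u k : L2 n)‖ + ‖A (u k)‖ ≤ C) →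
    ∃ (φ : ℕ → ℕ) (v : L2 n), StrictMono φ ∧
      Tendsto (fun k => B ⟨u (φ k), h (u (φ k)).2⟩) atTop (𝓝 v)

/-- `lam` is an eigenvalue of the operator `H`. -/
def IsEigenvalue (H : L2 n →ₗ.[ℂ] L2 n) (lam : ℂ) : Prop :=
  ∃ u : H.domain, (u : L2 n) ≠ 0 ∧ H u = lam • (u : L2 n)

/-- The unique continuation property: a solution of `H u = 0` which vanishes (almost everywhere)
outside a compact set is identically zero. -/
def UniqueContinuation (H : L2 n →ₗ.[ℂ] L2 n) : Prop :=
  ∀ u : H.domain, H u = 0 →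
    (∃ K : Set (Space n), IsCompact K ∧ ∀ᵐ x, x ∉ K → (u : L2 n) x = 0) → (u : L2 n) = 0

end Repulsive

end

/-! Write `t = |x|²`, `s = 1 + t`, `Q = ⟨x⟩^α + E` and `f = (-Δ - Q + V) u` for the residual of a
real function `u`. The operator is symmetric, so an eigenvalue is a real number `E`. The heart of
the matter is that an eigenvector vanishes outside a ball; it then lies in `H²`, and unique
continuation on a larger ball annihilates it.

An eigenvector of the closure is only a graph limit and is not known beforehand to lie in `H²`.
Every estimate is therefore proved for smooth functions, keeps `f` on the right, and is applied to
Schwartz functions converging to the eigenvector whose residuals tend to zero on each ball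
(`exists_schwartz_residual`). The coefficients are real, so real and imaginary parts are treated
separately, and far out only `V₂` is seen (`isApproxSolution_comp`).

Vanishing at infinity rests on the virial identity for the multiplier `2A(t)(x·∇u + κu)`
(`integral_virial`), used with two kinds of weight.

Flux at infinity. Take `A = χ(t) s^{-α/4-1/2} ln s`. The power is such that the terms carrying the
logarithm cancel to leading order, in the radial derivative and in the potential; differentiating
the logarithm leaves a negative multiple of `|∇u|² + ⟨x⟩^α u²`, which absorbs `V₂` precisely when
`⟨x⟩^{1-α/2} ln⟨x⟩ |V₂|` is small. Hence the integral of `χ'` times the weighted flux is at most a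
residual term (`flux_monotone`). Let `χ` rise on a bounded shell and fall far away. By a Caccioppoli
estimate `⟨x⟩^{-α}|∇u|²` is controlled by the `L²` mass, so the fall costs a bounded amount times
its slope; since `α ≤ 2` the available length of the fall diverges at least like `ln ln`, and the
slope can be taken arbitrarily small. So the flux through far shells is nonpositive in the limit
(`eventually_integral_flux_le`).

Polynomial weights of high degree. Take `A = χ(t) t^{k+1}` and `κ = k + n/2`. The term in `|∇u|²`
cancels, the remaining quadratic terms form the negative square `-4(k+1)(x·∇u + κu)²`, and the mass
of `u` with weight `t^{k+1}⟨x⟩^α` is controlled by terms in `χ'` (`power_inequality`). With `χ`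
rising on `[τ, τ+1]` and falling like `t^{-k-1}` far away, the far terms are the flux, already known
to be harmless, and terms that are absorbed or small (`interior_mass_le`). What remains is a
near-field term of size `k (τ+1)^{k+1}`, to be compared with `(τ+2)^{k+1}` times the mass beyond
`τ+2`; letting `k → ∞` gives zero mass there (`IsApproxSolution.ae_eq_zero`). These weights do the
work of a Carleman estimate.

To finish, the gradients of the approximants tend to zero on a shell outside the support, so
truncation creates no error in the limit. Since `V₁` has relative bound zero, `-Δ + V₁` is closed on
`H²`, and the eigenvector is an `H²` solution with compact support (`exists_laplacian_ae_eq`). -/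

noncomputable section

namespace Repulsive

open scoped ContDiff LineDeriv

variable {n : ℕ}

/-! ### Radial weights and the divergence theorem -/

/-- The partial derivative `∂ᵢ u`. -/
def pd (i : Fin n) (u : Space n → ℝ) (x : Space n) : ℝ :=
  fderiv ℝ u x (EuclideanSpace.single i 1)

/-- The squared length `|∇u|²` of the gradient. -/
def gradSq (u : Space n → ℝ) (x : Space n) : ℝ := ∑ i, pd i u x ^ 2

/-- The Euler vector field `x · ∇u`. -/
def euler (u : Space n → ℝ) (x : Space n) : ℝ := ∑ i, x i * pd i u x

/-- The Laplacian in coordinates. -/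
def lap (u : Space n → ℝ) (x : Space n) : ℝ := ∑ i, pd i (pd i u) x

/-- A radial weight `A(|x|²)` with derivative `A'`, vanishing for large `|x|`. -/
structure IsWeight (A A' : ℝ → ℝ) : Prop where
  hasDerivAt : ∀ t, 0 ≤ t → HasDerivAt A (A' t) t
  continuousOn : ContinuousOn A' (Set.Ici 0)
  eventually_zero : ∃ T, ∀ t, T ≤ t → A t = 0 ∧ A' t = 0

theorem IsWeight.mul {A A' Q Q' : ℝ → ℝ} (hA : IsWeight A A')
    (hQ : ∀ t, 0 ≤ t → HasDerivAt Q (Q' t) t) (hQ' : ContinuousOn Q' (Set.Ici 0)) :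
    IsWeight (fun t => A t * Q t) (fun t => A' t * Q t + A t * Q' t) where
  hasDerivAt t ht := (hA.hasDerivAt t ht).mul (hQ t ht)
  continuousOn := by
    have h1 : ContinuousOn A (Set.Ici 0) := fun t ht =>
      (hA.hasDerivAt t ht).continuousAt.continuousWithinAt
    have h2 : ContinuousOn Q (Set.Ici 0) := fun t ht =>
      (hQ t ht).continuousAt.continuousWithinAt
    exact (hA.continuousOn.mul h2).add (h1.mul hQ')
  eventually_zero := by
    obtain ⟨T, hT⟩ := hA.eventually_zero
    refine ⟨T, fun t ht => ?_⟩
    simp [(hT t ht).1, (hT t ht).2]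

theorem continuous_comp_normSq {A : ℝ → ℝ} (hA : ContinuousOn A (Set.Ici 0)) :
    Continuous fun x : Space n => A (‖x‖ ^ 2) :=
  hA.comp_continuous (by fun_prop) fun x => by simp

theorem IsWeight.continuousOn_self {A A' : ℝ → ℝ} (hA : IsWeight A A') :
    ContinuousOn A (Set.Ici 0) := fun t ht =>
  (hA.hasDerivAt t ht).continuousAt.continuousWithinAt

theorem IsWeight.continuous {A A' : ℝ → ℝ} (hA : IsWeight A A') :
    Continuous fun x : Space n => A (‖x‖ ^ 2) :=
  continuous_comp_normSq hA.continuousOn_self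

theorem IsWeight.continuous_deriv {A A' : ℝ → ℝ} (hA : IsWeight A A') :
    Continuous fun x : Space n => A' (‖x‖ ^ 2) :=
  continuous_comp_normSq hA.continuousOn

theorem hasCompactSupport_of_normSq {g : Space n → ℝ} {T : ℝ}
    (hT : ∀ x, T ≤ ‖x‖ ^ 2 → g x = 0) : HasCompactSupport g := by
  refine HasCompactSupport.intro (isCompact_closedBall (0 : Space n) (Real.sqrt T)) fun x hx => ?_
  apply hT
  rw [mem_closedBall_zero_iff, not_le] at hx
  exact (Real.lt_sq_of_sqrt_lt hx).le

theorem integrable_of_normSq {g : Space n → ℝ} (hg : Continuous g) {T : ℝ}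
    (hT : ∀ x, T ≤ ‖x‖ ^ 2 → g x = 0) : Integrable g :=
  hg.integrable_of_hasCompactSupport (hasCompactSupport_of_normSq hT)

/-- Each term is an integration by parts against the constant function 1. -/
theorem integral_divergence_eq_zero (F F' : Fin n → Space n → ℝ)
    (hF : ∀ i x, HasLineDerivAt ℝ (F i) (F' i x) x (EuclideanSpace.single i 1))
    (hi : ∀ i, Integrable (F i)) (hi' : ∀ i, Integrable (F' i)) :
    ∫ x, ∑ i, F' i x = 0 := by
  rw [integral_finsetSum _ fun i _ => hi' i]
  refine Finset.sum_eq_zero fun i _ => ?_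
  have := integral_bilinear_hasLineDerivAt_right_eq_neg_left_of_integrable (μ := volume)
    (f := fun _ : Space n => (1 : ℝ)) (f' := fun _ => 0) (g := F i) (g' := F' i)
    (v := EuclideanSpace.single i 1) (B := ContinuousLinearMap.mul ℝ ℝ) (by simp)
    (by simpa using hi' i) (by simpa using hi i)
    (fun x _ => by simpa using! hasDerivAt_const (0 : ℝ) (1 : ℝ)) (fun x _ => hF i x)
  simpa using this

theorem pd_contDiff {u : Space n → ℝ} (hu : ContDiff ℝ ∞ u) (i : Fin n) :
    ContDiff ℝ ∞ (pd i u) := by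
  unfold pd
  exact (hu.fderiv_right (m := ∞) (by simp)).clm_apply contDiff_const

theorem gradSq_continuous {u : Space n → ℝ} (hu : ContDiff ℝ ∞ u) : Continuous (gradSq u) := by
  unfold gradSq
  exact continuous_finsetSum _ fun i _ => ((pd_contDiff hu i).continuous).pow 2

theorem euler_continuous {u : Space n → ℝ} (hu : ContDiff ℝ ∞ u) : Continuous (euler u) := by
  unfold euler
  refine continuous_finsetSum _ fun i _ => Continuous.mul ?_ ((pd_contDiff hu i).continuous)
  fun_prop

theorem lap_continuous {u : Space n → ℝ} (hu : ContDiff ℝ ∞ u) : Continuous (lap u) := by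
  unfold lap
  exact continuous_finsetSum _ fun i _ => (pd_contDiff (pd_contDiff hu i) i).continuous

theorem hasLineDerivAt_pd {u : Space n → ℝ} (hu : ContDiff ℝ ∞ u) (i : Fin n) (x : Space n) :
    HasLineDerivAt ℝ u (pd i u x) x (EuclideanSpace.single i 1) :=
  ((hu.differentiable (by simp)) x).hasFDerivAt.hasLineDerivAt _

theorem hasLineDerivAt_coord (i j : Fin n) (x : Space n) :
    HasLineDerivAt ℝ (fun y : Space n => y j) (if i = j then 1 else 0) x
      (EuclideanSpace.single i 1) := by
  have h := (EuclideanSpace.proj (𝕜 := ℝ) j : Space n →L[ℝ] ℝ).hasFDerivAt (x := x)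
  have h2 := h.hasLineDerivAt (EuclideanSpace.single i 1)
  convert! h2 using 1
  simp [eq_comm]

theorem IsWeight.hasLineDerivAt {A A' : ℝ → ℝ} (hA : IsWeight A A') (i : Fin n) (x : Space n) :
    HasLineDerivAt ℝ (fun y : Space n => A (‖y‖ ^ 2)) (A' (‖x‖ ^ 2) * (2 * x i)) x
      (EuclideanSpace.single i 1) := by
  have h : HasFDerivAt (fun y : Space n => ‖y‖ ^ 2) (2 • innerSL ℝ x) x :=
    (hasStrictFDerivAt_norm_sq x).hasFDerivAt
  have h2 := ((hA.hasDerivAt (‖x‖ ^ 2) (by positivity)).comp_hasFDerivAt x h).hasLineDerivAt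
    (EuclideanSpace.single i 1)
  convert! h2 using 1
  have e : (2 • innerSL ℝ x : Space n →L[ℝ] ℝ) (EuclideanSpace.single i 1) = 2 * x i := by
    rw [two_smul, add_apply, innerSL_apply_apply, real_inner_comm,
      EuclideanSpace.inner_single_left]
    simp [two_mul]
  rw [smul_apply, e, smul_eq_mul]

theorem HasLineDerivAt.mul' {f g : Space n → ℝ} {f' g' : ℝ} {x v : Space n}
    (hf : HasLineDerivAt ℝ f f' x v) (hg : HasLineDerivAt ℝ g g' x v) :
    HasLineDerivAt ℝ (fun y => f y * g y) (f' * g x + f x * g') x v := by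
  have := HasDerivAt.mul hf hg
  simpa [HasLineDerivAt] using! this

theorem pd_comm {u : Space n → ℝ} (hu : ContDiff ℝ ∞ u) (i j : Fin n) (x : Space n) :
    pd i (pd j u) x = pd j (pd i u) x := by
  have h1 : ∀ a b : Fin n, pd a (pd b u) x = fderiv ℝ (fderiv ℝ u) x
      (EuclideanSpace.single a 1) (EuclideanSpace.single b 1) := by
    intro a b
    have hd : DifferentiableAt ℝ (fderiv ℝ u) x :=
      ((hu.fderiv_right (m := ∞) (by simp)).differentiable (by simp)) x
    have : pd b u = fun y => fderiv ℝ u y (EuclideanSpace.single b 1) := rfl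
    rw [pd, this, fderiv_clm_apply hd (by fun_prop)]
    simp
  rw [h1, h1]
  exact ((hu.of_le (m := 2) (by norm_cast)).contDiffAt.isSymmSndFDerivAt (by simp)).eq _ _

theorem normSq_eq_sum (x : Space n) : ‖x‖ ^ 2 = ∑ i, x i ^ 2 := by
  rw [EuclideanSpace.norm_sq_eq]; simp

theorem euler_sq_le (u : Space n → ℝ) (x : Space n) :
    euler u x ^ 2 ≤ ‖x‖ ^ 2 * gradSq u x := by
  rw [normSq_eq_sum]
  exact Finset.sum_mul_sq_le_sq_mul_sq _ _ _

theorem gradSq_nonneg (u : Space n → ℝ) (x : Space n) : 0 ≤ gradSq u x :=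
  Finset.sum_nonneg fun _ _ => sq_nonneg _

/-! ### Multiplier identities -/

/-- The integrand is the divergence of `C(|x|²) u² x`. -/
theorem integral_weight_mul_euler {u : Space n → ℝ} (hu : ContDiff ℝ ∞ u) {C C' : ℝ → ℝ}
    (hC : IsWeight C C') :
    ∫ x : Space n, (2 * C (‖x‖ ^ 2) * (u x * euler u x) +
      (n * C (‖x‖ ^ 2) + 2 * ‖x‖ ^ 2 * C' (‖x‖ ^ 2)) * u x ^ 2) = 0 := by
  obtain ⟨T, hT⟩ := hC.eventually_zero
  have hc := hC.continuous (n := n)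
  have hc' := hC.continuous_deriv (n := n)
  have huc := hu.continuous
  rw [← integral_divergence_eq_zero (fun i x => C (‖x‖ ^ 2) * (x i * (u x * u x)))
    (fun i x => C' (‖x‖ ^ 2) * (2 * x i) * (x i * (u x * u x)) + C (‖x‖ ^ 2) *
      ((if i = i then 1 else 0) * (u x * u x) + x i * (pd i u x * u x + u x * pd i u x)))]
  · congr 1
    ext x
    have e (i : Fin n) : C' (‖x‖ ^ 2) * (2 * x i) * (x i * (u x * u x)) + C (‖x‖ ^ 2) *
        ((if i = i then 1 else 0) * (u x * u x) + x i * (pd i u x * u x + u x * pd i u x)) =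
        2 * C' (‖x‖ ^ 2) * u x ^ 2 * (x i ^ 2) + 2 * C (‖x‖ ^ 2) * u x * (x i * pd i u x) +
          C (‖x‖ ^ 2) * u x ^ 2 := by
      rw [if_pos rfl]; ring
    rw [Finset.sum_congr rfl fun i _ => e i]
    simp only [Finset.sum_add_distrib, ← Finset.mul_sum, ← normSq_eq_sum, Finset.sum_const,
      Finset.card_univ, Fintype.card_fin, nsmul_eq_mul]
    rw [euler]
    ring
  · intro i x
    exact HasLineDerivAt.mul' (hC.hasLineDerivAt i x) (HasLineDerivAt.mul'
      (hasLineDerivAt_coord i i x) (HasLineDerivAt.mul' (hasLineDerivAt_pd hu i x)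
        (hasLineDerivAt_pd hu i x)))
  · intro i
    exact integrable_of_normSq (T := T) (hc.mul (by fun_prop)) fun x hx => by simp [(hT _ hx).1]
  · intro i
    have := (pd_contDiff hu i).continuous
    exact integrable_of_normSq (T := T) (((hc'.mul (by fun_prop)).mul (by fun_prop)).add
      (hc.mul (by fun_prop))) fun x hx => by simp [(hT _ hx).1, (hT _ hx).2]

/-- The integrand is the divergence of `B(|x|²) u ∇u`. -/
theorem integral_weight_mul_lap {u : Space n → ℝ} (hu : ContDiff ℝ ∞ u) {B B' : ℝ → ℝ}
    (hB : IsWeight B B') :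
    ∫ x : Space n, (B (‖x‖ ^ 2) * (u x * lap u x) + B (‖x‖ ^ 2) * gradSq u x +
      2 * B' (‖x‖ ^ 2) * (u x * euler u x)) = 0 := by
  obtain ⟨T, hT⟩ := hB.eventually_zero
  have hc := hB.continuous (n := n)
  have hc' := hB.continuous_deriv (n := n)
  have huc := hu.continuous
  have h1 (i) := (pd_contDiff hu i).continuous
  have h2 (i) := (pd_contDiff (pd_contDiff hu i) i).continuous
  rw [← integral_divergence_eq_zero (fun i x => B (‖x‖ ^ 2) * (u x * pd i u x))
    (fun i x => B' (‖x‖ ^ 2) * (2 * x i) * (u x * pd i u x) + B (‖x‖ ^ 2) *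
      (pd i u x * pd i u x + u x * pd i (pd i u) x))]
  · congr 1
    ext x
    have e (i : Fin n) : B' (‖x‖ ^ 2) * (2 * x i) * (u x * pd i u x) + B (‖x‖ ^ 2) *
        (pd i u x * pd i u x + u x * pd i (pd i u) x) =
        2 * B' (‖x‖ ^ 2) * u x * (x i * pd i u x) + B (‖x‖ ^ 2) * (pd i u x ^ 2) +
          B (‖x‖ ^ 2) * u x * pd i (pd i u) x := by
      ring
    rw [Finset.sum_congr rfl fun i _ => e i]
    simp only [Finset.sum_add_distrib, ← Finset.mul_sum]
    rw [euler, lap, gradSq]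
    ring
  · intro i x
    exact HasLineDerivAt.mul' (hB.hasLineDerivAt i x) (HasLineDerivAt.mul'
      (hasLineDerivAt_pd hu i x) (hasLineDerivAt_pd (pd_contDiff hu i) i x))
  · intro i
    exact integrable_of_normSq (T := T) (hc.mul (huc.mul (h1 i))) fun x hx => by
      simp [(hT _ hx).1]
  · intro i
    exact integrable_of_normSq (T := T) (((hc'.mul (by fun_prop)).mul (huc.mul (h1 i))).add
      (hc.mul (((h1 i).mul (h1 i)).add (huc.mul (h2 i))))) fun x hx => by
        simp [(hT _ hx).1, (hT _ hx).2]

theorem hasLineDerivAt_sum {f : Fin n → Space n → ℝ} {f' : Fin n → ℝ} {x v : Space n}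
    (h : ∀ j, HasLineDerivAt ℝ (f j) (f' j) x v) :
    HasLineDerivAt ℝ (fun y => ∑ j, f j y) (∑ j, f' j) x v := by
  have := HasDerivAt.fun_sum (u := Finset.univ) fun j _ => h j
  simpa [HasLineDerivAt] using! this

/-- The Rellich identity. -/
theorem integral_weight_mul_lap_mul_euler {u : Space n → ℝ} (hu : ContDiff ℝ ∞ u)
    {A A' : ℝ → ℝ} (hA : IsWeight A A') :
    ∫ x : Space n, (2 * A (‖x‖ ^ 2) * (lap u x * euler u x) -
      ((n - 2) * A (‖x‖ ^ 2) + 2 * ‖x‖ ^ 2 * A' (‖x‖ ^ 2)) * gradSq u x +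
      4 * A' (‖x‖ ^ 2) * euler u x ^ 2) = 0 := by
  obtain ⟨T, hT⟩ := hA.eventually_zero
  have hc := hA.continuous (n := n)
  have hc' := hA.continuous_deriv (n := n)
  have h1 (i) := (pd_contDiff hu i).continuous
  have h2 (i j) := (pd_contDiff (pd_contDiff hu i) j).continuous
  have he := euler_continuous hu
  have hg := gradSq_continuous hu
  have hde (i : Fin n) (x : Space n) : HasLineDerivAt ℝ (euler u)
      (pd i u x + ∑ j, x j * pd i (pd j u) x) x (EuclideanSpace.single i 1) := by
    have := hasLineDerivAt_sum (x := x) (v := EuclideanSpace.single i 1) fun j =>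
      HasLineDerivAt.mul' (hasLineDerivAt_coord i j x)
        (hasLineDerivAt_pd (pd_contDiff hu j) i x)
    convert! this using 1
    rw [Finset.sum_add_distrib]
    simp
  have hdg (i : Fin n) (x : Space n) : HasLineDerivAt ℝ (gradSq u)
      (2 * ∑ j, pd j u x * pd i (pd j u) x) x (EuclideanSpace.single i 1) := by
    have := hasLineDerivAt_sum (x := x) (v := EuclideanSpace.single i 1) fun j =>
      HasLineDerivAt.mul' (hasLineDerivAt_pd (pd_contDiff hu j) i x)
        (hasLineDerivAt_pd (pd_contDiff hu j) i x)
    convert! this using 1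
    · ext y; simp [gradSq, sq]
    · rw [Finset.mul_sum]
      exact Finset.sum_congr rfl fun j _ => by ring
  have hce (i : Fin n) : Continuous fun x : Space n =>
      pd i u x + ∑ j, x j * pd i (pd j u) x := by
    refine (h1 i).add (continuous_finsetSum _ fun j _ => Continuous.mul (by fun_prop) (h2 j i))
  have hcg (i : Fin n) : Continuous fun x : Space n =>
      2 * ∑ j, pd j u x * pd i (pd j u) x :=
    continuous_const.mul (continuous_finsetSum _ fun j _ => (h1 j).mul (h2 j i))
  -- The field behind the identity is `A (2 (x·∇u) ∇u - |∇u|² x)`.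
  have hJ (i : Fin n) (x : Space n) : HasLineDerivAt ℝ
      (fun y => 2 * (euler u y * pd i u y) - gradSq u y * y i)
      (2 * ((pd i u x + ∑ j, x j * pd i (pd j u) x) * pd i u x + euler u x * pd i (pd i u) x) -
        ((2 * ∑ j, pd j u x * pd i (pd j u) x) * x i + gradSq u x * if i = i then 1 else 0))
      x (EuclideanSpace.single i 1) := by
    have := HasDerivAt.sub (HasDerivAt.const_mul 2 (HasLineDerivAt.mul' (hde i x)
      (hasLineDerivAt_pd (pd_contDiff hu i) i x)))
      (HasLineDerivAt.mul' (hdg i x) (hasLineDerivAt_coord i i x))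
    exact this
  rw [← integral_divergence_eq_zero _ _
    (fun i x => HasLineDerivAt.mul' (hA.hasLineDerivAt i x) (hJ i x))]
  · congr 1
    ext x
    have e (i : Fin n) : A' (‖x‖ ^ 2) * (2 * x i) * (2 * (euler u x * pd i u x) -
        gradSq u x * x i) + A (‖x‖ ^ 2) * (2 * ((pd i u x + ∑ j, x j * pd i (pd j u) x) *
        pd i u x + euler u x * pd i (pd i u) x) - ((2 * ∑ j, pd j u x * pd i (pd j u) x) * x i +
        gradSq u x * if i = i then 1 else 0)) =
        4 * A' (‖x‖ ^ 2) * euler u x * (x i * pd i u x) -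
          2 * A' (‖x‖ ^ 2) * gradSq u x * (x i ^ 2) + 2 * A (‖x‖ ^ 2) * (pd i u x ^ 2) +
          2 * A (‖x‖ ^ 2) * (∑ j, x j * pd i u x * pd i (pd j u) x) -
          2 * A (‖x‖ ^ 2) * (∑ j, x i * pd j u x * pd i (pd j u) x) +
          2 * A (‖x‖ ^ 2) * euler u x * pd i (pd i u) x - A (‖x‖ ^ 2) * gradSq u x := by
      have e1 : ∑ j, x j * pd i u x * pd i (pd j u) x =
          (∑ j, x j * pd i (pd j u) x) * pd i u x := by
        rw [Finset.sum_mul]; exact Finset.sum_congr rfl fun j _ => by ring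
      have e2 : ∑ j, x i * pd j u x * pd i (pd j u) x =
          (∑ j, pd j u x * pd i (pd j u) x) * x i := by
        rw [Finset.sum_mul]; exact Finset.sum_congr rfl fun j _ => by ring
      rw [if_pos rfl, e1, e2]; ring
    rw [Finset.sum_congr rfl fun i _ => e i]
    -- Symmetry of the Hessian: the two contributions `∇u · D²u x` cancel, so `Δu` is the only
    -- second-order quantity left.
    have e3 : ∑ i, ∑ j, x i * pd j u x * pd i (pd j u) x =
        ∑ i, ∑ j, x j * pd i u x * pd i (pd j u) x := by
      rw [Finset.sum_comm]
      exact Finset.sum_congr rfl fun i _ => Finset.sum_congr rfl fun j _ => by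
        rw [pd_comm hu]
    simp only [Finset.sum_add_distrib, Finset.sum_sub_distrib, ← Finset.mul_sum,
      ← normSq_eq_sum, Finset.sum_const, Finset.card_univ, Fintype.card_fin, nsmul_eq_mul, e3]
    rw [← euler, ← lap, ← gradSq]
    ring
  · intro i
    exact integrable_of_normSq (T := T) (hc.mul ((continuous_const.mul (he.mul (h1 i))).sub
      (hg.mul (by fun_prop)))) fun x hx => by simp [(hT _ hx).1]
  · intro i
    exact integrable_of_normSq (T := T) (((hc'.mul (by fun_prop)).mul
      ((continuous_const.mul (he.mul (h1 i))).sub (hg.mul (by fun_prop)))).add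
      (hc.mul ((continuous_const.mul (((hce i).mul (h1 i)).add (he.mul (h2 i i)))).sub
        (((hcg i).mul (by fun_prop)).add (hg.mul continuous_const))))) fun x hx => by
        simp [(hT _ hx).1, (hT _ hx).2]

theorem IsWeight.integrable_mul {A A' : ℝ → ℝ} (hA : IsWeight A A') {g : Space n → ℝ}
    (hg : Continuous g) : Integrable fun x : Space n => A (‖x‖ ^ 2) * g x := by
  obtain ⟨T, hT⟩ := hA.eventually_zero
  exact integrable_of_normSq (T := T) (hA.continuous.mul hg) fun x hx => by simp [(hT _ hx).1]

theorem IsWeight.integrable_deriv_mul {A A' : ℝ → ℝ} (hA : IsWeight A A') {g : Space n → ℝ}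
    (hg : Continuous g) : Integrable fun x : Space n => A' (‖x‖ ^ 2) * g x := by
  obtain ⟨T, hT⟩ := hA.eventually_zero
  exact integrable_of_normSq (T := T) (hA.continuous_deriv.mul hg)
    fun x hx => by simp [(hT _ hx).2]

theorem integral_comb_eq_zero {f g h : Space n → ℝ} (hf : Integrable f) (hg : Integrable g)
    (hh : Integrable h) (c : ℝ) (ef : ∫ x, f x = 0) (eg : ∫ x, g x = 0) (eh : ∫ x, h x = 0) :
    Integrable (fun x => -f x - c * g x - h x) ∧ ∫ x, (-f x - c * g x - h x) = 0 := by
  have h1 : Integrable fun x => -f x := hf.neg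
  have h2 : Integrable fun x => c * g x := hg.const_mul c
  have h3 : Integrable fun x => -f x - c * g x := h1.sub h2
  refine ⟨h3.sub hh, ?_⟩
  rw [integral_sub h3 hh, integral_sub h1 h2, integral_neg, integral_const_mul, ef, eg,
    eh]
  simp

/-- The virial identity for the multiplier `2 A (x · ∇u + κ u)`. -/
theorem integral_virial {u : Space n → ℝ} (hu : ContDiff ℝ ∞ u) {A A' Q Q' : ℝ → ℝ}
    (hA : IsWeight A A') (hQ : ∀ t, 0 ≤ t → HasDerivAt Q (Q' t) t)
    (hQ' : ContinuousOn Q' (Set.Ici 0)) (κ : ℝ) :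
    Integrable (fun x : Space n =>
      ((n - 2 - 2 * κ) * A (‖x‖ ^ 2) + 2 * ‖x‖ ^ 2 * A' (‖x‖ ^ 2)) * gradSq u x
      - 4 * A' (‖x‖ ^ 2) * euler u x ^ 2 - 4 * κ * A' (‖x‖ ^ 2) * (u x * euler u x)
      + ((2 * κ - n) * (A (‖x‖ ^ 2) * Q (‖x‖ ^ 2)) - 2 * ‖x‖ ^ 2 *
        (A' (‖x‖ ^ 2) * Q (‖x‖ ^ 2) + A (‖x‖ ^ 2) * Q' (‖x‖ ^ 2))) * u x ^ 2
      - 2 * A (‖x‖ ^ 2) * ((lap u x + Q (‖x‖ ^ 2) * u x) * (euler u x + κ * u x))) ∧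
    ∫ x : Space n,
      (((n - 2 - 2 * κ) * A (‖x‖ ^ 2) + 2 * ‖x‖ ^ 2 * A' (‖x‖ ^ 2)) * gradSq u x
      - 4 * A' (‖x‖ ^ 2) * euler u x ^ 2 - 4 * κ * A' (‖x‖ ^ 2) * (u x * euler u x)
      + ((2 * κ - n) * (A (‖x‖ ^ 2) * Q (‖x‖ ^ 2)) - 2 * ‖x‖ ^ 2 *
        (A' (‖x‖ ^ 2) * Q (‖x‖ ^ 2) + A (‖x‖ ^ 2) * Q' (‖x‖ ^ 2))) * u x ^ 2
      - 2 * A (‖x‖ ^ 2) * ((lap u x + Q (‖x‖ ^ 2) * u x) * (euler u x + κ * u x))) = 0 := by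
  have hC := hA.mul hQ hQ'
  have huc := hu.continuous
  have he := euler_continuous hu
  have hg := gradSq_continuous hu
  have hl := lap_continuous hu
  have i1 : Integrable fun x : Space n => 2 * A (‖x‖ ^ 2) * (lap u x * euler u x) -
      ((n - 2) * A (‖x‖ ^ 2) + 2 * ‖x‖ ^ 2 * A' (‖x‖ ^ 2)) * gradSq u x +
      4 * A' (‖x‖ ^ 2) * euler u x ^ 2 := by
    refine ((hA.integrable_mul (g := fun x => 2 * (lap u x * euler u x) - (n - 2) * gradSq u x)
      (by fun_prop)).add (hA.integrable_deriv_mul (g := fun x => 4 * euler u x ^ 2 -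
        2 * ‖x‖ ^ 2 * gradSq u x) (by fun_prop))).congr (ae_of_all _ fun x => ?_)
    simp only [Pi.add_apply]
    ring
  have i2 : Integrable fun x : Space n => A (‖x‖ ^ 2) * (u x * lap u x) +
      A (‖x‖ ^ 2) * gradSq u x + 2 * A' (‖x‖ ^ 2) * (u x * euler u x) := by
    refine ((hA.integrable_mul (g := fun x => u x * lap u x + gradSq u x)
      (by fun_prop)).add (hA.integrable_deriv_mul (g := fun x => 2 * (u x * euler u x))
        (by fun_prop))).congr (ae_of_all _ fun x => ?_)
    simp only [Pi.add_apply]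
    ring
  have i3 : Integrable fun x : Space n => 2 * (A (‖x‖ ^ 2) * Q (‖x‖ ^ 2)) *
      (u x * euler u x) + (n * (A (‖x‖ ^ 2) * Q (‖x‖ ^ 2)) + 2 * ‖x‖ ^ 2 *
      (A' (‖x‖ ^ 2) * Q (‖x‖ ^ 2) + A (‖x‖ ^ 2) * Q' (‖x‖ ^ 2))) * u x ^ 2 := by
    refine ((hC.integrable_mul (g := fun x => 2 * (u x * euler u x) + n * u x ^ 2)
      (by fun_prop)).add (hC.integrable_deriv_mul (g := fun x => 2 * ‖x‖ ^ 2 * u x ^ 2)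
        (by fun_prop))).congr (ae_of_all _ fun x => ?_)
    simp only [Pi.add_apply]
    ring
  -- Minus the Rellich identity, minus `2κ` times the identity with `B = A`, minus the one with `C =
  -- A Q`; the last exchanges `A Q u (x·∇u)` for a derivative of the weight.
  obtain ⟨k1, k2⟩ := integral_comb_eq_zero i1 i2 i3 (2 * κ)
    (integral_weight_mul_lap_mul_euler hu hA) (integral_weight_mul_lap hu hA)
    (integral_weight_mul_euler hu hC)
  constructor
  · refine k1.congr (ae_of_all _ fun x => ?_)
    simp only
    ring
  · rw [← k2]
    congr 1
    ext x
    ring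

/-! ### The Caccioppoli estimate -/

/-- The residual `-Δu - Q u + V u`. -/
def residual (V : Space n → ℝ) (Q : ℝ → ℝ) (u : Space n → ℝ) (x : Space n) : ℝ :=
  V x * u x - (lap u x + Q (‖x‖ ^ 2) * u x)

theorem integrable_mul_residual_sq {u : Space n → ℝ} (hu : ContDiff ℝ ∞ u)
    {V : Space n → ℝ} (hVm : AEStronglyMeasurable V) {M : ℝ} (hV : ∀ᵐ x, |V x| ≤ M)
    {Q : ℝ → ℝ} (hQ : ContinuousOn Q (Set.Ici 0)) {w : Space n → ℝ} (hw : Continuous w) {T : ℝ}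
    (hT : ∀ x, T ≤ ‖x‖ ^ 2 → w x = 0) :
    Integrable fun x => w x * residual V Q u x ^ 2 := by
  have hQc := continuous_comp_normSq (n := n) hQ
  have huc := hu.continuous
  have hl := lap_continuous hu
  have i1 : Integrable fun x => w x * u x ^ 2 :=
    integrable_of_normSq (T := T) (by fun_prop) fun x hx => by simp [hT x hx]
  have i2 : Integrable fun x => w x * (u x * (lap u x + Q (‖x‖ ^ 2) * u x)) :=
    integrable_of_normSq (T := T) (hw.mul (huc.mul (hl.add (hQc.mul huc))))
      fun x hx => by simp [hT x hx]
  have i3 : Integrable fun x => w x * (lap u x + Q (‖x‖ ^ 2) * u x) ^ 2 :=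
    integrable_of_normSq (T := T) (hw.mul ((hl.add (hQc.mul huc)).pow 2))
      fun x hx => by simp [hT x hx]
  have j2 := i2.bdd_mul hVm hV
  have j1 := (i1.bdd_mul hVm hV).bdd_mul hVm hV
  refine ((j1.sub (j2.const_mul 2)).add i3).congr (ae_of_all _ fun x => ?_)
  simp only [Pi.sub_apply, Pi.add_apply, residual]
  ring

theorem two_mul_le_of_sq_le {a b c : ℝ} (ha : 0 ≤ a) (hb : 0 ≤ b) (h : c ^ 2 ≤ a * b) :
    2 * |c| ≤ a + b := by
  have h4 : (2 * |c|) ^ 2 ≤ (a + b) ^ 2 := by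
    rw [mul_pow, sq_abs]; nlinarith [sq_nonneg (a - b)]
  exact (abs_le_of_sq_le_sq' h4 (by positivity)).2

theorem isCompact_normSq_Icc (a b : ℝ) : IsCompact {x : Space n | ‖x‖ ^ 2 ∈ Set.Icc a b} := by
  refine (isCompact_closedBall (0 : Space n) (Real.sqrt b)).of_isClosed_subset
    (isClosed_Icc.preimage (by fun_prop)) fun x hx => ?_
  rw [mem_closedBall_zero_iff]
  exact Real.le_sqrt_of_sq_le hx.2

/-- The equation is tested with `B u`. The condition `B'² t ≤ B D`, satisfied when `B` contains the
square of a cutoff, makes the cross term `B' u (x·∇u)` absorbable into `B |∇u|²`. -/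
theorem caccioppoli {u : Space n → ℝ} (hu : ContDiff ℝ ∞ u)
    {V : Space n → ℝ} (hVm : AEStronglyMeasurable V) {M : ℝ} (hV : ∀ᵐ x, |V x| ≤ M)
    {Q : ℝ → ℝ} (hQ : ContinuousOn Q (Set.Ici 0)) {B B' : ℝ → ℝ} (hB : IsWeight B B')
    {a b C D : ℝ} (hD : 0 ≤ D) (hB0 : ∀ t, 0 ≤ t → 0 ≤ B t)
    (hsupp : ∀ t, 0 ≤ t → t ∉ Set.Icc a b → B t = 0 ∧ B' t = 0)
    (hBD : ∀ t ∈ Set.Icc a b, 0 ≤ t → B' t ^ 2 * t ≤ B t * D)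
    (hBC : ∀ t ∈ Set.Icc a b, 0 ≤ t → B t * (1 + 2 * |Q t| + 2 * M) + 4 * D ≤ C) :
    ∫ x, B (‖x‖ ^ 2) * gradSq u x ≤ (∫ x, B (‖x‖ ^ 2) * residual V Q u x ^ 2) +
      C * ∫ x in {x : Space n | ‖x‖ ^ 2 ∈ Set.Icc a b}, u x ^ 2 := by
  obtain ⟨T, hT⟩ := hB.eventually_zero
  have huc := hu.continuous
  have he := euler_continuous hu
  have hg := gradSq_continuous hu
  have hl := lap_continuous hu
  have i1 := hB.integrable_mul hg
  have i2 : Integrable fun x : Space n => B (‖x‖ ^ 2) * (u x * lap u x) +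
      B (‖x‖ ^ 2) * gradSq u x + 2 * B' (‖x‖ ^ 2) * (u x * euler u x) := by
    refine ((hB.integrable_mul (g := fun x => u x * lap u x + gradSq u x)
      (by fun_prop)).add (hB.integrable_deriv_mul (g := fun x => 2 * (u x * euler u x))
        (by fun_prop))).congr (ae_of_all _ fun x => ?_)
    simp only [Pi.add_apply]
    ring
  have i3 := integrable_mul_residual_sq hu hVm hV hQ (hB.continuous (n := n)) (T := T)
    fun x hx => (hT _ hx).1
  have hK := isCompact_normSq_Icc (n := n) a b
  have i4 : IntegrableOn (fun x => u x ^ 2) {x : Space n | ‖x‖ ^ 2 ∈ Set.Icc a b} :=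
    (huc.pow 2).continuousOn.integrableOn_compact hK
  have i5 := (integrable_indicator_iff hK.measurableSet).mpr i4
  have h0 := integral_weight_mul_lap hu hB
  rw [← integral_indicator hK.measurableSet, ← integral_const_mul, ← integral_add i3
    (i5.const_mul C)]
  -- Subtracting the null integral twice leaves `-B |∇u|²` on the right, exactly what the cross term
  -- consumes in `k1`.
  have : ∫ x, B (‖x‖ ^ 2) * gradSq u x = ∫ x, (B (‖x‖ ^ 2) * gradSq u x - 2 *
      (B (‖x‖ ^ 2) * (u x * lap u x) + B (‖x‖ ^ 2) * gradSq u x +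
        2 * B' (‖x‖ ^ 2) * (u x * euler u x))) := by
    rw [integral_sub i1 (i2.const_mul 2), integral_const_mul, h0]; simp
  rw [this]
  refine integral_mono_ae (i1.sub (i2.const_mul 2)) (i3.add (i5.const_mul C)) ?_
  filter_upwards [hV] with x hx
  have ht : 0 ≤ ‖x‖ ^ 2 := by positivity
  by_cases hmem : ‖x‖ ^ 2 ∈ Set.Icc a b
  · have hind : Set.indicator {x : Space n | ‖x‖ ^ 2 ∈ Set.Icc a b} (fun x => u x ^ 2) x
        = u x ^ 2 := Set.indicator_of_mem (s := {x : Space n | ‖x‖ ^ 2 ∈ Set.Icc a b}) hmem _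
    simp only [hind]
    have hes := euler_sq_le u x
    have hGn := gradSq_nonneg u x
    have hb0 := hB0 _ ht
    have h1 := hBD _ hmem ht
    have h2 := hBC _ hmem ht
    have hf : lap u x = V x * u x - Q (‖x‖ ^ 2) * u x - residual V Q u x := by
      rw [residual]; ring
    rw [hf]
    generalize residual V Q u x = f at *
    generalize ‖x‖ ^ 2 = t at *
    generalize gradSq u x = G at *
    generalize euler u x = p at *
    generalize u x = v at *
    have k1 : 2 * |2 * B' t * (v * p)| ≤ B t * G + 4 * D * v ^ 2 := by
      apply two_mul_le_of_sq_le (by positivity) (by positivity)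
      calc (2 * B' t * (v * p)) ^ 2 = 4 * B' t ^ 2 * v ^ 2 * p ^ 2 := by ring
        _ ≤ 4 * B' t ^ 2 * v ^ 2 * (t * G) := by gcongr
        _ = 4 * v ^ 2 * G * (B' t ^ 2 * t) := by ring
        _ ≤ 4 * v ^ 2 * G * (B t * D) := by gcongr
        _ = _ := by ring
    have k1' := neg_abs_le (2 * B' t * (v * p))
    have k2 : 2 * (v * f) ≤ v ^ 2 + f ^ 2 := by nlinarith [sq_nonneg (v - f)]
    have k3 : Q t ≤ |Q t| := le_abs_self _
    have k4 : -V x ≤ M := (neg_le_abs _).trans hx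
    have k5 : (B t * (1 + 2 * |Q t| + 2 * M) + 4 * D) * v ^ 2 ≤ C * v ^ 2 := by gcongr
    have k6 : B t * v ^ 2 * Q t ≤ B t * v ^ 2 * |Q t| := by gcongr
    have k7 : B t * v ^ 2 * (-V x) ≤ B t * v ^ 2 * M := by gcongr
    have k8 : B t * (2 * (v * f)) ≤ B t * (v ^ 2 + f ^ 2) := by gcongr
    linarith
  · have hind : Set.indicator {x : Space n | ‖x‖ ^ 2 ∈ Set.Icc a b} (fun x => u x ^ 2) x
        = 0 := Set.indicator_of_notMem (s := {x : Space n | ‖x‖ ^ 2 ∈ Set.Icc a b}) hmem _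
    simp only [hind, (hsupp _ ht hmem).1, (hsupp _ ht hmem).2]
    simp

/-! ### The flux and its monotonicity -/

/-- The potential `⟨x⟩^α + E` as a function of `t = |x|²`. -/
def potential (α E t : ℝ) : ℝ := (1 + t) ^ (α / 2) + E

/-- The derivative of `potential`. -/
def potentialDeriv (α t : ℝ) : ℝ := α / 2 * (1 + t) ^ (α / 2 - 1)

/-- The weight `⟨x⟩^{-α/2-1} ln ⟨x⟩²` as a function of `t = |x|²`. -/
def fluxWeight (α t : ℝ) : ℝ := (1 + t) ^ (-α / 4 - 1 / 2) * Real.log (1 + t)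

/-- The derivative of `fluxWeight`. -/
def fluxWeightDeriv (α t : ℝ) : ℝ :=
  (1 + t) ^ (-α / 4 - 1 / 2) * ((1 - (α / 4 + 1 / 2) * Real.log (1 + t)) / (1 + t))

/-- The constant of the zeroth order term in the multiplier. -/
def fluxConst (n : ℕ) (α : ℝ) : ℝ := (n - 1) / 2 + α / 4

/-- The radial flux density of `u`. -/
def flux (α E : ℝ) (u : Space n → ℝ) (x : Space n) : ℝ :=
  4 * euler u x ^ 2 + 4 * fluxConst n α * (u x * euler u x) +
    2 * ‖x‖ ^ 2 * potential α E (‖x‖ ^ 2) * u x ^ 2 - 2 * ‖x‖ ^ 2 * gradSq u x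

/-- The weight of the residual in the monotonicity formula. -/
def fluxResidualWeight (n : ℕ) (α t : ℝ) : ℝ :=
  (1 + t) ^ (-α / 4 - 1 / 2) * (Real.log (1 + t) ^ 2 * (4 * (1 + t) + fluxConst n α ^ 2))

theorem hasDerivAt_potential (α E : ℝ) {t : ℝ} (ht : 0 ≤ t) :
    HasDerivAt (potential α E) (potentialDeriv α t) t := by
  have h1 : HasDerivAt (fun t : ℝ => 1 + t) 1 t := (hasDerivAt_id t).const_add 1
  have := (h1.rpow_const (p := α / 2) (Or.inl (by positivity))).add_const E
  convert! this using 1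
  rw [potentialDeriv]; ring

theorem continuousOn_rpow_one_add (β : ℝ) :
    ContinuousOn (fun t : ℝ => (1 + t) ^ β) (Set.Ici 0) := by
  refine ContinuousOn.rpow_const (by fun_prop) fun t ht => Or.inl ?_
  have : 0 ≤ t := ht
  positivity

theorem continuousOn_log_one_add : ContinuousOn (fun t : ℝ => Real.log (1 + t)) (Set.Ici 0) := by
  refine ContinuousOn.log (by fun_prop) fun t ht => ?_
  have : 0 ≤ t := ht
  positivity

theorem continuousOn_potential (α E : ℝ) : ContinuousOn (potential α E) (Set.Ici 0) :=
  (continuousOn_rpow_one_add _).add continuousOn_const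

theorem continuousOn_potentialDeriv (α : ℝ) : ContinuousOn (potentialDeriv α) (Set.Ici 0) :=
  continuousOn_const.mul (continuousOn_rpow_one_add _)

theorem hasDerivAt_fluxWeight (α : ℝ) {t : ℝ} (ht : 0 ≤ t) :
    HasDerivAt (fluxWeight α) (fluxWeightDeriv α t) t := by
  have h1 : HasDerivAt (fun t : ℝ => 1 + t) 1 t := (hasDerivAt_id t).const_add 1
  have hs : (1 + t) ≠ 0 := by positivity
  have := (h1.rpow_const (p := -α / 4 - 1 / 2) (Or.inl hs)).mul (h1.log hs)
  convert! this using 1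
  rw [fluxWeightDeriv, Real.rpow_sub_one hs]
  field_simp
  ring

theorem continuousOn_fluxWeight (α : ℝ) : ContinuousOn (fluxWeight α) (Set.Ici 0) :=
  (continuousOn_rpow_one_add _).mul continuousOn_log_one_add

theorem continuousOn_fluxWeightDeriv (α : ℝ) : ContinuousOn (fluxWeightDeriv α) (Set.Ici 0) := by
  refine (continuousOn_rpow_one_add _).mul (ContinuousOn.div (continuousOn_const.sub
    (continuousOn_const.mul continuousOn_log_one_add)) (by fun_prop) fun t ht => ?_)
  have : 0 ≤ t := ht
  positivity

theorem continuousOn_fluxResidualWeight (α : ℝ) :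
    ContinuousOn (fluxResidualWeight n α) (Set.Ici 0) :=
  (continuousOn_rpow_one_add _).mul ((continuousOn_log_one_add.pow 2).mul (by fun_prop))

/-- In the application `r = 1/s`, `ℓ = ln s`, `Y = s^{α/2}`, the letters `v, p, G, f` stand for `u`,
`x·∇u`, `|∇u|²` and the residual, and the power `s^{-α/4-1/2}` has been divided out. After `r p² ≤
(1 - r) G` the gradient terms are at most `-2(1-r) G`, and the terms in `Y` are at most `-2(1-r) Y
v²`. Since `r ≤ 1/2`, this leaves a full `-G` and `-Y v²` to absorb `E`, `V`, the cross term and the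
residual. -/
theorem flux_bulk_le {α t s r ℓ Y E κ M V v p G f : ℝ} (hα₀ : 0 < α) (hα₂ : α ≤ 2)
    (hs : s = 1 + t) (ht : 1 ≤ t) (hr : r * s = 1) (hG : 0 ≤ G) (hp : p ^ 2 ≤ t * G)
    (hℓ : 2 ≤ ℓ) (hℓs : ℓ ^ 2 ≤ s) (hκ : 0 ≤ κ) (hM : |V| ≤ M)
    (hY : (4 * |E| + 2 * κ * M + 16 * κ ^ 2 + 1) * (ℓ + 1) ≤ Y / 2)
    (hV : V ^ 2 * s * ℓ ^ 2 ≤ Y / 16) :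
    -(1 + α / 2) * ℓ * G + t * r * (2 - (1 + α / 2) * ℓ) * G
      - 2 * (2 - (1 + α / 2) * ℓ) * r * p ^ 2 - 2 * κ * (2 - (1 + α / 2) * ℓ) * r * (v * p)
      + ((α / 2 - 1) * ℓ * (Y + E) - t * r * (2 - (1 + α / 2) * ℓ) * (Y + E)
        - α * ℓ * (t * r) * Y) * v ^ 2 - 2 * ℓ * ((V * v - f) * (p + κ * v)) ≤
    ℓ ^ 2 * (4 * s + κ ^ 2) * f ^ 2 := by
  have hs2 : 2 ≤ s := by linarith
  have hr0 : 0 < r := pos_of_mul_pos_left (by rw [hr]; exact one_pos) (by linarith)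
  have hr1 : r ≤ 1 / 2 := by
    have := mul_le_mul_of_nonneg_left hs2 hr0.le
    linarith
  have htr : t * r = 1 - r := by rw [← hr, hs]; ring
  have hM0 : 0 ≤ M := (abs_nonneg V).trans hM
  have hY0 : 0 ≤ Y := by
    have : 0 ≤ (4 * |E| + 2 * κ * M + 16 * κ ^ 2 + 1) * (ℓ + 1) := by positivity
    linarith
  set m := 1 + α / 2 with hm
  have hm1 : 1 ≤ m := by linarith
  have hm2 : m ≤ 2 := by linarith
  have hmℓ : 2 ≤ m * ℓ := by
    have := mul_le_mul_of_nonneg_right hm1 (by linarith : 0 ≤ ℓ)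
    linarith
  have hp' : p ^ 2 ≤ s * G := hp.trans (by gcongr; linarith)
  have hv : 0 ≤ v ^ 2 := sq_nonneg v
  -- radial part of the gradient
  have g1 : (m * ℓ - 2) * (r * p ^ 2) ≤ (m * ℓ - 2) * ((1 - r) * G) := by
    have : r * p ^ 2 ≤ (1 - r) * G := by
      rw [← htr]
      calc r * p ^ 2 ≤ r * (t * G) := by gcongr
        _ = _ := by ring
    exact mul_le_mul_of_nonneg_left this (by linarith)
  have g2 : 0 ≤ m * ℓ * r * G := by positivity
  have g3 : r * G ≤ G / 2 := by
    have := mul_le_mul_of_nonneg_right hr1 hG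
    linarith only [this]
  -- cross term
  have c1 : 2 * |κ * (2 - m * ℓ) * r * (v * p)| ≤ G / 4 + 16 * κ ^ 2 * v ^ 2 := by
    apply two_mul_le_of_sq_le (by positivity) (by positivity)
    -- The factor `r = 1/s` beats the square of the logarithm.
    have h1 : (m * ℓ - 2) ^ 2 * r ≤ 4 := by
      have h2 : (m * ℓ - 2) ^ 2 ≤ 4 * s := by
        have h3 : m * ℓ - 2 ≤ 2 * ℓ := by
          have := mul_le_mul_of_nonneg_right hm2 (by linarith : 0 ≤ ℓ)
          linarith only [this]
        have h4 := pow_le_pow_left₀ (by linarith : 0 ≤ m * ℓ - 2) h3 2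
        linarith only [h4, hℓs]
      calc (m * ℓ - 2) ^ 2 * r ≤ 4 * s * r := by gcongr
        _ = 4 := by linear_combination 4 * hr
    calc (κ * (2 - m * ℓ) * r * (v * p)) ^ 2
        = κ ^ 2 * ((m * ℓ - 2) ^ 2 * r) * v ^ 2 * (r * p ^ 2) := by ring
      _ ≤ κ ^ 2 * 4 * v ^ 2 * (r * (s * G)) := by gcongr
      _ = G / 4 * (16 * κ ^ 2 * v ^ 2) := by linear_combination (κ ^ 2 * 4 * v ^ 2 * G) * hr
  have c1' := neg_abs_le (κ * (2 - m * ℓ) * r * (v * p))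
  -- potential terms
  have d1 : 2 * |ℓ * V * (v * p)| ≤ G / 4 + Y / 4 * v ^ 2 := by
    apply two_mul_le_of_sq_le (by positivity) (by positivity)
    calc (ℓ * V * (v * p)) ^ 2 = ℓ ^ 2 * V ^ 2 * v ^ 2 * p ^ 2 := by ring
      _ ≤ ℓ ^ 2 * V ^ 2 * v ^ 2 * (s * G) := by gcongr
      _ = (V ^ 2 * s * ℓ ^ 2) * (v ^ 2 * G) := by ring
      _ ≤ (Y / 16) * (v ^ 2 * G) := by gcongr
      _ = _ := by ring
  have d1' := neg_abs_le (ℓ * V * (v * p))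
  have d2 : -(ℓ * κ * V * v ^ 2) ≤ ℓ * κ * M * v ^ 2 := by
    have : -V ≤ M := (neg_le_abs _).trans hM
    calc -(ℓ * κ * V * v ^ 2) = ℓ * κ * v ^ 2 * (-V) := by ring
      _ ≤ ℓ * κ * v ^ 2 * M := by gcongr
      _ = _ := by ring
  -- residual terms
  have f1 : 2 * |ℓ * (f * p)| ≤ G / 4 + 4 * s * ℓ ^ 2 * f ^ 2 := by
    apply two_mul_le_of_sq_le (by positivity) (by positivity)
    calc (ℓ * (f * p)) ^ 2 = ℓ ^ 2 * f ^ 2 * p ^ 2 := by ring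
      _ ≤ ℓ ^ 2 * f ^ 2 * (s * G) := by gcongr
      _ = _ := by ring
  have f1' := le_abs_self (ℓ * (f * p))
  have f2 : 2 * (ℓ * κ * f * v) ≤ v ^ 2 + ℓ ^ 2 * κ ^ 2 * f ^ 2 := by
    linarith only [sq_nonneg (v - ℓ * κ * f)]
  -- zeroth order
  have z1 : ((α / 2 - 1) * ℓ * (Y + E) - t * r * (2 - m * ℓ) * (Y + E) - α * ℓ * (t * r) * Y) ≤
      -Y + 4 * |E| * (ℓ + 1) := by
    rw [htr]
    -- At `r = 0` the coefficient of `ℓ Y` is `(α/2 - 1) + m - α = 0`; only `-2Y` survives.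
    have e1 : (α / 2 - 1) * ℓ * (Y + E) - (1 - r) * (2 - m * ℓ) * (Y + E) -
        α * ℓ * (1 - r) * Y = -2 * Y + 2 * (r * Y) + (α / 2 - 1) * (ℓ * r * Y) +
          ((α / 2 - 1) * ℓ - (1 - r) * (2 - m * ℓ)) * E := by
      rw [hm]; ring
    rw [e1]
    have e2 : r * Y ≤ Y / 2 := by
      have := mul_le_mul_of_nonneg_right hr1 hY0
      linarith only [this]
    have e3 : (α / 2 - 1) * (ℓ * r * Y) ≤ 0 :=
      mul_nonpos_of_nonpos_of_nonneg (by linarith) (by positivity)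
    have e4 : |(α / 2 - 1) * ℓ - (1 - r) * (2 - m * ℓ)| ≤ 4 * (ℓ + 1) := by
      rw [abs_le]
      have q1 : 0 ≤ (1 - r) * (m * ℓ - 2) := mul_nonneg (by linarith) (by linarith)
      have q2 : (1 - r) * (m * ℓ - 2) ≤ 1 * (m * ℓ - 2) := by gcongr; linarith
      have q3 : m * ℓ ≤ 2 * ℓ := by gcongr
      have q4 : 0 ≤ (1 - α / 2) * ℓ := mul_nonneg (by linarith) (by linarith)
      have q5 : (1 - α / 2) * ℓ ≤ 1 * ℓ := by gcongr; linarith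
      constructor <;> linarith
    have e5 : ((α / 2 - 1) * ℓ - (1 - r) * (2 - m * ℓ)) * E ≤ 4 * (ℓ + 1) * |E| := by
      refine (le_abs_self _).trans ?_
      rw [abs_mul]
      gcongr
    linarith
  have z2 := mul_le_mul_of_nonneg_right z1 hv
  have z3 := mul_le_mul_of_nonneg_right hY hv
  have z4 : 0 ≤ κ * M * v ^ 2 := by positivity
  have z5 : 0 ≤ κ ^ 2 * ℓ * v ^ 2 := by positivity
  have z6 : 0 ≤ ℓ * v ^ 2 := by positivity
  have z7 : 0 ≤ Y * v ^ 2 := by positivity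
  rw [htr] at z2 ⊢
  clear z1 hY hV hp hp' hs hℓs hmℓ hm1 hm2 hm htr hr hr1 hs2 hM hr0
  linarith only [g1, g2, g3, c1, c1', d1, d1', d2, f1, f1', f2, z2, z3, z4, z5, z6, z7, hG, hv]

/-- Bounded potentials with the decay required of `V₂`. -/
structure IsShortRange (α M : ℝ) (V : Space n → ℝ) : Prop where
  aestronglyMeasurable : AEStronglyMeasurable V
  bound : ∀ᵐ x, |V x| ≤ M
  decay : ∀ δ > 0, ∃ T : ℝ, ∀ᵐ x, T ≤ ‖x‖ ^ 2 →
    V x ^ 2 * (1 + ‖x‖ ^ 2) * Real.log (1 + ‖x‖ ^ 2) ^ 2 ≤ δ * (1 + ‖x‖ ^ 2) ^ (α / 2)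

theorem eventually_log_le {α : ℝ} (hα : 0 < α) (c : ℝ) : ∀ᶠ t : ℝ in atTop,
    2 ≤ Real.log (1 + t) ∧ Real.log (1 + t) ^ 2 ≤ 1 + t ∧
      c * (Real.log (1 + t) + 1) ≤ (1 + t) ^ (α / 2) / 2 := by
  have h1 : Tendsto (fun t : ℝ => 1 + t) atTop atTop := tendsto_atTop_add_const_left _ _ tendsto_id
  have key : ∀ᶠ s : ℝ in atTop, 2 ≤ Real.log s ∧ Real.log s ^ 2 ≤ s ∧
      c * (Real.log s + 1) ≤ s ^ (α / 2) / 2 := by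
    have a1 := Real.tendsto_log_atTop.eventually_ge_atTop 2
    have a2 := (isLittleO_log_rpow_atTop (r := 1 / 2) (by norm_num)).bound one_pos
    have a3 := (isLittleO_log_rpow_atTop (r := α / 2) (by positivity)).bound
      (show (0 : ℝ) < 1 / (4 * (|c| + 1)) by positivity)
    filter_upwards [a1, a2, a3, eventually_ge_atTop 1] with s h1 h2 h3 h4
    have hl : 0 ≤ Real.log s := by linarith
    rw [Real.norm_of_nonneg hl, Real.norm_of_nonneg (by positivity)] at h2 h3
    refine ⟨h1, ?_, ?_⟩
    · calc Real.log s ^ 2 ≤ (1 * s ^ (1 / 2 : ℝ)) ^ 2 := by gcongr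
        _ = s := by
          rw [one_mul, ← Real.rpow_natCast, ← Real.rpow_mul (by linarith)]; norm_num
    · calc c * (Real.log s + 1) ≤ (|c| + 1) * (Real.log s + Real.log s) := by
            gcongr
            · exact (le_abs_self c).trans (by linarith)
            · linarith
        _ ≤ (|c| + 1) * (1 / (4 * (|c| + 1)) * s ^ (α / 2) +
            1 / (4 * (|c| + 1)) * s ^ (α / 2)) := by gcongr
        _ = s ^ (α / 2) / 2 := by field_simp; ring
  exact h1.eventually key

/-- The form in which identities are used: an integrand of total integral zero is added to make the
comparison pointwise. -/
theorem integral_le_of_add_ae_le {J I F : Space n → ℝ} (hJ : Integrable J) (hI : Integrable I)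
    (hI0 : ∫ x, I x = 0) (hF : Integrable F) (h : ∀ᵐ x, J x + I x ≤ F x) :
    ∫ x, J x ≤ ∫ x, F x := by
  have := integral_mono_ae (hJ.add hI) hF h
  rwa [integral_add' hJ hI, hI0, add_zero] at this

theorem flux_continuous {α E : ℝ} {u : Space n → ℝ} (hu : ContDiff ℝ ∞ u) :
    Continuous (flux α E u) := by
  have huc := hu.continuous
  have he := euler_continuous hu
  have hg := gradSq_continuous hu
  have hq := continuous_comp_normSq (n := n) (continuousOn_potential α E)
  unfold flux
  exact ((by fun_prop : Continuous fun x => 4 * euler u x ^ 2 + 4 * fluxConst n α *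
    (u x * euler u x)).add (((continuous_const.mul (by fun_prop)).mul hq).mul
      (by fun_prop))).sub (by fun_prop)

/-- In the virial identity the terms in `χ'` add up to `-χ'` times the weighted flux, and the terms
in `χ` are handled by `flux_bulk_le`. The value of `κ` makes `n - 2 - 2κ = -(1 + α/2)`, which
matches the logarithmic derivative of `s^{-α/4-1/2}` and cancels the radial derivative to leading
order. -/
theorem flux_monotone (hn : 1 ≤ n) {α M : ℝ} (hα₀ : 0 < α) (hα₂ : α ≤ 2) (E : ℝ)
    {V : Space n → ℝ} (hV : IsShortRange α M V) :
    ∃ T₁ : ℝ, 1 ≤ T₁ ∧ ∀ u : Space n → ℝ, ContDiff ℝ ∞ u → ∀ χ χ' : ℝ → ℝ, IsWeight χ χ' →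
      (∀ t, 0 ≤ t → 0 ≤ χ t) → (∀ t, 0 ≤ t → t < T₁ → χ t = 0) →
      ∫ x, χ' (‖x‖ ^ 2) * fluxWeight α (‖x‖ ^ 2) * flux α E u x ≤
        ∫ x, χ (‖x‖ ^ 2) * fluxResidualWeight n α (‖x‖ ^ 2) *
          residual V (potential α E) u x ^ 2 := by
  have hκ : 0 ≤ fluxConst n α := by
    have : (1 : ℝ) ≤ n := by exact_mod_cast hn
    rw [fluxConst]
    linarith
  obtain ⟨T, hT⟩ := hV.decay (1 / 16) (by norm_num)
  obtain ⟨T', hT'⟩ := eventually_atTop.mp (eventually_log_le hα₀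
    (4 * |E| + 2 * fluxConst n α * M + 16 * fluxConst n α ^ 2 + 1))
  refine ⟨max 1 (max T T'), le_max_left _ _, fun u hu χ χ' hχ hχ0 hχs => ?_⟩
  have hA := hχ.mul (fun t ht => hasDerivAt_fluxWeight α ht) (continuousOn_fluxWeightDeriv α)
  obtain ⟨iI, hI⟩ := integral_virial hu hA (fun t ht => hasDerivAt_potential α E ht)
    (continuousOn_potentialDeriv α) (fluxConst n α)
  have hfc := flux_continuous (α := α) (E := E) hu
  have i1 : Integrable fun x : Space n =>
      χ' (‖x‖ ^ 2) * fluxWeight α (‖x‖ ^ 2) * flux α E u x := by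
    simp only [mul_assoc]
    exact hχ.integrable_deriv_mul
      ((continuous_comp_normSq (continuousOn_fluxWeight α)).mul hfc)
  obtain ⟨T₀, hT₀⟩ := hχ.eventually_zero
  have i2 := integrable_mul_residual_sq hu hV.aestronglyMeasurable hV.bound
    (continuousOn_potential α E) (w := fun x : Space n => χ (‖x‖ ^ 2) *
      fluxResidualWeight n α (‖x‖ ^ 2))
    (hχ.continuous.mul (continuous_comp_normSq (continuousOn_fluxResidualWeight α)))
    (T := T₀) fun x hx => by simp [(hT₀ _ hx).1]
  refine integral_le_of_add_ae_le i1 iI hI i2 ?_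
  filter_upwards [hV.bound, hT] with x hx1 hx2
  have ht : 0 ≤ ‖x‖ ^ 2 := by positivity
  by_cases hlt : ‖x‖ ^ 2 < max 1 (max T T')
  -- Nothing is assumed about `χ'` below the threshold; its terms cancel identically against the
  -- flux.
  · simp only [hχs _ ht hlt, flux]
    apply le_of_eq
    ring
  · push Not at hlt
    have h1 : 1 ≤ ‖x‖ ^ 2 := (le_max_left _ _).trans hlt
    have h2 := hx2 (((le_max_left _ _).trans (le_max_right _ _)).trans hlt)
    obtain ⟨h3, h4, h5⟩ := hT' _ (((le_max_right _ _).trans (le_max_right _ _)).trans hlt)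
    have hs0 : 0 < 1 + ‖x‖ ^ 2 := by positivity
    have hr : (1 + ‖x‖ ^ 2)⁻¹ * (1 + ‖x‖ ^ 2) = 1 := inv_mul_cancel₀ hs0.ne'
    have key := flux_bulk_le (v := u x) (f := residual V (potential α E) u x) hα₀ hα₂ rfl h1 hr
      (gradSq_nonneg u x) (euler_sq_le u x) h3 h4 hκ hx1 h5 (by linarith)
    have hf : lap u x + potential α E (‖x‖ ^ 2) * u x =
      V x * u x - residual V (potential α E) u x := by rw [residual]; ring
    have hb : 0 < (1 + ‖x‖ ^ 2) ^ (-α / 4 - 1 / 2) := by positivity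
    have key2 := mul_le_mul_of_nonneg_left key (mul_nonneg (hχ0 _ ht) hb.le)
    have hpd : potentialDeriv α (‖x‖ ^ 2) =
        α / 2 * ((1 + ‖x‖ ^ 2) ^ (α / 2) * (1 + ‖x‖ ^ 2)⁻¹) := by
      rw [potentialDeriv, Real.rpow_sub_one hs0.ne', div_eq_mul_inv _ (1 + ‖x‖ ^ 2)]
    rw [hf]
    simp only [flux, fluxWeight, fluxWeightDeriv, fluxResidualWeight, hpd, potential,
      div_eq_mul_inv _ (1 + ‖x‖ ^ 2)]
    refine le_trans (le_of_eq ?_) (key2.trans (le_of_eq ?_))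
    · simp only [fluxConst]
      generalize (1 + ‖x‖ ^ 2)⁻¹ = r
      generalize (1 + ‖x‖ ^ 2) ^ (-α / 4 - 1 / 2) = b
      generalize (1 + ‖x‖ ^ 2) ^ (α / 2) = Y
      generalize Real.log (1 + ‖x‖ ^ 2) = l
      generalize ‖x‖ ^ 2 = t
      clear * -
      ring
    · ring

/-! ### Polynomial weights of arbitrary degree -/

/-- With `z = x·∇u + κu` and `N = k + 1`, half of the square `4N z²` pays for the product `V v z`
and half for `f z`. The constants do not deteriorate as `N` grows. -/
theorem power_bulk_le {N t Y E Q' V v f z : ℝ} (hN : 1 ≤ N) (ht : 1 ≤ t)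
    (hE : 2 * |E| ≤ Y / 2) (hQ' : 0 ≤ Q') (hV : t * V ^ 2 ≤ Y / 2) :
    -4 * N * z ^ 2 - (2 * (Y + E) + 2 * t * Q') * t * v ^ 2 - 2 * t * ((V * v - f) * z) ≤
      -(1 / 2 * Y * t * v ^ 2) + t ^ 2 * f ^ 2 := by
  have hY : 0 ≤ Y := by have := abs_nonneg E; linarith
  have h1 : 2 * |t * (V * v * z)| ≤ 2 * N * z ^ 2 + t * (Y / 2) * v ^ 2 := by
    apply two_mul_le_of_sq_le (by positivity) (by positivity)
    calc (t * (V * v * z)) ^ 2 = t * (t * V ^ 2) * v ^ 2 * (1 * z ^ 2) := by ring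
      _ ≤ t * (Y / 2) * v ^ 2 * ((2 * N) * z ^ 2) := by gcongr; linarith
      _ = _ := by ring
  have h1' := neg_abs_le (t * (V * v * z))
  have h2 : 2 * |t * (f * z)| ≤ 2 * N * z ^ 2 + t ^ 2 * f ^ 2 := by
    apply two_mul_le_of_sq_le (by positivity) (by positivity)
    calc (t * (f * z)) ^ 2 = t ^ 2 * f ^ 2 * (1 * z ^ 2) := by ring
      _ ≤ t ^ 2 * f ^ 2 * ((2 * N) * z ^ 2) := by gcongr; linarith
      _ = _ := by ring
  have h2' := le_abs_self (t * (f * z))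
  have h3 : 0 ≤ t * Q' * t * v ^ 2 := by positivity
  have h4 : (-2 * E) * (t * v ^ 2) ≤ (Y / 2) * (t * v ^ 2) := by
    gcongr
    have := neg_abs_le E
    linarith
  have h5 : 0 ≤ Y * t * v ^ 2 := by positivity
  linarith only [h1, h1', h2, h2', h3, h4, h5]

/-- The difference between the constants of the multipliers with weights `t ^ N` and
`fluxWeight`. -/
def powerGap (α : ℝ) (k : ℕ) : ℝ := k + 1 / 2 - α / 4

/-- The constant of the multiplier with weight `t ^ (k + 1)`. -/
def powerConst (n k : ℕ) : ℝ := k + n / 2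

/-- Since `n - 2 - 2κ + 2(k+1) = 0` for `κ = k + n/2`, no `|∇u|²` term remains where `χ` is
undifferentiated, only `-4(k+1) t^k (p² + κ u p)` with `p = x·∇u`. Subtracting `2(k+1)κ` times the
identity for `χ t^k u² x` completes the square exactly; its price is the `u²` term multiplied by
`χ'`. The threshold is chosen before `k`. -/
theorem power_inequality {α M : ℝ} (hα₀ : 0 < α) (E : ℝ)
    {V : Space n → ℝ} (hV : IsShortRange α M V) :
    ∃ T₁ : ℝ, 1 ≤ T₁ ∧ ∀ u : Space n → ℝ, ContDiff ℝ ∞ u → ∀ k : ℕ, ∀ χ χ' : ℝ → ℝ,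
      IsWeight χ χ' → (∀ t, 0 ≤ t → 0 ≤ χ t) → (∀ t, 0 ≤ t → t < T₁ → χ t = 0) →
      ∫ x, χ (‖x‖ ^ 2) * (‖x‖ ^ 2) ^ (k + 1) * (1 / 2 * (1 + ‖x‖ ^ 2) ^ (α / 2)) * u x ^ 2 ≤
        ∫ x, (-(χ' (‖x‖ ^ 2) * (‖x‖ ^ 2) ^ (k + 1) * (flux α E u x +
          4 * powerGap α k * (u x * euler u x) + 4 * powerConst n k * (k + 1) * u x ^ 2)) +
          χ (‖x‖ ^ 2) * (‖x‖ ^ 2) ^ (k + 2) * residual V (potential α E) u x ^ 2) := by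
  obtain ⟨T, hT⟩ := hV.decay (1 / 16) (by norm_num)
  obtain ⟨T', hT'⟩ := eventually_atTop.mp (eventually_log_le hα₀ (4 * |E|))
  refine ⟨max 1 (max T T'), le_max_left _ _, fun u hu k χ χ' hχ hχ0 hχs => ?_⟩
  have hpow (j : ℕ) : IsWeight (fun t => χ t * t ^ j)
      (fun t => χ' t * t ^ j + χ t * (j * t ^ (j - 1))) :=
    hχ.mul (fun t _ => hasDerivAt_pow j t) (by fun_prop)
  obtain ⟨T₀, hT₀⟩ := hχ.eventually_zero
  have huc := hu.continuous
  have he := euler_continuous hu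
  have hg := gradSq_continuous hu
  have hfc := flux_continuous (α := α) (E := E) hu
  obtain ⟨iI, hI⟩ := integral_virial hu (hpow (k + 1))
    (fun t ht => hasDerivAt_potential α E ht) (continuousOn_potentialDeriv α) (powerConst n k)
  have i3 : Integrable fun x : Space n => 2 * (χ (‖x‖ ^ 2) * (‖x‖ ^ 2) ^ k) *
      (u x * euler u x) + (n * (χ (‖x‖ ^ 2) * (‖x‖ ^ 2) ^ k) + 2 * ‖x‖ ^ 2 *
      (χ' (‖x‖ ^ 2) * (‖x‖ ^ 2) ^ k + χ (‖x‖ ^ 2) * (k * (‖x‖ ^ 2) ^ (k - 1)))) * u x ^ 2 := by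
    refine (((hpow k).integrable_mul (g := fun x => 2 * (u x * euler u x) + n * u x ^ 2)
      (by fun_prop)).add ((hpow k).integrable_deriv_mul (g := fun x => 2 * ‖x‖ ^ 2 * u x ^ 2)
        (by fun_prop))).congr (ae_of_all _ fun x => ?_)
    simp only [Pi.add_apply]
    ring
  have h3 := integral_weight_mul_euler hu (hpow k)
  have iZ : Integrable (fun _ : Space n => (0 : ℝ)) := integrable_zero _ _ _
  obtain ⟨k1, k2⟩ := integral_comb_eq_zero iI.neg i3 iZ (2 * (k + 1) * powerConst n k)
    (by simp only [Pi.neg_apply, integral_neg, hI, neg_zero]) h3 (by simp)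
  have i1 : Integrable fun x : Space n =>
      χ (‖x‖ ^ 2) * (‖x‖ ^ 2) ^ (k + 1) * (1 / 2 * (1 + ‖x‖ ^ 2) ^ (α / 2)) * u x ^ 2 := by
    simp only [mul_assoc]
    have := continuous_comp_normSq (n := n) (continuousOn_rpow_one_add (α / 2))
    exact hχ.integrable_mul (by fun_prop)
  have i2 := integrable_mul_residual_sq hu hV.aestronglyMeasurable hV.bound
    (continuousOn_potential α E) (w := fun x : Space n => χ (‖x‖ ^ 2) *
      (‖x‖ ^ 2) ^ (k + 2)) (hχ.continuous.mul (by fun_prop))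
    (T := T₀) fun x hx => by simp [(hT₀ _ hx).1]
  have i4 : Integrable fun x : Space n => -(χ' (‖x‖ ^ 2) * (‖x‖ ^ 2) ^ (k + 1) *
      (flux α E u x + 4 * powerGap α k * (u x * euler u x) +
        4 * powerConst n k * (k + 1) * u x ^ 2)) := by
    simp only [mul_assoc]
    exact (hχ.integrable_deriv_mul (by fun_prop)).neg
  refine integral_le_of_add_ae_le i1 k1 k2 (i4.add i2) ?_
  filter_upwards [hV.bound, hT] with x hx1 hx2
  have ht : 0 ≤ ‖x‖ ^ 2 := by positivity
  -- For `k = 0` the exponent `k - 1` is truncated to zero, and the factor `k` saves the formula.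
  have hdk : ‖x‖ ^ 2 * (k * (‖x‖ ^ 2) ^ (k - 1)) = k * (‖x‖ ^ 2) ^ k := by
    rcases k with _ | k
    · simp
    · rw [Nat.add_sub_cancel, pow_succ]; ring
  have hf : lap u x + potential α E (‖x‖ ^ 2) * u x =
    V x * u x - residual V (potential α E) u x := by rw [residual]; ring
  have key : χ (‖x‖ ^ 2) * (‖x‖ ^ 2) ^ k * (-4 * (k + 1) * (euler u x + powerConst n k * u x) ^ 2 -
      (2 * ((1 + ‖x‖ ^ 2) ^ (α / 2) + E) + 2 * ‖x‖ ^ 2 * potentialDeriv α (‖x‖ ^ 2)) * ‖x‖ ^ 2 *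
      u x ^ 2 - 2 * ‖x‖ ^ 2 * ((V x * u x - residual V (potential α E) u x) *
        (euler u x + powerConst n k * u x))) ≤ χ (‖x‖ ^ 2) * (‖x‖ ^ 2) ^ k *
      (-(1 / 2 * (1 + ‖x‖ ^ 2) ^ (α / 2) * ‖x‖ ^ 2 * u x ^ 2) +
        (‖x‖ ^ 2) ^ 2 * residual V (potential α E) u x ^ 2) := by
    by_cases hlt : ‖x‖ ^ 2 < max 1 (max T T')
    · simp [hχs _ ht hlt]
    · push Not at hlt
      have h1 : 1 ≤ ‖x‖ ^ 2 := (le_max_left _ _).trans hlt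
      have h2 := hx2 (((le_max_left _ _).trans (le_max_right _ _)).trans hlt)
      obtain ⟨h3, h4, h5⟩ := hT' _ (((le_max_right _ _).trans (le_max_right _ _)).trans hlt)
      refine mul_le_mul_of_nonneg_left ?_ (mul_nonneg (hχ0 _ ht) (by positivity))
      have hE0 := abs_nonneg E
      refine power_bulk_le (by simp) h1 ?_ ?_ ?_
      · have : 4 * |E| * 1 ≤ 4 * |E| * (Real.log (1 + ‖x‖ ^ 2) + 1) := by gcongr; linarith
        linarith
      · rw [potentialDeriv]; positivity
      · have hY : 0 ≤ (1 + ‖x‖ ^ 2) ^ (α / 2) := by positivity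
        have h6 : ‖x‖ ^ 2 * V x ^ 2 ≤ V x ^ 2 * (1 + ‖x‖ ^ 2) * Real.log (1 + ‖x‖ ^ 2) ^ 2 := by
          have : 1 ≤ Real.log (1 + ‖x‖ ^ 2) ^ 2 := by nlinarith only [h3]
          calc ‖x‖ ^ 2 * V x ^ 2 ≤ V x ^ 2 * (1 + ‖x‖ ^ 2) * 1 := by
                linarith only [sq_nonneg (V x)]
            _ ≤ _ := by gcongr
        linarith
  rw [Pi.neg_apply, hf]
  simp only [Nat.add_sub_cancel, Nat.cast_add, Nat.cast_one]
  have hκ : powerConst n k = k + n / 2 := rfl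
  have hl : powerGap α k = k + 1 / 2 - α / 4 := rfl
  simp only [flux, fluxConst, potential, pow_succ (‖x‖ ^ 2) k,
    pow_succ (‖x‖ ^ 2) (k + 1)]
  rw [hκ] at key ⊢
  rw [hl]
  linear_combination key + 2 * (2 * (k + 1) * (k + n / 2)) * (-χ (‖x‖ ^ 2) * u x ^ 2) * hdk

/-! ### Cutoffs and weights with prescribed rise and fall -/

theorem deriv_smoothTransition_of_neg {x : ℝ} (hx : x < 0) :
    deriv Real.smoothTransition x = 0 := by
  have : Real.smoothTransition =ᶠ[𝓝 x] fun _ => 0 := by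
    filter_upwards [Iio_mem_nhds hx] with y hy
    exact Real.smoothTransition.zero_of_nonpos (le_of_lt hy)
  rw [this.deriv_eq, deriv_const]

theorem deriv_smoothTransition_of_one_lt {x : ℝ} (hx : 1 < x) :
    deriv Real.smoothTransition x = 0 := by
  have : Real.smoothTransition =ᶠ[𝓝 x] fun _ => 1 := by
    filter_upwards [Ioi_mem_nhds hx] with y hy
    exact Real.smoothTransition.one_of_one_le (le_of_lt hy)
  rw [this.deriv_eq, deriv_const]

theorem hasDerivAt_smoothTransition (x : ℝ) :
    HasDerivAt Real.smoothTransition (deriv Real.smoothTransition x) x :=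
  ((Real.smoothTransition.contDiff (n := 1)).differentiable (by simp) x).hasDerivAt

theorem continuous_deriv_smoothTransition : Continuous (deriv Real.smoothTransition) :=
  (Real.smoothTransition.contDiff (n := 1)).continuous_deriv (by simp)

theorem exists_deriv_smoothTransition_le :
    ∃ K : ℝ, 0 ≤ K ∧ ∀ x, |deriv Real.smoothTransition x| ≤ K := by
  obtain ⟨K, hK⟩ := (isCompact_Icc (a := (0 : ℝ)) (b := 1)).exists_bound_of_continuousOn
    continuous_deriv_smoothTransition.continuousOn
  refine ⟨max K 0, le_max_right _ _, fun x => ?_⟩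
  by_cases h0 : x < 0
  · simp [deriv_smoothTransition_of_neg h0]
  by_cases h1 : 1 < x
  · simp [deriv_smoothTransition_of_one_lt h1]
  · exact (hK x ⟨not_lt.mp h0, not_lt.mp h1⟩).trans (le_max_left _ _)

theorem deriv_smoothTransition_nonneg (x : ℝ) : 0 ≤ deriv Real.smoothTransition x :=
  Real.smoothTransition.monotone.deriv_nonneg

/-- A smooth cutoff supported in `[ρ, 2 L]`, equal to `1` on `[ρ + 1, L]`. -/
def cutoff (ρ L t : ℝ) : ℝ := Real.smoothTransition (t - ρ) * Real.smoothTransition (2 - t / L)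

/-- The derivative of `cutoff`. -/
def cutoffDeriv (ρ L t : ℝ) : ℝ :=
  deriv Real.smoothTransition (t - ρ) * Real.smoothTransition (2 - t / L) -
    Real.smoothTransition (t - ρ) * (deriv Real.smoothTransition (2 - t / L) / L)

theorem cutoff_nonneg (ρ L t : ℝ) : 0 ≤ cutoff ρ L t :=
  mul_nonneg (Real.smoothTransition.nonneg _) (Real.smoothTransition.nonneg _)

theorem cutoff_le_one (ρ L t : ℝ) : cutoff ρ L t ≤ 1 :=
  mul_le_one₀ (Real.smoothTransition.le_one _) (Real.smoothTransition.nonneg _)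
    (Real.smoothTransition.le_one _)

theorem cutoff_eq_one {ρ L t : ℝ} (hL : 0 < L) (h1 : ρ + 1 ≤ t) (h2 : t ≤ L) :
    cutoff ρ L t = 1 := by
  rw [cutoff, Real.smoothTransition.one_of_one_le (by linarith),
    Real.smoothTransition.one_of_one_le, one_mul]
  have : t / L ≤ 1 := (div_le_one hL).mpr h2
  linarith

theorem cutoff_eq_zero {ρ L t : ℝ} (hL : 0 < L) (h : t ∉ Set.Icc ρ (2 * L)) :
    cutoff ρ L t = 0 ∧ cutoffDeriv ρ L t = 0 := by
  rw [Set.mem_Icc, not_and_or, not_le, not_le] at h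
  rcases h with h | h
  · rw [cutoff, cutoffDeriv, Real.smoothTransition.zero_of_nonpos (by linarith : t - ρ ≤ 0),
      deriv_smoothTransition_of_neg (by linarith)]
    simp
  · have h2 : 2 < t / L := (lt_div_iff₀ hL).mpr h
    rw [cutoff, cutoffDeriv, Real.smoothTransition.zero_of_nonpos (by linarith : 2 - t / L ≤ 0),
      deriv_smoothTransition_of_neg (x := 2 - t / L) (by linarith)]
    simp

theorem hasDerivAt_cutoff (ρ L t : ℝ) : HasDerivAt (cutoff ρ L) (cutoffDeriv ρ L t) t := by
  have h1 : HasDerivAt (fun t : ℝ => t - ρ) 1 t := (hasDerivAt_id t).sub_const ρ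
  have h2 : HasDerivAt (fun t : ℝ => 2 - t / L) (-(1 / L)) t :=
    ((hasDerivAt_id t).div_const L).const_sub 2
  have := ((hasDerivAt_smoothTransition (t - ρ)).comp t h1).mul
    ((hasDerivAt_smoothTransition (2 - t / L)).comp t h2)
  convert! this using 1
  simp only [cutoffDeriv, Function.comp]
  ring

theorem continuous_cutoffDeriv (ρ L : ℝ) : Continuous (cutoffDeriv ρ L) := by
  have h1 := continuous_deriv_smoothTransition
  have h2 := Real.smoothTransition.continuous
  unfold cutoffDeriv
  fun_prop

theorem continuous_cutoff (ρ L : ℝ) : Continuous (cutoff ρ L) :=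
  continuous_iff_continuousAt.mpr fun t => (hasDerivAt_cutoff ρ L t).continuousAt

theorem isWeight_cutoff (ρ : ℝ) {L : ℝ} (hL : 0 < L) :
    IsWeight (cutoff ρ L) (cutoffDeriv ρ L) where
  hasDerivAt t _ := hasDerivAt_cutoff ρ L t
  continuousOn := (continuous_cutoffDeriv ρ L).continuousOn
  eventually_zero := ⟨2 * L + 1, fun t ht => cutoff_eq_zero hL fun h => by
    have := h.2
    linarith⟩

/-- Only the falling factor gives a negative derivative, of size at most `K / L`, and `t / L ≤ 2`;
the bound is uniform in `L`. -/
theorem neg_mul_cutoffDeriv_le {K : ℝ} (hK : ∀ x, |deriv Real.smoothTransition x| ≤ K)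
    {ρ L t : ℝ} (hL : 0 < L) (ht : 0 ≤ t) (h : t ≤ 2 * L) :
    -(t * cutoffDeriv ρ L t) ≤ 2 * K := by
  have hS := deriv_smoothTransition_nonneg (t - ρ)
  have hS' := deriv_smoothTransition_nonneg (2 - t / L)
  have h1 := (le_abs_self _).trans (hK (2 - t / L))
  have h2 := Real.smoothTransition.le_one (t - ρ)
  have h3 := Real.smoothTransition.nonneg (t - ρ)
  have h4 := Real.smoothTransition.nonneg (2 - t / L)
  have h5 : 0 ≤ t / L := by positivity
  have h6 : t / L ≤ 2 := (div_le_iff₀ hL).mpr h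
  calc -(t * cutoffDeriv ρ L t) = -(t * (deriv Real.smoothTransition (t - ρ) *
        Real.smoothTransition (2 - t / L))) + Real.smoothTransition (t - ρ) *
        ((t / L) * deriv Real.smoothTransition (2 - t / L)) := by
        rw [cutoffDeriv]; ring
    _ ≤ 0 + 1 * (2 * K) := by
        gcongr
        · have : 0 ≤ t * (deriv Real.smoothTransition (t - ρ) *
            Real.smoothTransition (2 - t / L)) := by positivity
          linarith
    _ = 2 * K := by ring

/-- The rise takes place at `t ≤ ρ + 1` and the fall contributes `(K / L)² · 2L`, so the bound is
again uniform in `L`. -/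
theorem cutoffDeriv_sq_mul_le {K : ℝ} (hK : ∀ x, |deriv Real.smoothTransition x| ≤ K)
    {ρ L t : ℝ} (hρ : 0 ≤ ρ) (hL : 1 ≤ L) (ht : 0 ≤ t) (h : t ≤ 2 * L) :
    cutoffDeriv ρ L t ^ 2 * t ≤ 2 * K ^ 2 * (ρ + 3) := by
  have hK0 : 0 ≤ K := (abs_nonneg _).trans (hK 0)
  have h1 := hK (2 - t / L)
  have h2 := Real.smoothTransition.le_one (t - ρ)
  have h3 := Real.smoothTransition.nonneg (t - ρ)
  have h4 := Real.smoothTransition.nonneg (2 - t / L)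
  have h5 := Real.smoothTransition.le_one (2 - t / L)
  set a := deriv Real.smoothTransition (t - ρ) * Real.smoothTransition (2 - t / L) with ha
  set b := Real.smoothTransition (t - ρ) * (deriv Real.smoothTransition (2 - t / L) / L) with hb
  have e : cutoffDeriv ρ L t = a - b := rfl
  have ha' : a ^ 2 * t ≤ K ^ 2 * (ρ + 1) := by
    by_cases h6 : 1 < t - ρ
    · rw [ha, deriv_smoothTransition_of_one_lt h6]
      simp; positivity
    · have h7 : |a| ≤ K * 1 := by
        rw [ha, abs_mul]
        exact mul_le_mul (hK _) (by rw [abs_of_nonneg h4]; exact h5) (abs_nonneg _) hK0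
      have h8 : a ^ 2 ≤ K ^ 2 := by
        rw [← sq_abs]; gcongr; linarith
      push Not at h6
      gcongr
      linarith
  have hb' : b ^ 2 * t ≤ K ^ 2 * 2 := by
    have h7 : |b| ≤ 1 * (K / L) := by
      rw [hb, abs_mul, abs_div, abs_of_nonneg h3, abs_of_nonneg (by linarith : 0 ≤ L)]
      gcongr
    have h8 : b ^ 2 ≤ (K / L) ^ 2 := by
      rw [← sq_abs]; gcongr; linarith
    calc b ^ 2 * t ≤ (K / L) ^ 2 * (2 * L) := by gcongr
      _ = K ^ 2 * 2 / L := by field_simp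
      _ ≤ K ^ 2 * 2 := div_le_self (by positivity) hL
  have h9 : (a - b) ^ 2 ≤ 2 * a ^ 2 + 2 * b ^ 2 := by nlinarith only [sq_nonneg (a + b)]
  rw [e]
  calc (a - b) ^ 2 * t ≤ (2 * a ^ 2 + 2 * b ^ 2) * t := by gcongr
    _ ≤ _ := by linarith only [ha', hb']

/-- A weight which rises with density `g₁` and falls with a multiple of the density `g₂`. -/
theorem exists_isWeight {g₁ g₂ : ℝ → ℝ} (hg₁ : Continuous g₁) (hg₂ : Continuous g₂)
    (h₁ : ∀ t, 0 ≤ g₁ t) (h₂ : ∀ t, 0 ≤ g₂ t) {a b d : ℝ} (hab : a ≤ b) (hbd : b ≤ d)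
    (hs₁ : ∀ t, t ∉ Set.Icc a b → g₁ t = 0) (hs₂ : ∀ t, t ∉ Set.Icc b d → g₂ t = 0)
    (hI : 0 < ∫ t in b..d, g₂ t) :
    ∃ χ : ℝ → ℝ, IsWeight χ (fun t => g₁ t -
        (∫ t in a..b, g₁ t) / (∫ t in b..d, g₂ t) * g₂ t) ∧ (∀ t, 0 ≤ χ t) ∧
      (∀ t, t ∉ Set.Icc a d → χ t = 0) ∧ ∀ t ∈ Set.Icc b d,
        χ t = (∫ t in a..b, g₁ t) / (∫ t in b..d, g₂ t) * ∫ s in t..d, g₂ s := by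
  set I₁ := ∫ t in a..b, g₁ t with hI₁
  set I₂ := ∫ t in b..d, g₂ t with hI₂
  have i1 (s t : ℝ) : IntervalIntegrable g₁ volume s t := hg₁.intervalIntegrable _ _
  have i2 (s t : ℝ) : IntervalIntegrable g₂ volume s t := hg₂.intervalIntegrable _ _
  have z1 {s t : ℝ} (hst : s ≤ t) (h : b ≤ s ∨ t ≤ a) : ∫ x in s..t, g₁ x = 0 := by
    rw [intervalIntegral.integral_of_le hst, integral_Ioc_eq_integral_Ioo]
    refine setIntegral_eq_zero_of_forall_eq_zero fun x hx => hs₁ x fun hx' => ?_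
    rcases h with h | h
    · linarith [hx.1, hx'.2]
    · linarith [hx.2, hx'.1]
  have z2 {s t : ℝ} (hst : s ≤ t) (h : d ≤ s ∨ t ≤ b) : ∫ x in s..t, g₂ x = 0 := by
    rw [intervalIntegral.integral_of_le hst, integral_Ioc_eq_integral_Ioo]
    refine setIntegral_eq_zero_of_forall_eq_zero fun x hx => hs₂ x fun hx' => ?_
    rcases h with h | h
    · linarith [hx.1, hx'.2]
    · linarith [hx.2, hx'.1]
  have hI₁0 : 0 ≤ I₁ := intervalIntegral.integral_nonneg hab fun t _ => h₁ t
  have hd (t : ℝ) : HasDerivAt (fun t => (∫ x in a..t, g₁ x) - I₁ / I₂ * ∫ x in b..t, g₂ x)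
      (g₁ t - I₁ / I₂ * g₂ t) t :=
    (hg₁.integral_hasStrictDerivAt a t).hasDerivAt.sub
      ((hg₂.integral_hasStrictDerivAt b t).hasDerivAt.const_mul _)
  have lo {t : ℝ} (ht : t ≤ a) :
      (∫ x in a..t, g₁ x) - I₁ / I₂ * ∫ x in b..t, g₂ x = 0 := by
    rw [intervalIntegral.integral_symm, z1 ht (Or.inr le_rfl), intervalIntegral.integral_symm t b,
      z2 (ht.trans hab) (Or.inr le_rfl)]
    simp
  have hi {t : ℝ} (ht : b ≤ t) : (∫ x in a..t, g₁ x) = I₁ := by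
    rw [← intervalIntegral.integral_add_adjacent_intervals (i1 a b) (i1 b t),
      z1 ht (Or.inl le_rfl), add_zero]
  have mid {t : ℝ} (ht : b ≤ t) :
      (∫ x in a..t, g₁ x) - I₁ / I₂ * ∫ x in b..t, g₂ x = I₁ / I₂ * ∫ s in t..d, g₂ s := by
    rw [hi ht, eq_comm, ← sub_eq_zero]
    have : I₂ = (∫ x in b..t, g₂ x) + ∫ x in t..d, g₂ x := by
      rw [intervalIntegral.integral_add_adjacent_intervals (i2 _ _) (i2 _ _)]
    have e : I₁ / I₂ * I₂ = I₁ := div_mul_cancel₀ _ hI.ne'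
    linear_combination (-(I₁ / I₂)) * this + e
  have top {t : ℝ} (ht : d ≤ t) :
      (∫ x in a..t, g₁ x) - I₁ / I₂ * ∫ x in b..t, g₂ x = 0 := by
    rw [mid (hbd.trans ht), intervalIntegral.integral_symm, z2 ht (Or.inl le_rfl)]
    simp
  -- The ratio `I₁ / I₂` makes the total variation cancel, so the weight vanishes beyond `d`. The
  -- thresholds are shifted by one because the densities are only known to vanish off closed
  -- intervals.
  refine ⟨fun t => (∫ x in a..t, g₁ x) - I₁ / I₂ * ∫ x in b..t, g₂ x, ⟨fun t _ => hd t,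
    by fun_prop, max (b + 1) (d + 1), fun t ht => ⟨?_, ?_⟩⟩, fun t => ?_, fun t ht => ?_,
    fun t ht => mid ht.1⟩
  · exact top ((le_max_right _ _).trans ht |>.trans' (by linarith))
  · have t1 : b + 1 ≤ t := (le_max_left _ _).trans ht
    have t2 : d + 1 ≤ t := (le_max_right _ _).trans ht
    simp only [hs₁ t fun h => by linarith [h.2], hs₂ t fun h => by linarith [h.2]]
    simp
  · rcases le_total t a with ht | ht
    · exact (lo ht).ge
    rcases le_total t b with ht' | ht'
    · simp only
      rw [intervalIntegral.integral_symm t b, z2 ht' (Or.inr le_rfl)]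
      simpa using intervalIntegral.integral_nonneg ht fun t _ => h₁ t
    rcases le_total t d with ht'' | ht''
    · simp only [mid ht']
      exact mul_nonneg (div_nonneg hI₁0 hI.le)
        (intervalIntegral.integral_nonneg ht'' fun t _ => h₂ t)
    · exact (top ht'').ge
  · rw [Set.mem_Icc, not_and_or, not_le, not_le] at ht
    rcases ht with ht | ht
    · exact lo ht.le
    · exact top ht.le

/-! ### Approximate solutions and the energy bound -/

/-- The closed shell `a ≤ |x|² ≤ b`. -/
def shell (n : ℕ) (a b : ℝ) : Set (Space n) := {x | ‖x‖ ^ 2 ∈ Set.Icc a b}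

theorem isCompact_shell (a b : ℝ) : IsCompact (shell n a b) := isCompact_normSq_Icc a b

theorem measurableSet_shell (a b : ℝ) : MeasurableSet (shell n a b) :=
  (isCompact_shell a b).measurableSet

/-- A sequence of smooth functions converging to `U` locally in `L²`, whose residuals tend to zero
locally in `L²` on `|x|² ≥ T₀`. -/
structure IsApproxSolution (α E T₀ : ℝ) (V : Space n → ℝ) (u : ℕ → Space n → ℝ)
    (U : Space n → ℝ) : Prop where
  contDiff : ∀ k, ContDiff ℝ ∞ (u k)
  integrable : Integrable fun x => U x ^ 2
  tendsto : ∀ a b, Tendsto (fun k => ∫ x in shell n a b, u k x ^ 2) atTop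
    (𝓝 (∫ x in shell n a b, U x ^ 2))
  residual : ∀ a b, T₀ ≤ a → Tendsto (fun k => ∫ x in shell n a b,
    residual V (potential α E) (u k) x ^ 2) atTop (𝓝 0)

theorem integrableOn_residual_sq {u : Space n → ℝ} (hu : ContDiff ℝ ∞ u)
    {V : Space n → ℝ} (hVm : AEStronglyMeasurable V) {M : ℝ} (hV : ∀ᵐ x, |V x| ≤ M)
    {Q : ℝ → ℝ} (hQ : ContinuousOn Q (Set.Ici 0)) (a b : ℝ) :
    IntegrableOn (fun x => residual V Q u x ^ 2) (shell n a b) := by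
  have h := integrable_mul_residual_sq hu hVm hV hQ
    (w := fun x : Space n => max 0 (min 1 (b + 1 - ‖x‖ ^ 2))) (by fun_prop) (T := b + 1)
    fun x hx => max_eq_left (min_le_of_right_le (by linarith))
  refine (h.integrableOn (s := shell n a b)).congr_fun (fun x hx => ?_) (measurableSet_shell a b)
  have : ‖x‖ ^ 2 ≤ b := hx.2
  simp only
  rw [min_eq_left (by linarith), max_eq_right zero_le_one, one_mul]

theorem IsApproxSolution.tendsto_integral_weight {α E T₀ M : ℝ} {V : Space n → ℝ}
    {u : ℕ → Space n → ℝ} {U : Space n → ℝ} (h : IsApproxSolution α E T₀ V u U)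
    (hV : IsShortRange α M V) {W : ℝ → ℝ} (hW : ContinuousOn W (Set.Ici 0)) {a b : ℝ}
    (ha : T₀ ≤ a) (hs : ∀ t, 0 ≤ t → t ∉ Set.Icc a b → W t = 0) :
    Tendsto (fun k => ∫ x, W (‖x‖ ^ 2) * Repulsive.residual V (potential α E) (u k) x ^ 2) atTop
      (𝓝 0) := by
  obtain ⟨C, hC⟩ := (isCompact_Icc (a := (0 : ℝ)) (b := b)).exists_bound_of_continuousOn
    (hW.mono Set.Icc_subset_Ici_self)
  have key (k : ℕ) : ‖∫ x, W (‖x‖ ^ 2) * Repulsive.residual V (potential α E) (u k) x ^ 2‖ ≤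
      |C| * ∫ x in shell n a b, Repulsive.residual V (potential α E) (u k) x ^ 2 := by
    rw [← integral_indicator (measurableSet_shell a b), ← integral_const_mul]
    refine norm_integral_le_of_norm_le ((integrable_indicator_iff (measurableSet_shell a b)).mpr
      (integrableOn_residual_sq (h.contDiff k) hV.aestronglyMeasurable hV.bound
        (continuousOn_potential α E) a b) |>.const_mul _) (ae_of_all _ fun x => ?_)
    have ht : 0 ≤ ‖x‖ ^ 2 := by positivity
    by_cases hx : x ∈ shell n a b
    · rw [Set.indicator_of_mem hx, norm_mul, Real.norm_of_nonneg (sq_nonneg _)]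
      gcongr
      exact (hC _ ⟨ht, hx.2⟩).trans (le_abs_self C)
    · rw [Set.indicator_of_notMem hx, hs _ ht hx]
      simp
  refine squeeze_zero_norm key ?_
  simpa using (h.residual a b ha).const_mul |C|

theorem continuousOn_sq_cutoff_mul_rpow (α ρ L : ℝ) :
    ContinuousOn (fun t => cutoff ρ L t ^ 2 * (1 + t) ^ (-(α / 2))) (Set.Ici 0) :=
  (((continuous_cutoff ρ L).pow 2).continuousOn).mul (continuousOn_rpow_one_add _)

/-- The weight `⟨x⟩^{-α}` compensates the growth of the potential, since `⟨x⟩^{-α} |Q| ≤ 1 + |E|`.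
Hence the constant is independent of `L`, and `L` may later be sent to infinity against a fixed `L²`
mass. -/
theorem exists_energy_le {α M : ℝ} (hα₀ : 0 < α) (hα₂ : α ≤ 2) (E : ℝ)
    {V : Space n → ℝ} (hV : IsShortRange α M V) {ρ : ℝ} (hρ : 0 ≤ ρ) :
    ∃ C : ℝ, 0 ≤ C ∧ ∀ L, 1 ≤ L → ∀ u : Space n → ℝ, ContDiff ℝ ∞ u →
      ∫ x, cutoff ρ L (‖x‖ ^ 2) ^ 2 * (1 + ‖x‖ ^ 2) ^ (-(α / 2)) * gradSq u x ≤
        (∫ x, cutoff ρ L (‖x‖ ^ 2) ^ 2 * (1 + ‖x‖ ^ 2) ^ (-(α / 2)) *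
          residual V (potential α E) u x ^ 2) + C * ∫ x in shell n ρ (2 * L), u x ^ 2 := by
  obtain ⟨K, hK0, hK⟩ := exists_deriv_smoothTransition_le
  refine ⟨1 + 2 * (1 + |E|) + 2 * |M| + 4 * (16 * K ^ 2 * (ρ + 3) + 2), by positivity,
    fun L hL u hu => ?_⟩
  have hL0 : 0 < L := by linarith
  have hsq : IsWeight (fun t => cutoff ρ L t * cutoff ρ L t) _ :=
    (isWeight_cutoff ρ hL0).mul (fun t _ => hasDerivAt_cutoff ρ L t)
      (continuous_cutoffDeriv ρ L).continuousOn
  have hB := hsq.mul (Q := fun t => (1 + t) ^ (-(α / 2)))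
    (Q' := fun t => -(α / 2) * (1 + t) ^ (-(α / 2) - 1)) (fun t ht => by
      have h1 : HasDerivAt (fun t : ℝ => 1 + t) 1 t := (hasDerivAt_id t).const_add 1
      convert! h1.rpow_const (p := -(α / 2)) (Or.inl (by positivity)) using 1
      ring) (continuousOn_const.mul (continuousOn_rpow_one_add _))
  have key := caccioppoli hu hV.aestronglyMeasurable hV.bound (continuousOn_potential α E) hB
    (a := ρ) (b := 2 * L) (D := 16 * K ^ 2 * (ρ + 3) + 2)
    (C := 1 + 2 * (1 + |E|) + 2 * |M| + 4 * (16 * K ^ 2 * (ρ + 3) + 2)) (by positivity)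
    (fun t ht => mul_nonneg (mul_self_nonneg _) (by positivity)) (fun t ht hmem => by
      have := cutoff_eq_zero hL0 hmem
      simp [this.1]) ?_ ?_
  · simpa only [← sq] using! key
  · intro t hmem ht
    have hs0 : 0 < 1 + t := by positivity
    have hc0 := cutoff_nonneg ρ L t
    have hc1 := cutoff_le_one ρ L t
    have hd := cutoffDeriv_sq_mul_le hK hρ hL ht hmem.2
    have hy0 : 0 < (1 + t) ^ (-(α / 2)) := by positivity
    have hy1 : (1 + t) ^ (-(α / 2)) ≤ 1 :=
      Real.rpow_le_one_of_one_le_of_nonpos (by linarith) (by linarith)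
    rw [Real.rpow_sub_one hs0.ne', div_eq_mul_inv _ (1 + t)]
    have hr0 : 0 < (1 + t)⁻¹ := by positivity
    have hr1 : (1 + t)⁻¹ * t ≤ 1 := by rw [inv_mul_le_iff₀ hs0]; linarith
    have hr2 : (1 + t)⁻¹ ≤ 1 := inv_le_one_of_one_le₀ (by linarith)
    generalize (1 + t)⁻¹ = r at *
    generalize (1 + t) ^ (-(α / 2)) = y at *
    generalize cutoff ρ L t = c at *
    generalize cutoffDeriv ρ L t = c' at *
    -- The cutoff enters squared, so `B'²` contains the factor `B = c² y`.
    have e1 : ((c' * c + c * c') * y + c * c * (-(α / 2) * (y * r))) ^ 2 * t =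
      (c * c * y) * (y * ((2 * c' - α / 2 * (c * r)) ^ 2 * t)) := by ring
    rw [e1]
    refine mul_le_mul_of_nonneg_left ?_ (by positivity)
    have e2 : (2 * c' - α / 2 * (c * r)) ^ 2 * t ≤ 16 * K ^ 2 * (ρ + 3) + 2 := by
      have e3 : (2 * c' - α / 2 * (c * r)) ^ 2 ≤ 8 * c' ^ 2 + 2 * (α / 2 * (c * r)) ^ 2 := by
        nlinarith only [sq_nonneg (2 * c' + α / 2 * (c * r))]
      have e4 : (α / 2 * (c * r)) ^ 2 * t ≤ 1 := by
        calc (α / 2 * (c * r)) ^ 2 * t = (α / 2) ^ 2 * (c ^ 2 * (r * (r * t))) := by ring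
          _ ≤ 1 ^ 2 * (1 ^ 2 * (1 * 1)) := by gcongr; linarith
          _ = 1 := by norm_num
      calc (2 * c' - α / 2 * (c * r)) ^ 2 * t
          ≤ (8 * c' ^ 2 + 2 * (α / 2 * (c * r)) ^ 2) * t := by gcongr
        _ ≤ _ := by linarith only [e4, hd]
    calc y * ((2 * c' - α / 2 * (c * r)) ^ 2 * t) ≤ 1 * ((2 * c' - α / 2 * (c * r)) ^ 2 * t) := by
          gcongr
      _ ≤ _ := by linarith
  · intro t hmem ht
    have hs0 : 0 < 1 + t := by positivity
    have hc0 := cutoff_nonneg ρ L t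
    have hc1 := cutoff_le_one ρ L t
    have hy0 : 0 < (1 + t) ^ (-(α / 2)) := by positivity
    have hy1 : (1 + t) ^ (-(α / 2)) ≤ 1 :=
      Real.rpow_le_one_of_one_le_of_nonpos (by linarith) (by linarith)
    have hyq : (1 + t) ^ (-(α / 2)) * |potential α E t| ≤ 1 + |E| := by
      have h1 : |potential α E t| ≤ (1 + t) ^ (α / 2) + |E| := by
        refine (abs_add_le _ _).trans ?_
        rw [abs_of_pos (by positivity)]
      have h2 : (1 + t) ^ (-(α / 2)) * (1 + t) ^ (α / 2) = 1 := by
        rw [← Real.rpow_add hs0]; simp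
      calc (1 + t) ^ (-(α / 2)) * |potential α E t|
          ≤ (1 + t) ^ (-(α / 2)) * ((1 + t) ^ (α / 2) + |E|) := by gcongr
        _ = 1 + (1 + t) ^ (-(α / 2)) * |E| := by rw [mul_add, h2]
        _ ≤ 1 + 1 * |E| := by gcongr
        _ = _ := by ring
    have hcc : cutoff ρ L t * cutoff ρ L t ≤ 1 := by nlinarith only [hc0, hc1]
    have hcy : cutoff ρ L t * cutoff ρ L t * (1 + t) ^ (-(α / 2)) ≤ 1 :=
      mul_le_one₀ hcc hy0.le hy1
    have hM : M ≤ |M| := le_abs_self M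
    gcongr ?_ + _
    calc cutoff ρ L t * cutoff ρ L t * (1 + t) ^ (-(α / 2)) *
          (1 + 2 * |potential α E t| + 2 * M)
        ≤ cutoff ρ L t * cutoff ρ L t * (1 + t) ^ (-(α / 2)) *
          (1 + 2 * |potential α E t| + 2 * |M|) := by gcongr
      _ = cutoff ρ L t * cutoff ρ L t * (1 + t) ^ (-(α / 2)) * (1 + 2 * |M|) +
          2 * (cutoff ρ L t * cutoff ρ L t) * ((1 + t) ^ (-(α / 2)) * |potential α E t|) := by
          ring
      _ ≤ 1 * (1 + 2 * |M|) + 2 * 1 * (1 + |E|) := by gcongr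
      _ = _ := by ring

theorem flux_le (hn : 1 ≤ n) {α : ℝ} (hα₀ : 0 < α) (E : ℝ) (u : Space n → ℝ) {x : Space n}
    (hx : 1 ≤ ‖x‖ ^ 2) : flux α E u x ≤ (6 + 4 * fluxConst n α + 2 * |E|) *
      (‖x‖ ^ 2 * (gradSq u x + (1 + ‖x‖ ^ 2) ^ (α / 2) * u x ^ 2)) := by
  have hκ : 0 ≤ fluxConst n α := by
    have : (1 : ℝ) ≤ n := by exact_mod_cast hn
    rw [fluxConst]
    linarith
  have hY : 1 ≤ (1 + ‖x‖ ^ 2) ^ (α / 2) := Real.one_le_rpow (by linarith) (by positivity)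
  have hp := euler_sq_le u x
  have hG := gradSq_nonneg u x
  have hE := le_abs_self E
  have hE0 := abs_nonneg E
  rw [flux, potential]
  generalize (1 + ‖x‖ ^ 2) ^ (α / 2) = Y at *
  generalize ‖x‖ ^ 2 = t at *
  generalize fluxConst n α = κ at *
  generalize euler u x = p at *
  generalize gradSq u x = G at *
  generalize u x = v at *
  have h1 : 2 * (v * p) ≤ v ^ 2 + p ^ 2 := by linarith only [sq_nonneg (v - p)]
  have h2 : v ^ 2 ≤ t * (Y * v ^ 2) := by
    calc v ^ 2 = 1 * (1 * v ^ 2) := by ring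
      _ ≤ _ := by gcongr
  have h3 : κ * (2 * (v * p)) ≤ κ * (t * (Y * v ^ 2) + t * G) := by gcongr; linarith
  have h4 : t * (E * v ^ 2) ≤ t * (|E| * (Y * v ^ 2)) := by
    gcongr
    calc v ^ 2 = 1 * v ^ 2 := by ring
      _ ≤ _ := by gcongr
  have h5 : 0 ≤ t * (Y * v ^ 2) := by positivity
  have h6 : 0 ≤ t * G := by positivity
  have h7 : 0 ≤ |E| * (t * G) := by positivity
  have h8 : 0 ≤ κ * (t * (Y * v ^ 2)) := by positivity
  have h9 : 0 ≤ κ * (t * G) := by positivity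
  linarith only [hp, h3, h4, h5, h6, h7, h8, h9]

/-! ### The flux at infinity -/

theorem fluxWeight_pos {α t : ℝ} (ht : 0 < t) : 0 < fluxWeight α t :=
  mul_pos (by positivity) (Real.log_pos (by linarith))

/-- Replacing `t` by `max t 1` avoids the zero of the logarithm at `t = 0`; the densities in use
live in `t ≥ 1`, where nothing changes. -/
theorem continuous_fluxWeight_max (α : ℝ) : Continuous fun t => fluxWeight α (max t 1) :=
  (continuousOn_fluxWeight α).comp_continuous (by fun_prop) fun t =>
    zero_le_one.trans (le_max_right t 1)

/-- The density with which the weights in the monotonicity formula fall. -/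
def fallDensity (α ρ L t : ℝ) : ℝ :=
  cutoff ρ L t ^ 2 * ((1 + max t 1) ^ (-(α / 2)) / (max t 1 * fluxWeight α (max t 1)))

theorem continuous_fallDensity (α ρ L : ℝ) : Continuous (fallDensity α ρ L) := by
  have h0 (t : ℝ) : 0 < max t 1 := zero_lt_one.trans_le (le_max_right t 1)
  refine ((continuous_cutoff ρ L).pow 2).mul (Continuous.div ?_ ?_ fun t => ?_)
  · exact (continuousOn_rpow_one_add (-(α / 2))).comp_continuous (by fun_prop) fun t => (h0 t).le
  · exact (by fun_prop : Continuous fun t : ℝ => max t 1).mul (continuous_fluxWeight_max α)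
  · exact (mul_pos (h0 t) (fluxWeight_pos (h0 t))).ne'

theorem fallDensity_nonneg (α ρ L t : ℝ) : 0 ≤ fallDensity α ρ L t := by
  have h0 : 0 < max t 1 := zero_lt_one.trans_le (le_max_right t 1)
  have := fluxWeight_pos (α := α) h0
  unfold fallDensity
  positivity

/-- The density is built so that its product with the weighted flux is bounded, up to a constant, by
`ψ² ⟨x⟩^{-α} (|∇u|² + ⟨x⟩^α u²)`, where `ψ` is the cutoff; the energy bound controls the integral of
this. On the other side, `s^{1/2-α/4} ≥ 1` for `α ≤ 2` makes it at least `1 / (s ln s)` where the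
cutoff is 1, whose integral grows like `ln ln L`. -/
theorem exists_le_integral_fallDensity {α : ℝ} (hα₂ : α ≤ 2) {ρ : ℝ} (hρ : 1 ≤ ρ)
    (R : ℝ) : ∃ L, ρ + 1 ≤ L ∧ R ≤ ∫ t in ρ..(2 * L), fallDensity α ρ L t := by
  have hlim : Tendsto (fun L : ℝ => Real.log (Real.log (1 + L))) atTop atTop :=
    Real.tendsto_log_atTop.comp (Real.tendsto_log_atTop.comp
      (tendsto_atTop_add_const_left _ _ tendsto_id))
  obtain ⟨L, hL1, hL2⟩ := ((eventually_ge_atTop (ρ + 1)).and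
    (hlim.eventually_ge_atTop (R + Real.log (Real.log (1 + (ρ + 1)))))).exists
  refine ⟨L, hL1, ?_⟩
  have hL0 : 0 < L := by linarith
  have hc := continuous_fallDensity α ρ L
  have hsc : ∀ t ∈ Set.uIcc (ρ + 1) L, 1 < 1 + t := fun t ht => by
    rw [Set.uIcc_of_le hL1] at ht
    linarith [ht.1]
  have hd : ∀ t ∈ Set.uIcc (ρ + 1) L, HasDerivAt (fun t => Real.log (Real.log (1 + t)))
      (1 / ((1 + t) * Real.log (1 + t))) t := fun t ht => by
    have h1 : HasDerivAt (fun t : ℝ => 1 + t) 1 t := (hasDerivAt_id t).const_add 1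
    have h2 := hsc t ht
    have h3 := Real.log_pos h2
    convert! (h1.log (by positivity)).log h3.ne' using 1
    field_simp
  have hcont : ContinuousOn (fun t : ℝ => 1 / ((1 + t) * Real.log (1 + t)))
      (Set.uIcc (ρ + 1) L) := by
    refine ContinuousOn.div continuousOn_const (ContinuousOn.mul (by fun_prop)
      (ContinuousOn.log (by fun_prop) fun t ht => ?_)) fun t ht => ?_
    · have := hsc t ht; positivity
    · have h2 := hsc t ht
      have h3 := Real.log_pos h2
      positivity
  have e := intervalIntegral.integral_eq_sub_of_hasDerivAt hd hcont.intervalIntegrable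
  calc R ≤ ∫ t in (ρ + 1)..L, 1 / ((1 + t) * Real.log (1 + t)) := by rw [e]; linarith
    _ ≤ ∫ t in (ρ + 1)..L, fallDensity α ρ L t := by
        refine intervalIntegral.integral_mono_on hL1 hcont.intervalIntegrable
          (hc.intervalIntegrable _ _) fun t ht => ?_
        have ht1 : 1 ≤ t := by linarith [ht.1]
        have hs0 : 0 < 1 + t := by linarith
        have hl := Real.log_pos (by linarith : 1 < 1 + t)
        rw [fallDensity, cutoff_eq_one hL0 ht.1 ht.2, max_eq_left ht1, fluxWeight, one_pow,
          one_mul, div_le_div_iff₀ (by positivity) (by positivity), one_mul]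
        have e1 : (1 + t) ^ (-(α / 2)) * (1 + t) = (1 + t) ^ (-(α / 2) + 1) := by
          rw [Real.rpow_add_one hs0.ne']
        have e2 : (1 + t) ^ (-α / 4 - 1 / 2) * (1 + t) ≤ (1 + t) ^ (-(α / 2) + 1) := by
          rw [← Real.rpow_add_one hs0.ne']
          exact Real.rpow_le_rpow_of_exponent_le (by linarith) (by linarith)
        have e3 : 0 < (1 + t) ^ (-α / 4 - 1 / 2) := by positivity
        calc t * ((1 + t) ^ (-α / 4 - 1 / 2) * Real.log (1 + t))
            ≤ (1 + t) * ((1 + t) ^ (-α / 4 - 1 / 2) * Real.log (1 + t)) := by gcongr; linarith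
          _ = ((1 + t) ^ (-α / 4 - 1 / 2) * (1 + t)) * Real.log (1 + t) := by ring
          _ ≤ (1 + t) ^ (-(α / 2) + 1) * Real.log (1 + t) := by gcongr
          _ = _ := by rw [← e1]; ring
    _ ≤ _ := by
        refine intervalIntegral.integral_mono_interval (by linarith) hL1 (by linarith)
          (ae_of_all _ fun t => fallDensity_nonneg α ρ L t) (hc.intervalIntegrable _ _)

/-- The flux of an approximate eigenfunction at infinity is not positive in the limit. -/
theorem eventually_integral_flux_le (hn : 1 ≤ n) {α M : ℝ} (hα₀ : 0 < α) (hα₂ : α ≤ 2) (E : ℝ)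
    {V : Space n → ℝ} (hV : IsShortRange α M V) :
    ∃ T₁ : ℝ, 1 ≤ T₁ ∧ ∀ (T₀ : ℝ) (u : ℕ → Space n → ℝ) (U : Space n → ℝ),
      IsApproxSolution α E T₀ V u U → ∀ ζ : ℝ → ℝ, Continuous ζ → (∀ t, 0 ≤ ζ t) →
      ∀ a b, T₁ ≤ a → T₀ ≤ a → a ≤ b → (∀ t, t ∉ Set.Icc a b → ζ t = 0) → ∀ ε > 0,
      ∀ᶠ k in atTop, ∫ x, ζ (‖x‖ ^ 2) * flux α E (u k) x ≤ ε := by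
  obtain ⟨T₁, hT₁, hmon⟩ := flux_monotone hn hα₀ hα₂ E hV
  refine ⟨T₁, hT₁, fun T₀ u U hu ζ hζc hζ0 a b ha₁ ha₀ hab hζs ε hε => ?_⟩
  have hκ : 0 ≤ fluxConst n α := by
    have : (1 : ℝ) ≤ n := by exact_mod_cast hn
    rw [fluxConst]
    linarith
  have hb1 : 1 ≤ b := by linarith
  obtain ⟨C, hC0, hC⟩ := exists_energy_le hα₀ hα₂ E hV (by linarith : 0 ≤ b)
  set Cf := 6 + 4 * fluxConst n α + 2 * |E| with hCf
  have hCf0 : 0 < Cf := by positivity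
  set M₀ := ∫ x, U x ^ 2 with hM₀
  have hM₀0 : 0 ≤ M₀ := integral_nonneg fun x => sq_nonneg _
  -- With this rise, `χ'` times the flux weight equals `ζ` on its support.
  set g₁ : ℝ → ℝ := fun t => ζ t / fluxWeight α (max t 1) with hg₁
  have hm0 (t : ℝ) : 0 < max t 1 := zero_lt_one.trans_le (le_max_right t 1)
  have hg₁c : Continuous g₁ :=
    hζc.div (continuous_fluxWeight_max α) fun t => (fluxWeight_pos (hm0 t)).ne'
  have hg₁0 (t : ℝ) : 0 ≤ g₁ t := div_nonneg (hζ0 t) (fluxWeight_pos (hm0 t)).le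
  set I₁ := ∫ t in a..b, g₁ t with hI₁
  have hI₁0 : 0 ≤ I₁ := intervalIntegral.integral_nonneg hab fun t _ => hg₁0 t
  -- `C` does not depend on `L`, so `L` can be taken large enough that the slope `c = I₁ / I₂`
  -- satisfies `c Cf (C + 1) M₀ < ε`; the added ones keep the threshold positive.
  obtain ⟨L, hL, hLI⟩ := exists_le_integral_fallDensity hα₂ hb1
    (2 * (I₁ + 1) * Cf * (C + 1) * (M₀ + 1) / ε)
  have hL0 : 0 < L := by linarith
  set I₂ := ∫ t in b..(2 * L), fallDensity α b L t with hI₂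
  have hI₂0 : 0 < I₂ := lt_of_lt_of_le (by positivity) hLI
  have hfs (t : ℝ) (ht : t ∉ Set.Icc b (2 * L)) : fallDensity α b L t = 0 := by
    rw [fallDensity, (cutoff_eq_zero hL0 ht).1]; simp
  obtain ⟨χ, hχ, hχ0, hχs, -⟩ := exists_isWeight hg₁c (continuous_fallDensity α b L) hg₁0
    (fallDensity_nonneg α b L) hab (by linarith : b ≤ 2 * L)
    (fun t ht => by rw [hg₁]; simp only [hζs t ht, zero_div]) hfs hI₂0
  rw [← hI₁, ← hI₂] at hχ
  set c := I₁ / I₂ with hc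
  have hc0 : 0 ≤ c := div_nonneg hI₁0 hI₂0.le
  -- smallness of the constant
  have hcs : c * Cf * ((C + 1) * M₀) < ε := by
    rw [div_le_iff₀ hε] at hLI
    rw [hc, div_mul_eq_mul_div, div_mul_eq_mul_div, div_lt_iff₀ hI₂0]
    have h1 : I₁ * Cf * ((C + 1) * M₀) ≤ (I₁ + 1) * Cf * ((C + 1) * (M₀ + 1)) := by
      gcongr <;> linarith
    have h2 : 0 < (I₁ + 1) * Cf * ((C + 1) * (M₀ + 1)) := by positivity
    linarith only [h1, h2, hLI]
  have hW1 := hu.tendsto_integral_weight hV (W := fun t => χ t * fluxResidualWeight n α t)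
    (a := a) (b := 2 * L) (hχ.continuousOn_self.mul (continuousOn_fluxResidualWeight α)) ha₀
    (fun t _ h => by simp only [hχs t h, zero_mul])
  have hW2 := hu.tendsto_integral_weight hV
    (W := fun t => cutoff b L t ^ 2 * (1 + t) ^ (-(α / 2)))
    (a := b) (b := 2 * L) (continuousOn_sq_cutoff_mul_rpow α b L) (by linarith)
    (fun t _ h => by simp only [(cutoff_eq_zero hL0 h).1]; simp)
  -- All that bounds the flux integral of the `k`-th approximant: two residual terms tending to zero
  -- and the mass on the falling shell.
  have hlim := hW1.add ((hW2.add ((hu.tendsto b (2 * L)).const_mul (C + 1))).const_mul (c * Cf))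
  have hle : ∫ x in shell n b (2 * L), U x ^ 2 ≤ M₀ :=
    setIntegral_le_integral hu.integrable (ae_of_all _ fun x => sq_nonneg _)
  have hlt : 0 + c * Cf * (0 + (C + 1) * ∫ x in shell n b (2 * L), U x ^ 2) < ε := by
    refine lt_of_le_of_lt ?_ hcs
    rw [zero_add, zero_add]
    gcongr
  filter_upwards [hlim.eventually_lt_const hlt] with k hk
  refine le_trans ?_ hk.le
  have hm := hmon (u k) (hu.contDiff k) χ _ hχ (fun t _ => hχ0 t)
    (fun t _ ht => hχs t fun h => by linarith [h.1])
  have he := hC L (by linarith) (u k) (hu.contDiff k)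
  have huc := (hu.contDiff k).continuous
  have hgc := gradSq_continuous (hu.contDiff k)
  have hfc := flux_continuous (α := α) (E := E) (hu.contDiff k)
  have hcutw := isWeight_cutoff b hL0
  -- pointwise comparison
  have i1 : Integrable fun x : Space n => (g₁ (‖x‖ ^ 2) - c * fallDensity α b L (‖x‖ ^ 2)) *
      fluxWeight α (‖x‖ ^ 2) * flux α E (u k) x := by
    simp only [mul_assoc]
    exact hχ.integrable_deriv_mul
      ((continuous_comp_normSq (continuousOn_fluxWeight α)).mul hfc)
  have i2 : Integrable fun x : Space n => cutoff b L (‖x‖ ^ 2) ^ 2 *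
      (1 + ‖x‖ ^ 2) ^ (-(α / 2)) * gradSq (u k) x :=
    integrable_of_normSq ((continuous_comp_normSq
      (continuousOn_sq_cutoff_mul_rpow α b L)).mul hgc) (T := 2 * L + 1) fun x hx => by
        rw [(cutoff_eq_zero hL0 fun h => by linarith [h.2]).1]; simp
  have i3 : Integrable ((shell n b (2 * L)).indicator fun x => u k x ^ 2) :=
    (integrable_indicator_iff (measurableSet_shell _ _)).mpr
      ((huc.pow 2).continuousOn.integrableOn_compact (isCompact_shell _ _))
  have i0 : Integrable fun x : Space n => ζ (‖x‖ ^ 2) * flux α E (u k) x :=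
    integrable_of_normSq (T := b + 1) ((hζc.comp (by fun_prop)).mul hfc) fun x hx => by
      rw [hζs _ fun h => by linarith [h.2]]; simp
  have key : ∫ x, ζ (‖x‖ ^ 2) * flux α E (u k) x ≤
      (∫ x, (g₁ (‖x‖ ^ 2) - c * fallDensity α b L (‖x‖ ^ 2)) *
        fluxWeight α (‖x‖ ^ 2) * flux α E (u k) x) + c * Cf * ((∫ x, cutoff b L (‖x‖ ^ 2) ^ 2 *
        (1 + ‖x‖ ^ 2) ^ (-(α / 2)) * gradSq (u k) x) + ∫ x in shell n b (2 * L), u k x ^ 2) := by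
    have i4 : Integrable fun x : Space n => c * Cf * (cutoff b L (‖x‖ ^ 2) ^ 2 *
        (1 + ‖x‖ ^ 2) ^ (-(α / 2)) * gradSq (u k) x +
          (shell n b (2 * L)).indicator (fun x => u k x ^ 2) x) := (i2.add i3).const_mul _
    rw [← integral_indicator (measurableSet_shell _ _), ← integral_add i2 i3,
      ← integral_const_mul, ← integral_add i1 i4]
    refine integral_mono i0 (i1.add i4) fun x => ?_
    have ht : 0 ≤ ‖x‖ ^ 2 := by positivity
    by_cases hx : x ∈ shell n b (2 * L)
    · have h1 : 1 ≤ ‖x‖ ^ 2 := hb1.trans hx.1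
      have hfw := fluxWeight_pos (α := α) (by linarith : 0 < ‖x‖ ^ 2)
      have hf := flux_le hn hα₀ E (u k) h1
      have hs0 : 0 < 1 + ‖x‖ ^ 2 := by positivity
      have hy : (1 + ‖x‖ ^ 2) ^ (-(α / 2)) * (1 + ‖x‖ ^ 2) ^ (α / 2) = 1 := by
        rw [← Real.rpow_add hs0]; simp
      have hy0 : 0 < (1 + ‖x‖ ^ 2) ^ (-(α / 2)) := by positivity
      have hq0 := cutoff_nonneg b L (‖x‖ ^ 2)
      have hq1 := cutoff_le_one b L (‖x‖ ^ 2)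
      have hG := gradSq_nonneg (u k) x
      simp only [Set.indicator_of_mem hx, hg₁, fallDensity, max_eq_left h1]
      rw [← hCf] at hf
      have e1 : (ζ (‖x‖ ^ 2) / fluxWeight α (‖x‖ ^ 2) - c * (cutoff b L (‖x‖ ^ 2) ^ 2 *
          ((1 + ‖x‖ ^ 2) ^ (-(α / 2)) / (‖x‖ ^ 2 * fluxWeight α (‖x‖ ^ 2))))) *
          fluxWeight α (‖x‖ ^ 2) * flux α E (u k) x = ζ (‖x‖ ^ 2) * flux α E (u k) x -
          c * cutoff b L (‖x‖ ^ 2) ^ 2 * (1 + ‖x‖ ^ 2) ^ (-(α / 2)) / ‖x‖ ^ 2 *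
            flux α E (u k) x := by
        have : ‖x‖ ^ 2 ≠ 0 := by positivity
        field_simp
      rw [e1]
      have e2 : c * cutoff b L (‖x‖ ^ 2) ^ 2 * (1 + ‖x‖ ^ 2) ^ (-(α / 2)) / ‖x‖ ^ 2 *
          flux α E (u k) x ≤ c * Cf * (cutoff b L (‖x‖ ^ 2) ^ 2 * (1 + ‖x‖ ^ 2) ^ (-(α / 2)) *
            gradSq (u k) x + u k x ^ 2) := by
        calc _ ≤ c * cutoff b L (‖x‖ ^ 2) ^ 2 * (1 + ‖x‖ ^ 2) ^ (-(α / 2)) / ‖x‖ ^ 2 *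
              (Cf * (‖x‖ ^ 2 * (gradSq (u k) x + (1 + ‖x‖ ^ 2) ^ (α / 2) * u k x ^ 2))) := by
              gcongr
          _ = c * Cf * (cutoff b L (‖x‖ ^ 2) ^ 2 * (1 + ‖x‖ ^ 2) ^ (-(α / 2)) * gradSq (u k) x +
              cutoff b L (‖x‖ ^ 2) ^ 2 * ((1 + ‖x‖ ^ 2) ^ (-(α / 2)) *
                (1 + ‖x‖ ^ 2) ^ (α / 2)) * u k x ^ 2) := by
              have hx0 : ‖x‖ ≠ 0 := fun h => by rw [h] at h1; norm_num at h1
              field_simp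
          _ ≤ c * Cf * (cutoff b L (‖x‖ ^ 2) ^ 2 * (1 + ‖x‖ ^ 2) ^ (-(α / 2)) * gradSq (u k) x +
              1 ^ 2 * 1 * u k x ^ 2) := by
              rw [hy]; gcongr
          _ = _ := by ring
      linarith only [e2]
    · have h0 := (cutoff_eq_zero hL0 (show ‖x‖ ^ 2 ∉ Set.Icc b (2 * L) from hx)).1
      simp only [Set.indicator_of_notMem hx, hfs _ hx, h0, hg₁]
      by_cases h1 : 1 ≤ ‖x‖ ^ 2
      · have hfw := fluxWeight_pos (α := α) (by linarith : 0 < ‖x‖ ^ 2)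
        rw [max_eq_left h1]
        apply le_of_eq
        field_simp
        ring
      · rw [hζs _ fun h => h1 (by linarith [h.1])]
        simp
  refine key.trans ?_
  have : c * Cf * ((∫ x, cutoff b L (‖x‖ ^ 2) ^ 2 *
        (1 + ‖x‖ ^ 2) ^ (-(α / 2)) * gradSq (u k) x) + ∫ x in shell n b (2 * L), u k x ^ 2) ≤
      c * Cf * ((∫ x, cutoff b L (‖x‖ ^ 2) ^ 2 * (1 + ‖x‖ ^ 2) ^ (-(α / 2)) *
        residual V (potential α E) (u k) x ^ 2) +
        (C + 1) * ∫ x in shell n b (2 * L), u k x ^ 2) := by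
    refine mul_le_mul_of_nonneg_left ?_ (by positivity)
    linarith only [he]
  exact add_le_add hm this

/-! ### Control of the interior mass and vanishing at infinity -/

/-- The tent function on `[τ, τ + 1]`. -/
def tent (τ t : ℝ) : ℝ := max 0 (min (t - τ) (τ + 1 - t))

theorem continuous_tent (τ : ℝ) : Continuous (tent τ) := by unfold tent; fun_prop

theorem tent_nonneg (τ t : ℝ) : 0 ≤ tent τ t := le_max_left _ _

theorem tent_le_one (τ t : ℝ) : tent τ t ≤ 1 := by
  refine max_le zero_le_one ?_
  rcases le_total t (τ + 1) with h | h
  · exact (min_le_left _ _).trans (by linarith)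
  · exact (min_le_right _ _).trans (by linarith)

theorem tent_eq_zero {τ t : ℝ} (h : t ∉ Set.Icc τ (τ + 1)) : tent τ t = 0 := by
  rw [Set.mem_Icc, not_and_or, not_le, not_le] at h
  rcases h with h | h
  · exact max_eq_left (min_le_of_left_le (by linarith))
  · exact max_eq_left (min_le_of_right_le (by linarith))

theorem integral_tent_pos (τ : ℝ) : 0 < ∫ t in τ..τ + 1, tent τ t := by
  refine intervalIntegral.intervalIntegral_pos_of_pos_on
    ((continuous_tent τ).intervalIntegrable _ _) (fun t ht => ?_) (by linarith)
  exact lt_max_of_lt_right (lt_min (by linarith [ht.1]) (by linarith [ht.2]))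

theorem integral_tent_le_one (τ : ℝ) : ∫ t in τ..τ + 1, tent τ t ≤ 1 := by
  calc ∫ t in τ..τ + 1, tent τ t ≤ ∫ _ in τ..τ + 1, (1 : ℝ) :=
        intervalIntegral.integral_mono_on (by linarith)
          ((continuous_tent τ).intervalIntegrable _ _) intervalIntegrable_const
          fun t _ => tent_le_one τ t
    _ = 1 := by simp

theorem cutoffDeriv_nonneg {ρ L t : ℝ} (hL : 0 < L) (h : t < L) : 0 ≤ cutoffDeriv ρ L t := by
  have h1 : t / L < 1 := (div_lt_one hL).mpr h
  rw [cutoffDeriv, deriv_smoothTransition_of_one_lt (x := 2 - t / L) (by linarith)]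
  have := mul_nonneg (deriv_smoothTransition_nonneg (t - ρ))
    (Real.smoothTransition.nonneg (2 - t / L))
  simpa

theorem integral_linear_comb {f₁ f₂ f₃ f₄ f₅ : Space n → ℝ} (h₁ : Integrable f₁)
    (h₂ : Integrable f₂) (h₃ : Integrable f₃) (h₄ : Integrable f₄) (h₅ : Integrable f₅)
    {c₂ c₃ c₄ : ℝ} : ∫ x, (f₁ x + c₂ * f₂ x + c₃ * f₃ x + c₄ * f₄ x + f₅ x) =
      (∫ x, f₁ x) + c₂ * (∫ x, f₂ x) + c₃ * (∫ x, f₃ x) + c₄ * (∫ x, f₄ x) + ∫ x, f₅ x := by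
  have i2 : Integrable fun x => f₁ x + c₂ * f₂ x := h₁.add (h₂.const_mul _)
  have i3 : Integrable fun x => f₁ x + c₂ * f₂ x + c₃ * f₃ x := i2.add (h₃.const_mul _)
  have i4 : Integrable fun x => f₁ x + c₂ * f₂ x + c₃ * f₃ x + c₄ * f₄ x :=
    i3.add (h₄.const_mul _)
  rw [integral_add i4 h₅, integral_add i3 (h₄.const_mul _), integral_add i2 (h₃.const_mul _),
    integral_add h₁ (h₂.const_mul _), integral_const_mul, integral_const_mul, integral_const_mul]

theorem linear_comb_le_of_forall {f₁ f₂ f₃ f₄ f₅ : Space n → ℝ} (h₁ : Integrable f₁)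
    (h₂ : Integrable f₂) (h₃ : Integrable f₃) (h₄ : Integrable f₄) (h₅ : Integrable f₅)
    {c₁ c₂ c₃ c₅ : ℝ}
    (h : ∀ x, c₁ * f₁ x + (c₂ * f₂ x - c₃ * f₃ x) ≤ f₄ x + c₅ * f₅ x) :
    c₁ * (∫ x, f₁ x) + (c₂ * (∫ x, f₂ x) - c₃ * ∫ x, f₃ x) ≤
      (∫ x, f₄ x) + c₅ * ∫ x, f₅ x := by
  have i23 : Integrable fun x => c₂ * f₂ x - c₃ * f₃ x := (h₂.const_mul _).sub (h₃.const_mul _)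
  have := integral_mono ((h₁.const_mul c₁).add i23) (h₄.add (h₅.const_mul c₅)) h
  simp only [Pi.add_apply] at this
  rwa [integral_add (h₁.const_mul _) i23, integral_sub (h₂.const_mul _) (h₃.const_mul _),
    integral_add h₄ (h₅.const_mul _), integral_const_mul, integral_const_mul, integral_const_mul,
    integral_const_mul] at this

/-- The multiplier of the power inequality whose bulk is `t ^ (k + 1)`. -/
def powerFlux (α E : ℝ) (k : ℕ) (u : Space n → ℝ) (x : Space n) : ℝ :=
  flux α E u x + 4 * powerGap α k * (u x * euler u x) + 4 * powerConst n k * (k + 1) * u x ^ 2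

theorem powerFlux_continuous {α E : ℝ} {k : ℕ} {u : Space n → ℝ} (hu : ContDiff ℝ ∞ u) :
    Continuous (powerFlux α E k u) := by
  have := flux_continuous (α := α) (E := E) hu
  have := euler_continuous hu
  have := hu.continuous
  unfold powerFlux
  fun_prop

/-- In the far region `t^{k+1} χ' = -c ψ` with `ψ` the cutoff: the power is undone, and the sign of
the flux can be used with `ζ = ψ`. The bound on `c` is uniform in `L`. The lower bound on `χ
t^{k+1}` comes from the part of the fall that lies in `[t + 1, 2t]`. -/
theorem exists_multiplier (k : ℕ) {τ ρ L : ℝ} (hτ : 1 ≤ τ) (hρ : τ + 1 ≤ ρ) (hL : ρ + 2 ≤ L) :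
    ∃ (c : ℝ) (χ : ℝ → ℝ), 0 ≤ c ∧ c ≤ (ρ + 2) ^ (k + 1) ∧
      IsWeight χ (fun t => tent τ t - c * (cutoff ρ L t / max t 1 ^ (k + 1))) ∧ (∀ t, 0 ≤ χ t) ∧
      (∀ t, t ∉ Set.Icc τ (2 * L) → χ t = 0) ∧
      (∀ t ∈ Set.Icc (τ + 1) ρ, χ t = ∫ t in τ..τ + 1, tent τ t) ∧
      ∀ t ∈ Set.Icc ρ (L / 2), c * ((t - 1) / 2 ^ (k + 1)) ≤ χ t * t ^ (k + 1) := by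
  have hL0 : 0 < L := by linarith
  set g₂ : ℝ → ℝ := fun t => cutoff ρ L t / max t 1 ^ (k + 1) with hg₂
  have hmax (t : ℝ) : 0 < max t 1 := lt_max_of_lt_right one_pos
  have hc₂ : Continuous g₂ :=
    (continuous_cutoff ρ L).div (by fun_prop) fun t => (pow_pos (hmax t) _).ne'
  have h₂ (t : ℝ) : 0 ≤ g₂ t := div_nonneg (cutoff_nonneg ρ L t) (pow_pos (hmax t) _).le
  have i2 (s t : ℝ) : IntervalIntegrable g₂ volume s t := hc₂.intervalIntegrable _ _
  have hz₂ (t : ℝ) (ht : t ∉ Set.Icc ρ (2 * L)) : g₂ t = 0 := by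
    rw [hg₂]; simp only [(cutoff_eq_zero hL0 ht).1, zero_div]
  have lower {s d : ℝ} (hs : ρ ≤ s) (hsd : s + 1 ≤ d) (hd : d ≤ L) :
      (d - (s + 1)) / d ^ (k + 1) ≤ ∫ t in s..2 * L, g₂ t := by
    calc (d - (s + 1)) / d ^ (k + 1) = ∫ _ in s + 1..d, 1 / d ^ (k + 1) := by
          rw [intervalIntegral.integral_const, smul_eq_mul, mul_one_div]
      _ ≤ ∫ t in s + 1..d, g₂ t := by
          refine intervalIntegral.integral_mono_on hsd intervalIntegrable_const (i2 _ _)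
            fun t ht => ?_
          simp only [hg₂]
          rw [cutoff_eq_one hL0 (by linarith [ht.1]) (by linarith [ht.2]),
            max_eq_left (by linarith [ht.1])]
          have : 0 < t := by linarith [ht.1]
          gcongr
          exact ht.2
      _ ≤ ∫ t in s..2 * L, g₂ t := by
          refine intervalIntegral.integral_mono_interval (by linarith) hsd (by linarith)
            (ae_of_all _ h₂) (i2 _ _)
  have hI₂ : ∫ t in τ + 1..2 * L, g₂ t = ∫ t in ρ..2 * L, g₂ t := by
    rw [← intervalIntegral.integral_add_adjacent_intervals (i2 (τ + 1) ρ) (i2 ρ (2 * L))]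
    have : ∫ t in τ + 1..ρ, g₂ t = 0 := by
      rw [intervalIntegral.integral_of_le hρ, integral_Ioc_eq_integral_Ioo]
      exact setIntegral_eq_zero_of_forall_eq_zero fun x hx => hz₂ x fun h => by
        linarith [h.1, hx.2]
    rw [this, zero_add]
  -- The cutoff is 1 on `[ρ+1, ρ+2]`, so the fall has length at least `(ρ+2)^{-(k+1)}`; this bounds
  -- `c`.
  have hI₂l := lower le_rfl (by linarith : ρ + 1 ≤ ρ + 2) hL
  rw [show ρ + 2 - (ρ + 1) = 1 by ring] at hI₂l
  have hp : 0 < (ρ + 2) ^ (k + 1) := by have : 0 < ρ + 2 := by linarith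
                                        positivity
  have hI₂0 : 0 < ∫ t in ρ..2 * L, g₂ t := lt_of_lt_of_le (by positivity) hI₂l
  obtain ⟨χ, hχ, hχ0, hχs, hχe⟩ := exists_isWeight (continuous_tent τ) hc₂ (tent_nonneg τ) h₂
    (a := τ) (b := τ + 1) (d := 2 * L) (by linarith) (by linarith) (fun t => tent_eq_zero)
    (fun t ht => hz₂ t fun h => ht ⟨by linarith [h.1], h.2⟩) (hI₂ ▸ hI₂0)
  rw [hI₂] at hχ hχe
  set c := (∫ t in τ..τ + 1, tent τ t) / ∫ t in ρ..2 * L, g₂ t with hc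
  have hc0 : 0 ≤ c := div_nonneg (integral_tent_pos τ).le hI₂0.le
  refine ⟨c, χ, hc0, ?_, hχ, hχ0, hχs, fun t ht => ?_, fun t ht => ?_⟩
  · rw [hc, div_le_iff₀ hI₂0]
    refine (integral_tent_le_one τ).trans ?_
    rw [div_le_iff₀ hp] at hI₂l
    linarith
  · rw [hχe t ⟨ht.1, by linarith [ht.2]⟩]
    have : ∫ s in t..2 * L, g₂ s = ∫ s in ρ..2 * L, g₂ s := by
      rw [← intervalIntegral.integral_add_adjacent_intervals (i2 t ρ) (i2 ρ (2 * L))]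
      have : ∫ s in t..ρ, g₂ s = 0 := by
        rw [intervalIntegral.integral_of_le ht.2, integral_Ioc_eq_integral_Ioo]
        exact setIntegral_eq_zero_of_forall_eq_zero fun x hx => hz₂ x fun h => by
          linarith [h.1, hx.2]
      rw [this, zero_add]
    rw [this, hc, div_mul_cancel₀ _ hI₂0.ne']
  · have ht0 : 0 < t := by linarith [ht.1]
    rw [hχe t ⟨by linarith [ht.1], by linarith [ht.2]⟩, mul_assoc]
    refine mul_le_mul_of_nonneg_left ?_ hc0
    have := lower ht.1 (by linarith [ht.1] : t + 1 ≤ 2 * t) (by linarith [ht.2])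
    calc (t - 1) / 2 ^ (k + 1) = (2 * t - (t + 1)) / (2 * t) ^ (k + 1) * t ^ (k + 1) := by
          rw [mul_pow]; field_simp; ring
      _ ≤ _ := by gcongr

/-- The interior mass with weight `t ^ (k + 1)` is controlled by the near field, the flux at
infinity and the exterior mass. -/
theorem interior_mass_le {α M : ℝ} (hα₀ : 0 < α) (hα₂ : α ≤ 2) (E : ℝ)
    {V : Space n → ℝ} (hV : IsShortRange α M V) :
    ∃ T₁ : ℝ, 1 ≤ T₁ ∧ ∀ τ, T₁ ≤ τ → ∀ k : ℕ, ∃ ρ₀ D : ℝ, τ + 1 ≤ ρ₀ ∧ 0 ≤ D ∧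
      ∀ ρ, ρ₀ ≤ ρ → ∀ L, 2 * (ρ + 2) ≤ L →
      ∃ (c : ℝ) (χ : ℝ → ℝ), 0 ≤ c ∧ c ≤ (ρ + 2) ^ (k + 1) ∧ ContinuousOn χ (Set.Ici 0) ∧
        (∀ t, t ∉ Set.Icc τ (2 * L) → χ t = 0) ∧
        ∀ u : Space n → ℝ, ContDiff ℝ ∞ u → ∀ ρ', ρ' < ρ →
          (∫ t in τ..τ + 1, tent τ t) / 2 *
            ∫ x in shell n (τ + 1) ρ', (‖x‖ ^ 2) ^ (k + 1) * u x ^ 2 ≤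
          (∫ x, -(tent τ (‖x‖ ^ 2) * (‖x‖ ^ 2) ^ (k + 1) * powerFlux α E k u x)) +
          c * (∫ x, cutoff ρ L (‖x‖ ^ 2) * flux α E u x) +
          (∫ x, χ (‖x‖ ^ 2) * (‖x‖ ^ 2) ^ (k + 2) * residual V (potential α E) u x ^ 2) +
          c * (D * ∫ x in shell n (L / 2) (2 * L), u x ^ 2) := by
  obtain ⟨T₁, hT₁, key⟩ := power_inequality hα₀ E hV
  obtain ⟨K, hK0, hK⟩ := exists_deriv_smoothTransition_le
  refine ⟨T₁, hT₁, fun τ hτ k => ?_⟩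
  set lam := powerGap α k with hlam
  set B := 4 * powerConst n k * (k + 1) with hB
  have hlam0 : 0 ≤ lam := by
    have : (0 : ℝ) ≤ k := k.cast_nonneg
    rw [hlam, powerGap]; linarith
  have hB0 : 0 ≤ B := by rw [hB, powerConst]; positivity
  -- Beyond `ρ₀` one has `2B ≤ (t - 1) / 2^{k+1}`, so the term `c B ψ u²` is absorbed on the left up
  -- to `L / 2`. `D` collects what remains on `[L/2, 2L]`: `B` from that term and `4 lam · 2K` from
  -- the derivative of the cutoff.
  refine ⟨τ + 1 + 2 * B * 2 ^ (k + 1), B + 8 * lam * K, by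
    have : 0 ≤ 2 * B * 2 ^ (k + 1) := by positivity
    linarith, by positivity, fun ρ hρ L hL => ?_⟩
  have hρ₁ : 2 * B * 2 ^ (k + 1) ≤ ρ - 1 := by linarith
  have hρ₂ : τ + 1 ≤ ρ := by
    have : 0 ≤ 2 * B * 2 ^ (k + 1) := by positivity
    linarith
  have hL0 : 0 < L := by linarith
  obtain ⟨c, χ, hc0, hc1, hχ, hχ0, hχs, hχI, hχl⟩ :=
    exists_multiplier k (hT₁.trans hτ) hρ₂ (L := L) (by linarith)
  refine ⟨c, χ, hc0, hc1, hχ.continuousOn_self, hχs, fun u hu ρ' hρ' => ?_⟩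
  have h0 := key u hu k χ _ hχ (fun t _ => hχ0 t) fun t _ ht =>
    hχs t fun h => by linarith [h.1]
  set I₁ := ∫ t in τ..τ + 1, tent τ t with hI₁
  have hψ := isWeight_cutoff ρ hL0
  have huc := hu.continuous
  have hec := euler_continuous hu
  have hfc := flux_continuous (α := α) (E := E) hu
  have hpc := powerFlux_continuous (α := α) (E := E) (k := k) hu
  have j1 : Integrable fun x => -(tent τ (‖x‖ ^ 2) * (‖x‖ ^ 2) ^ (k + 1) * powerFlux α E k u x) := by
    refine integrable_of_normSq (T := τ + 2) ?_ fun x hx => ?_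
    · have := continuous_tent τ
      fun_prop
    · rw [tent_eq_zero fun h => by linarith [h.2]]; simp
  have j2 : Integrable fun x => cutoff ρ L (‖x‖ ^ 2) * flux α E u x := hψ.integrable_mul hfc
  have j3 : Integrable fun x => cutoff ρ L (‖x‖ ^ 2) * (u x * euler u x) :=
    hψ.integrable_mul (by fun_prop)
  have j4 : Integrable fun x => cutoff ρ L (‖x‖ ^ 2) * u x ^ 2 := hψ.integrable_mul (by fun_prop)
  have j4' : Integrable fun x => cutoffDeriv ρ L (‖x‖ ^ 2) * (‖x‖ ^ 2 * u x ^ 2) :=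
    hψ.integrable_deriv_mul (by fun_prop)
  obtain ⟨T₀, hT₀⟩ := hχ.eventually_zero
  have hχc : Continuous fun x : Space n => χ (‖x‖ ^ 2) := hχ.continuous
  have j5 : Integrable fun x => χ (‖x‖ ^ 2) * (‖x‖ ^ 2) ^ (k + 2) *
      residual V (potential α E) u x ^ 2 :=
    integrable_mul_residual_sq hu hV.aestronglyMeasurable hV.bound (continuousOn_potential α E)
      (w := fun x => χ (‖x‖ ^ 2) * (‖x‖ ^ 2) ^ (k + 2)) (hχc.mul (by fun_prop)) (T := T₀)
      fun x hx => by simp only [(hT₀ _ hx).1, zero_mul]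
  have hYc : Continuous fun x : Space n => (1 + ‖x‖ ^ 2) ^ (α / 2) :=
    continuous_comp_normSq (A := fun t => (1 + t) ^ (α / 2)) (continuousOn_rpow_one_add _)
  have j6 : Integrable fun x => χ (‖x‖ ^ 2) * (‖x‖ ^ 2) ^ (k + 1) *
      (1 / 2 * (1 + ‖x‖ ^ 2) ^ (α / 2)) * u x ^ 2 := by
    refine integrable_of_normSq (T := T₀)
      (((hχc.mul (by fun_prop)).mul (by fun_prop)).mul (by fun_prop)) fun x hx => ?_
    simp only [(hT₀ _ hx).1, zero_mul]
  have hs (a b : ℝ) {f : Space n → ℝ} (hf : Continuous f) : Integrable ((shell n a b).indicator f) :=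
    (integrable_indicator_iff (measurableSet_shell a b)).mpr
      (hf.continuousOn.integrableOn_compact (isCompact_shell a b))
  have j7 := hs (τ + 1) ρ' (f := fun x => (‖x‖ ^ 2) ^ (k + 1) * u x ^ 2) (by fun_prop)
  have j8 := hs (L / 2) (2 * L) (f := fun x => u x ^ 2) (by fun_prop)
  -- Trades `ψ u (x·∇u)` for `-(n/2) ψ u² - t ψ' u²`. As `lam ≥ 0`, the first has the favourable
  -- sign, and so has the second except where `ψ` decreases.
  have hvir := integral_weight_mul_euler hu hψ
  have hvir' : 2 * (∫ x, cutoff ρ L (‖x‖ ^ 2) * (u x * euler u x)) +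
      n * (∫ x, cutoff ρ L (‖x‖ ^ 2) * u x ^ 2) +
      2 * ∫ x, cutoffDeriv ρ L (‖x‖ ^ 2) * (‖x‖ ^ 2 * u x ^ 2) = 0 := by
    rw [← integral_const_mul, ← integral_const_mul, ← integral_const_mul, ← integral_add,
      ← integral_add, ← hvir]
    · refine integral_congr_ae (ae_of_all _ fun x => ?_)
      simp only; ring
    · exact (j3.const_mul _).add (j4.const_mul _)
    · exact j4'.const_mul _
    · exact j3.const_mul _
    · exact j4.const_mul _
  have hsplit : ∫ x, (-((tent τ (‖x‖ ^ 2) - c * (cutoff ρ L (‖x‖ ^ 2) /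
        max (‖x‖ ^ 2) 1 ^ (k + 1))) * (‖x‖ ^ 2) ^ (k + 1) * (flux α E u x +
          4 * lam * (u x * euler u x) + B * u x ^ 2)) +
          χ (‖x‖ ^ 2) * (‖x‖ ^ 2) ^ (k + 2) * residual V (potential α E) u x ^ 2) =
      (∫ x, -(tent τ (‖x‖ ^ 2) * (‖x‖ ^ 2) ^ (k + 1) * powerFlux α E k u x)) +
      c * (∫ x, cutoff ρ L (‖x‖ ^ 2) * flux α E u x) +
      c * (4 * lam) * (∫ x, cutoff ρ L (‖x‖ ^ 2) * (u x * euler u x)) +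
      c * B * (∫ x, cutoff ρ L (‖x‖ ^ 2) * u x ^ 2) +
      ∫ x, χ (‖x‖ ^ 2) * (‖x‖ ^ 2) ^ (k + 2) * residual V (potential α E) u x ^ 2 := by
    rw [← integral_linear_comb j1 j2 j3 j4 j5]
    refine integral_congr_ae (ae_of_all _ fun x => ?_)
    have e : cutoff ρ L (‖x‖ ^ 2) / max (‖x‖ ^ 2) 1 ^ (k + 1) * (‖x‖ ^ 2) ^ (k + 1) =
        cutoff ρ L (‖x‖ ^ 2) := by
      by_cases h : 1 ≤ ‖x‖ ^ 2
      · rw [max_eq_left h, div_mul_cancel₀ _ (by positivity)]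
      · rw [(cutoff_eq_zero hL0 fun h' => h (by linarith [h'.1])).1]; simp
    simp only [powerFlux, ← hlam, ← hB]
    linear_combination (c * (flux α E u x + 4 * lam * (u x * euler u x) + B * u x ^ 2)) * e
  have hpt : I₁ / 2 * (∫ x, (shell n (τ + 1) ρ').indicator
        (fun x => (‖x‖ ^ 2) ^ (k + 1) * u x ^ 2) x) +
      (c * (B - 2 * lam * n) * (∫ x, cutoff ρ L (‖x‖ ^ 2) * u x ^ 2) -
        c * (4 * lam) * ∫ x, cutoffDeriv ρ L (‖x‖ ^ 2) * (‖x‖ ^ 2 * u x ^ 2)) ≤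
      (∫ x, χ (‖x‖ ^ 2) * (‖x‖ ^ 2) ^ (k + 1) * (1 / 2 * (1 + ‖x‖ ^ 2) ^ (α / 2)) * u x ^ 2) +
      c * (B + 8 * lam * K) * ∫ x, (shell n (L / 2) (2 * L)).indicator (fun x => u x ^ 2) x := by
    refine linear_comb_le_of_forall j7 j4 j4' j6 j8 fun x => ?_
    have ht : 0 ≤ ‖x‖ ^ 2 := by positivity
    have hY : 1 ≤ (1 + ‖x‖ ^ 2) ^ (α / 2) := Real.one_le_rpow (by linarith) (by positivity)
    have hχx := hχ0 (‖x‖ ^ 2)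
    have hu2 := sq_nonneg (u x)
    have m1 : x ∈ shell n (τ + 1) ρ' ↔ ‖x‖ ^ 2 ∈ Set.Icc (τ + 1) ρ' := Iff.rfl
    have m2 : x ∈ shell n (L / 2) (2 * L) ↔ ‖x‖ ^ 2 ∈ Set.Icc (L / 2) (2 * L) := Iff.rfl
    have hr : 0 ≤ χ (‖x‖ ^ 2) * (‖x‖ ^ 2) ^ (k + 1) *
      (1 / 2 * (1 + ‖x‖ ^ 2) ^ (α / 2)) * u x ^ 2 := by positivity
    have hr' : 0 ≤ c * (B + 8 * lam * K) * (shell n (L / 2) (2 * L)).indicator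
        (fun x => u x ^ 2) x :=
      mul_nonneg (by positivity) (Set.indicator_nonneg (fun _ _ => sq_nonneg _) _)
    by_cases hmem : ‖x‖ ^ 2 ∈ Set.Icc ρ (2 * L)
    · rw [Set.indicator_of_notMem (s := shell n (τ + 1) ρ') fun h => by
        have := h.2
        linarith [hmem.1]]
      have hψ0 := cutoff_nonneg ρ L (‖x‖ ^ 2)
      have hψ1 := cutoff_le_one ρ L (‖x‖ ^ 2)
      -- Up to `L / 2` the cutoff does not decrease and `χ t^{k+1}` dominates; beyond, everything is
      -- charged to the exterior mass.
      by_cases hL2 : ‖x‖ ^ 2 ≤ L / 2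
      · have hd := cutoffDeriv_nonneg (ρ := ρ) hL0 (t := ‖x‖ ^ 2) (by linarith)
        have hl := hχl (‖x‖ ^ 2) ⟨hmem.1, hL2⟩
        have hB' : B ≤ 1 / 2 * ((‖x‖ ^ 2 - 1) / 2 ^ (k + 1)) := by
          have : 2 * B ≤ (‖x‖ ^ 2 - 1) / 2 ^ (k + 1) := by
            rw [le_div_iff₀ (by positivity)]
            linarith [hmem.1]
          linarith
        have e1 : c * (B - 2 * lam * n) * (cutoff ρ L (‖x‖ ^ 2) * u x ^ 2) ≤
            1 / 2 * (χ (‖x‖ ^ 2) * (‖x‖ ^ 2) ^ (k + 1)) * u x ^ 2 := by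
          calc c * (B - 2 * lam * n) * (cutoff ρ L (‖x‖ ^ 2) * u x ^ 2)
              ≤ c * B * (cutoff ρ L (‖x‖ ^ 2) * u x ^ 2) := by
                gcongr
                have : 0 ≤ 2 * lam * n := by positivity
                linarith
            _ ≤ c * (1 / 2 * ((‖x‖ ^ 2 - 1) / 2 ^ (k + 1))) * (1 * u x ^ 2) := by
                have := mul_nonneg hc0 (hB0.trans hB')
                gcongr
            _ = 1 / 2 * (c * ((‖x‖ ^ 2 - 1) / 2 ^ (k + 1))) * u x ^ 2 := by ring
            _ ≤ _ := by gcongr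
        have e2 : 1 / 2 * (χ (‖x‖ ^ 2) * (‖x‖ ^ 2) ^ (k + 1)) * u x ^ 2 ≤
            χ (‖x‖ ^ 2) * (‖x‖ ^ 2) ^ (k + 1) * (1 / 2 * (1 + ‖x‖ ^ 2) ^ (α / 2)) * u x ^ 2 := by
          calc _ = χ (‖x‖ ^ 2) * (‖x‖ ^ 2) ^ (k + 1) * (1 / 2 * 1) * u x ^ 2 := by ring
            _ ≤ _ := by gcongr
        have e3 : 0 ≤ c * (4 * lam) * (cutoffDeriv ρ L (‖x‖ ^ 2) * (‖x‖ ^ 2 * u x ^ 2)) := by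
          positivity
        linarith
      · rw [Set.indicator_of_mem (m2.mpr ⟨by linarith, hmem.2⟩)]
        have hd := neg_mul_cutoffDeriv_le (ρ := ρ) hK hL0 ht hmem.2
        have e1 : c * (B - 2 * lam * n) * (cutoff ρ L (‖x‖ ^ 2) * u x ^ 2) ≤
            c * B * (1 * u x ^ 2) := by
          calc c * (B - 2 * lam * n) * (cutoff ρ L (‖x‖ ^ 2) * u x ^ 2)
              ≤ c * B * (cutoff ρ L (‖x‖ ^ 2) * u x ^ 2) := by
                gcongr
                have : 0 ≤ 2 * lam * n := by positivity
                linarith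
            _ ≤ _ := by gcongr
        have e2 : c * (4 * lam) * (-(‖x‖ ^ 2 * cutoffDeriv ρ L (‖x‖ ^ 2)) * u x ^ 2) ≤
            c * (4 * lam) * (2 * K * u x ^ 2) := by gcongr
        linarith only [e1, e2, hr]
    · obtain ⟨z1, z2⟩ := cutoff_eq_zero hL0 hmem
      rw [z1, z2]
      by_cases hm : x ∈ shell n (τ + 1) ρ'
      · rw [Set.indicator_of_mem hm]
        have hx1 := hm.1
        have hx2 := hm.2
        rw [hχI (‖x‖ ^ 2) ⟨hx1, by linarith⟩] at hr ⊢
        have hI0 : 0 ≤ I₁ := (integral_tent_pos τ).le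
        have : I₁ / 2 * ((‖x‖ ^ 2) ^ (k + 1) * u x ^ 2) ≤ I₁ * (‖x‖ ^ 2) ^ (k + 1) *
            (1 / 2 * (1 + ‖x‖ ^ 2) ^ (α / 2)) * u x ^ 2 := by
          calc _ = I₁ * (‖x‖ ^ 2) ^ (k + 1) * (1 / 2 * 1) * u x ^ 2 := by ring
            _ ≤ _ := by gcongr
        linarith only [this, hr']
      · rw [Set.indicator_of_notMem hm]
        linarith only [hr, hr']
  rw [integral_indicator (measurableSet_shell _ _),
    integral_indicator (measurableSet_shell _ _)] at hpt
  simp only [← hlam, ← hB] at h0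
  rw [hsplit] at h0
  linear_combination h0 + hpt + c * (2 * lam) * hvir'

/-- Only the dependence on `k` matters: `(τ+1)^{k+1}` times a linear factor from `powerGap`. The
`u²` term of order `k²` has the good sign and is dropped; `-4p² - 4κ u p`, with `p = x·∇u` and `κ`
the flux constant, is bounded by completing the square. -/
theorem exists_near_le {α : ℝ} (hα₀ : 0 < α) (hα₂ : α ≤ 2) (E : ℝ) {τ : ℝ} (hτ : 1 ≤ τ) :
    ∃ C : ℝ, 0 ≤ C ∧ ∀ k : ℕ, ∀ u : Space n → ℝ, ContDiff ℝ ∞ u →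
      ∫ x, -(tent τ (‖x‖ ^ 2) * (‖x‖ ^ 2) ^ (k + 1) * powerFlux α E k u x) ≤
        (τ + 1) ^ (k + 1) * ((1 + 4 * powerGap α k) * C) *
          ((∫ x, cutoff (τ - 1) (τ + 1) (‖x‖ ^ 2) ^ 2 * (1 + ‖x‖ ^ 2) ^ (-(α / 2)) * gradSq u x) +
            ∫ x in shell n τ (τ + 1), u x ^ 2) := by
  set C₀ := fluxConst n α ^ 2 + 2 * (τ + 1) * |E| + 2 * (τ + 1) + 1 with hC₀
  have hC₀0 : 0 ≤ C₀ := by positivity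
  refine ⟨C₀ * (τ + 2) ^ (α / 2), by positivity, fun k u hu => ?_⟩
  have hg0 : 0 ≤ 4 * powerGap α k := by
    have : (0 : ℝ) ≤ k := k.cast_nonneg
    rw [powerGap]; linarith
  have hB0 : 0 ≤ 4 * powerConst n k * (k + 1) := by rw [powerConst]; positivity
  have huc := hu.continuous
  have hgc := gradSq_continuous hu
  have hpc := powerFlux_continuous (α := α) (E := E) (k := k) hu
  have hψc := continuous_cutoff (τ - 1) (τ + 1)
  have hYc : Continuous fun x : Space n => (1 + ‖x‖ ^ 2) ^ (-(α / 2)) :=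
    continuous_comp_normSq (A := fun t => (1 + t) ^ (-(α / 2))) (continuousOn_rpow_one_add _)
  have hτ1 : 0 < τ + 1 := by linarith
  have i1 : Integrable fun x => cutoff (τ - 1) (τ + 1) (‖x‖ ^ 2) ^ 2 *
      (1 + ‖x‖ ^ 2) ^ (-(α / 2)) * gradSq u x := by
    refine integrable_of_normSq (T := 2 * (τ + 1) + 1) (by fun_prop) fun x hx => ?_
    rw [(cutoff_eq_zero hτ1 fun h => by linarith [h.2]).1]
    simp
  have i2 : Integrable ((shell n τ (τ + 1)).indicator fun x => u x ^ 2) :=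
    (integrable_indicator_iff (measurableSet_shell _ _)).mpr
      ((huc.pow 2).continuousOn.integrableOn_compact (isCompact_shell _ _))
  rw [← integral_indicator (measurableSet_shell _ _), ← integral_add i1 i2, ← integral_const_mul]
  have i0 : Integrable fun x => -(tent τ (‖x‖ ^ 2) * (‖x‖ ^ 2) ^ (k + 1) * powerFlux α E k u x) := by
    refine integrable_of_normSq (T := τ + 2) ?_ fun x hx => ?_
    · have := continuous_tent τ
      fun_prop
    · rw [tent_eq_zero fun h => by linarith [h.2]]; simp
  refine integral_mono i0 ((i1.add i2).const_mul _) fun x => ?_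
  have ht : 0 ≤ ‖x‖ ^ 2 := by positivity
  have hG := gradSq_nonneg u x
  have hw : 0 ≤ cutoff (τ - 1) (τ + 1) (‖x‖ ^ 2) ^ 2 * (1 + ‖x‖ ^ 2) ^ (-(α / 2)) * gradSq u x := by
    positivity
  by_cases hx : x ∈ shell n τ (τ + 1)
  · have hx1 : τ ≤ ‖x‖ ^ 2 := hx.1
    have hx2 : ‖x‖ ^ 2 ≤ τ + 1 := hx.2
    rw [Set.indicator_of_mem hx, cutoff_eq_one hτ1 (by linarith) hx2]
    have hp := euler_sq_le u x
    have hY : 0 ≤ (1 + ‖x‖ ^ 2) ^ (α / 2) := by positivity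
    have hF : -powerFlux α E k u x ≤ (1 + 4 * powerGap α k) * C₀ * (gradSq u x + u x ^ 2) := by
      have hE := neg_abs_le E
      have hE0 := abs_nonneg E
      rw [powerFlux, flux, potential]
      generalize (1 + ‖x‖ ^ 2) ^ (α / 2) = Y at *
      generalize ‖x‖ ^ 2 = t at *
      generalize fluxConst n α = κ at *
      generalize 4 * powerGap α k = A at *
      generalize 4 * powerConst n k * (k + 1) = B at *
      generalize euler u x = p at *
      generalize gradSq u x = G at *
      generalize u x = v at *
      have e1 : -(4 * p ^ 2) - 4 * κ * (v * p) ≤ κ ^ 2 * v ^ 2 := by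
        linarith only [sq_nonneg (2 * p + κ * v)]
      have e2 : A * (-(v * p)) ≤ A * (v ^ 2 + (τ + 1) * G) := by
        gcongr
        have : t * G ≤ (τ + 1) * G := by gcongr
        nlinarith only [sq_nonneg (v + p), sq_nonneg v, sq_nonneg p, this, hp]
      have e3 : -(2 * t * (Y + E) * v ^ 2) ≤ 2 * (τ + 1) * |E| * v ^ 2 := by
        have h1 : 0 ≤ t * Y * v ^ 2 := by positivity
        have h2 : t * |E| * v ^ 2 ≤ (τ + 1) * |E| * v ^ 2 := by gcongr
        have h3 : t * v ^ 2 * (-E) ≤ t * v ^ 2 * |E| := by gcongr; linarith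
        linarith only [h1, h2, h3]
      have e4 : 2 * t * G ≤ 2 * (τ + 1) * G := by gcongr
      have e5 : 0 ≤ B * v ^ 2 := by positivity
      have e6 : 0 ≤ A * (κ ^ 2 + 2 * (τ + 1) * |E|) * (G + v ^ 2) := by positivity
      have e7 : 0 ≤ (κ ^ 2 + 2 * (τ + 1) * |E| + 1) * G + (2 * (τ + 1) + 1) * v ^ 2 := by
        positivity
      have e8 : 0 ≤ A * ((τ + 1) * (G + 2 * v ^ 2) + G) := by positivity
      rw [hC₀]
      linarith only [e1, e2, e3, e4, e5, e6, e7, e8]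
    have hY1 : 1 ≤ (τ + 2) ^ (α / 2) * (1 + ‖x‖ ^ 2) ^ (-(α / 2)) := by
      rw [Real.rpow_neg (by positivity), ← div_eq_mul_inv, one_le_div (by positivity)]
      exact Real.rpow_le_rpow (by positivity) (by linarith) (by positivity)
    have hY2 : 1 ≤ (τ + 2) ^ (α / 2) := Real.one_le_rpow (by linarith) (by positivity)
    calc -(tent τ (‖x‖ ^ 2) * (‖x‖ ^ 2) ^ (k + 1) * powerFlux α E k u x)
        = tent τ (‖x‖ ^ 2) * (‖x‖ ^ 2) ^ (k + 1) * -powerFlux α E k u x := by ring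
      _ ≤ tent τ (‖x‖ ^ 2) * (‖x‖ ^ 2) ^ (k + 1) *
          ((1 + 4 * powerGap α k) * C₀ * (gradSq u x + u x ^ 2)) := by
          have := tent_nonneg τ (‖x‖ ^ 2)
          gcongr
      _ ≤ 1 * (τ + 1) ^ (k + 1) * ((1 + 4 * powerGap α k) * C₀ *
          (((τ + 2) ^ (α / 2) * (1 + ‖x‖ ^ 2) ^ (-(α / 2))) * gradSq u x +
            (τ + 2) ^ (α / 2) * u x ^ 2)) := by
          gcongr
          · exact tent_le_one _ _
          · exact le_mul_of_one_le_left hG hY1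
          · exact le_mul_of_one_le_left (sq_nonneg _) hY2
      _ = _ := by ring
  · rw [Set.indicator_of_notMem hx, tent_eq_zero hx]
    simp only [zero_mul, neg_zero, add_zero]
    have : 0 ≤ C₀ * (τ + 2) ^ (α / 2) := by positivity
    positivity

theorem tendsto_setIntegral_shell {f : Space n → ℝ} (hf : Integrable f) :
    Tendsto (fun L : ℝ => ∫ x in shell n (L / 2) (2 * L), f x) atTop (𝓝 0) := by
  have h : Tendsto (fun L : ℝ => ∫ x, (shell n (L / 2) (2 * L)).indicator f x) atTop
      (𝓝 (∫ _ : Space n, (0 : ℝ))) := by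
    refine tendsto_integral_filter_of_dominated_convergence (fun x => ‖f x‖)
      (Eventually.of_forall fun L => hf.aestronglyMeasurable.indicator (measurableSet_shell _ _))
      (Eventually.of_forall fun L => ae_of_all _ fun x => norm_indicator_le_norm_self _ _)
      hf.norm (ae_of_all _ fun x => ?_)
    refine tendsto_const_nhds.congr' ?_
    filter_upwards [eventually_gt_atTop (2 * ‖x‖ ^ 2)] with L hL
    rw [Set.indicator_of_notMem]
    intro hx
    have := hx.1
    linarith
  rw [integral_zero] at h
  exact h.congr fun L => integral_indicator (measurableSet_shell _ _)

/-- An approximate solution has a limit which vanishes at infinity. -/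
theorem IsApproxSolution.ae_eq_zero (hn : 1 ≤ n) {α M : ℝ} (hα₀ : 0 < α) (hα₂ : α ≤ 2)
    {E T₀ : ℝ} {V : Space n → ℝ} (hV : IsShortRange α M V) {u : ℕ → Space n → ℝ}
    {U : Space n → ℝ} (h : IsApproxSolution α E T₀ V u U) :
    ∃ T : ℝ, ∀ᵐ x, T ≤ ‖x‖ ^ 2 → U x = 0 := by
  obtain ⟨T₁, hT₁, hint⟩ := interior_mass_le hα₀ hα₂ E hV
  obtain ⟨T₂, hT₂, hflux⟩ := eventually_integral_flux_le hn hα₀ hα₂ E hV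
  obtain ⟨τ, hτ1, hτ2, hτ0⟩ : ∃ τ, T₁ ≤ τ ∧ T₂ ≤ τ ∧ T₀ + 1 ≤ τ :=
    ⟨max T₁ (max T₂ (T₀ + 1)), le_max_left _ _, (le_max_left _ _).trans (le_max_right _ _),
      (le_max_right _ _).trans (le_max_right _ _)⟩
  have hτ : 1 ≤ τ := hT₁.trans hτ1
  obtain ⟨C, hC0, hC⟩ := exists_near_le (n := n) hα₀ hα₂ E hτ
  obtain ⟨C', hC'0, hC'⟩ := exists_energy_le hα₀ hα₂ E hV (ρ := τ - 1) (by linarith)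
  set m := ∫ x, U x ^ 2 with hm
  have hshell (a b : ℝ) : ∫ x in shell n a b, U x ^ 2 ≤ m :=
    setIntegral_le_integral h.integrable (ae_of_all _ fun x => sq_nonneg _)
  have hm0 : 0 ≤ m := integral_nonneg fun x => sq_nonneg _
  -- The near-field energy is bounded independently of `k`, through the energy estimate on a
  -- slightly larger shell.
  have hnear : ∀ᶠ j in atTop, (∫ x, cutoff (τ - 1) (τ + 1) (‖x‖ ^ 2) ^ 2 *
      (1 + ‖x‖ ^ 2) ^ (-(α / 2)) * gradSq (u j) x) + ∫ x in shell n τ (τ + 1), u j x ^ 2 ≤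
      (1 + C' * (m + 1)) + (m + 1) := by
    have e1 := (h.tendsto_integral_weight hV (continuousOn_sq_cutoff_mul_rpow α (τ - 1) (τ + 1))
      (a := τ - 1) (b := 2 * (τ + 1)) (by linarith) (fun t _ ht => by
        rw [(cutoff_eq_zero (by linarith) ht).1]; simp)).eventually_le_const zero_lt_one
    have e2 := (h.tendsto (τ - 1) (2 * (τ + 1))).eventually_le_const
      ((hshell _ _).trans_lt (lt_add_one m))
    have e3 := (h.tendsto τ (τ + 1)).eventually_le_const ((hshell _ _).trans_lt (lt_add_one m))
    filter_upwards [e1, e2, e3] with j h1 h2 h3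
    have := hC' (τ + 1) (by linarith) (u j) (h.contDiff j)
    have : C' * ∫ x in shell n (τ - 1) (2 * (τ + 1)), u j x ^ 2 ≤ C' * (m + 1) := by gcongr
    linarith
  set M₁ := (1 + C' * (m + 1)) + (m + 1) with hM₁
  have hM₁0 : 0 ≤ M₁ := by positivity
  set I₁ := ∫ t in τ..τ + 1, tent τ t with hI₁
  have hI₁0 : 0 < I₁ := integral_tent_pos τ
  -- For fixed `k` one chooses `ρ`, then `L`, and only then lets the approximants converge. The `3`
  -- is one each for the flux, the residual and the exterior mass.
  have main (ρ' : ℝ) (k : ℕ) : I₁ / 2 * ((τ + 2) ^ (k + 1) *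
      ∫ x in shell n (τ + 2) ρ', U x ^ 2) ≤
      (τ + 1) ^ (k + 1) * ((1 + 4 * powerGap α k) * C) * M₁ + 3 := by
    have hg0 : 0 ≤ 1 + 4 * powerGap α k := by
      have : (0 : ℝ) ≤ k := k.cast_nonneg
      rw [powerGap]; linarith
    obtain ⟨ρ₀, D, hρ₀, hD, hρ⟩ := hint τ hτ1 k
    obtain ⟨ρ, hρ1, hρ2⟩ : ∃ ρ, ρ₀ ≤ ρ ∧ ρ' < ρ :=
      ⟨max ρ₀ (ρ' + 1), le_max_left _ _, lt_max_of_lt_right (lt_add_one _)⟩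
    have hρ0 : 0 < ρ + 2 := by linarith
    set P := (ρ + 2) ^ (k + 1) with hP
    have hP0 : 0 < P := by positivity
    -- Since `c ≤ P` uniformly in `L`, an exterior mass below this makes `c D` times it at most 1;
    -- the flux is likewise made smaller than `1 / P`.
    have hδ : 0 < 1 / (P * (D + 1)) := by positivity
    obtain ⟨L, hL, hLU⟩ := ((eventually_ge_atTop (2 * (ρ + 2))).and
      ((tendsto_setIntegral_shell h.integrable).eventually_lt_const hδ)).exists
    have hL0 : 0 < L := by linarith
    obtain ⟨c, χ, hc0, hcP, hχc, hχs, hχ⟩ := hρ ρ hρ1 L hL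
    have e1 := hflux T₀ u U h (cutoff ρ L) (continuous_cutoff ρ L) (cutoff_nonneg ρ L) ρ (2 * L)
      (by linarith) (by linarith) (by linarith) (fun t ht => (cutoff_eq_zero hL0 ht).1) (1 / P)
      (by positivity)
    have e2 := (h.tendsto_integral_weight hV (W := fun t => χ t * t ^ (k + 2))
      (hχc.mul (by fun_prop)) (a := τ) (b := 2 * L) (by linarith) (fun t _ ht => by
        rw [hχs t ht, zero_mul])).eventually_le_const zero_lt_one
    have e3 := (h.tendsto (L / 2) (2 * L)).eventually_le_const hLU
    have e4 : Tendsto (fun j => I₁ / 2 * ((τ + 2) ^ (k + 1) *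
        ∫ x in shell n (τ + 2) ρ', u j x ^ 2)) atTop
        (𝓝 (I₁ / 2 * ((τ + 2) ^ (k + 1) * ∫ x in shell n (τ + 2) ρ', U x ^ 2))) :=
      ((h.tendsto (τ + 2) ρ').const_mul _).const_mul _
    refine le_of_tendsto e4 ?_
    filter_upwards [hnear, e1, e2, e3] with j h0 h1 h2 h3
    have hj := hχ (u j) (h.contDiff j) ρ' hρ2
    have hn' := hC k (u j) (h.contDiff j)
    have hjc := (h.contDiff j).continuous
    have hlow : (τ + 2) ^ (k + 1) * ∫ x in shell n (τ + 2) ρ', u j x ^ 2 ≤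
        ∫ x in shell n (τ + 1) ρ', (‖x‖ ^ 2) ^ (k + 1) * u j x ^ 2 := by
      have hI (a b : ℝ) {f : Space n → ℝ} (hf : Continuous f) : IntegrableOn f (shell n a b) :=
        hf.continuousOn.integrableOn_compact (isCompact_shell a b)
      rw [← integral_const_mul]
      calc ∫ x in shell n (τ + 2) ρ', (τ + 2) ^ (k + 1) * u j x ^ 2
          ≤ ∫ x in shell n (τ + 2) ρ', (‖x‖ ^ 2) ^ (k + 1) * u j x ^ 2 := by
            refine setIntegral_mono_on (hI _ _ (by fun_prop)) (hI _ _ (by fun_prop))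
              (measurableSet_shell _ _) fun x hx => ?_
            have := hx.1
            gcongr
        _ ≤ _ := by
            refine setIntegral_mono_set (hI _ _ (by fun_prop)) (ae_of_all _ fun x => ?_)
              (LE.le.eventuallyLE fun x hx => ⟨by linarith [hx.1], hx.2⟩)
            simp only [Pi.zero_apply]
            positivity
    have f1 : c * (∫ x, cutoff ρ L (‖x‖ ^ 2) * flux α E (u j) x) ≤ 1 := by
      calc _ ≤ c * (1 / P) := by gcongr
        _ ≤ P * (1 / P) := by gcongr
        _ = 1 := by field_simp
    have f2 : c * (D * ∫ x in shell n (L / 2) (2 * L), u j x ^ 2) ≤ 1 := by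
      calc _ ≤ P * ((D + 1) * (1 / (P * (D + 1)))) := by
            have : 0 ≤ ∫ x in shell n (L / 2) (2 * L), u j x ^ 2 :=
              setIntegral_nonneg (measurableSet_shell _ _) fun x _ => sq_nonneg _
            gcongr
            linarith
        _ = 1 := by field_simp
    have f3 : (τ + 1) ^ (k + 1) * ((1 + 4 * powerGap α k) * C) *
          ((∫ x, cutoff (τ - 1) (τ + 1) (‖x‖ ^ 2) ^ 2 * (1 + ‖x‖ ^ 2) ^ (-(α / 2)) *
            gradSq (u j) x) + ∫ x in shell n τ (τ + 1), u j x ^ 2) ≤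
        (τ + 1) ^ (k + 1) * ((1 + 4 * powerGap α k) * C) * M₁ := by gcongr
    have f4 : I₁ / 2 * ((τ + 2) ^ (k + 1) * ∫ x in shell n (τ + 2) ρ', u j x ^ 2) ≤
        I₁ / 2 * ∫ x in shell n (τ + 1) ρ', (‖x‖ ^ 2) ^ (k + 1) * u j x ^ 2 := by gcongr
    linarith only [hj, hn', f1, f2, f3, f4, h2]
  have hzero (ρ' : ℝ) : ∫ x in shell n (τ + 2) ρ', U x ^ 2 = 0 := by
    refine le_antisymm ?_ (setIntegral_nonneg (measurableSet_shell _ _) fun x _ => sq_nonneg _)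
    set a := ∫ x in shell n (τ + 2) ρ', U x ^ 2 with ha
    -- The geometric decay of this ratio beats the linear growth in `k`.
    have hr : (τ + 1) / (τ + 2) < 1 := by rw [div_lt_one] <;> linarith
    have hr0 : 0 ≤ (τ + 1) / (τ + 2) := by positivity
    have hlim := ((tendsto_self_mul_const_pow_of_lt_one hr0 hr).comp
      (tendsto_add_atTop_nat 1)).const_mul (4 * C * M₁ + 3)
    rw [mul_zero] at hlim
    have hle : I₁ / 2 * a ≤ 0 := by
      refine ge_of_tendsto hlim (Eventually.of_forall fun k => ?_)
      have hk := main ρ' k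
      have hg : (1 + 4 * powerGap α k) ≤ 4 * (k + 1 : ℝ) := by rw [powerGap]; linarith
      have h2 : 0 < (τ + 2) ^ (k + 1) := by positivity
      have h1 : 1 ≤ (τ + 1) ^ (k + 1) := one_le_pow₀ (by linarith)
      have hk1 : (1 : ℝ) ≤ k + 1 := by linarith [(k.cast_nonneg : (0 : ℝ) ≤ k)]
      simp only [Function.comp]
      rw [div_pow, ← mul_div_assoc, ← mul_div_assoc, le_div_iff₀ h2]
      push_cast
      calc I₁ / 2 * a * (τ + 2) ^ (k + 1) = I₁ / 2 * ((τ + 2) ^ (k + 1) * a) := by ring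
        _ ≤ (τ + 1) ^ (k + 1) * ((1 + 4 * powerGap α k) * C) * M₁ + 3 * (1 * 1) := by
          linarith
        _ ≤ (τ + 1) ^ (k + 1) * ((4 * (k + 1 : ℝ)) * C) * M₁ +
            3 * ((k + 1) * (τ + 1) ^ (k + 1)) := by gcongr
        _ = _ := by ring
    nlinarith only [hle, hI₁0]
  refine ⟨τ + 2, ?_⟩
  have hae (N : ℕ) : ∀ᵐ x, x ∈ shell n (τ + 2) N → U x = 0 := by
    have := (setIntegral_eq_zero_iff_of_nonneg_ae (ae_of_all _ fun x => sq_nonneg (U x))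
      h.integrable.integrableOn).mp (hzero N)
    rw [Filter.EventuallyEq, ae_restrict_iff' (measurableSet_shell _ _)] at this
    filter_upwards [this] with x hx hmem
    exact pow_eq_zero_iff two_ne_zero |>.mp (hx hmem)
  filter_upwards [ae_all_iff.mpr hae] with x hx ht
  obtain ⟨N, hN⟩ := exists_nat_ge (‖x‖ ^ 2)
  exact hx N ⟨ht, hN⟩

/-! ### The Laplacian on `H²` and Schwartz approximation -/

section

open TemperedDistribution FourierTransform

theorem continuous_embed : Continuous (embed n) :=
  (Lp.toTemperedDistributionCLM ℂ (volume : Measure (Space n)) 2).continuous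

/-- With the Fourier convention `exp(-2πi x·ξ)` the symbol of `-Δ` is `(2π)²|ξ|²`, so `1 + |ξ|²`
belongs to `1 - (2π)⁻² Δ`. -/
theorem besselPotential_two_apply (T : 𝓢'(Space n, ℂ)) :
    besselPotential (Space n) ℂ 2 T = T - ((2 * Real.pi) ^ 2)⁻¹ • Δ T := by
  have h1 : (fun x : Space n => ((1 : ℝ) : ℂ)).HasTemperateGrowth := by fun_prop
  have h2 : (fun x : Space n => ((‖x‖ ^ 2 : ℝ) : ℂ)).HasTemperateGrowth := by fun_prop
  have e : (fun x : Space n => (((1 + ‖x‖ ^ 2) ^ ((2 : ℝ) / 2) : ℝ) : ℂ)) =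
      (fun x : Space n => ((1 : ℝ) : ℂ)) + fun x : Space n => ((‖x‖ ^ 2 : ℝ) : ℂ) := by
    ext x
    simp
  rw [laplacian_eq_fourierMultiplierCLM, besselPotential, e, fourierMultiplierCLM_apply,
    smulLeftCLM_add h1 h2, fourierMultiplierCLM_apply]
  have hp : ((2 * Real.pi) ^ 2)⁻¹ * -(2 * Real.pi) ^ 2 = -1 := by
    have := Real.pi_pos
    field_simp
  rw [smul_smul, hp, neg_one_smul, sub_neg_eq_add, _root_.add_apply,
    FourierTransform.fourierInv_add, smulLeftCLM_const]
  simp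

/-- Plancherel, the symbol `(1 + |ξ|²)⁻¹` being at most 1. -/
theorem exists_besselPotential_neg_two (f : L2 n) :
    ∃ g : L2 n, embed n g = besselPotential (Space n) ℂ (-2) (embed n f) ∧ ‖g‖ ≤ ‖f‖ := by
  have hG : (fun x : Space n => (((1 + ‖x‖ ^ 2) ^ ((-2 : ℝ) / 2) : ℝ) : ℂ)).HasTemperateGrowth := by
    fun_prop
  have hb (x : Space n) : ‖(((1 + ‖x‖ ^ 2) ^ ((-2 : ℝ) / 2) : ℝ) : ℂ)‖ ≤ 1 := by
    rw [Complex.norm_real, Real.norm_of_nonneg (by positivity)]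
    exact Real.rpow_le_one_of_one_le_of_nonpos (by simp) (by norm_num)
  have hm : MemLp (fun x : Space n => (((1 + ‖x‖ ^ 2) ^ ((-2 : ℝ) / 2) : ℝ) : ℂ)) ∞ volume :=
    memLp_top_of_bound hG.1.continuous.aestronglyMeasurable 1 (ae_of_all _ hb)
  refine ⟨𝓕⁻ ((hm.toLp _) • 𝓕 f : L2 n), ?_, ?_⟩
  · rw [embed_apply, embed_apply, ← Lp.fourierInv_toTemperedDistribution_eq,
      Lp.toTemperedDistribution_smul_eq hG, ← Lp.fourier_toTemperedDistribution_eq]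
    rfl
  · have h1 : ‖(𝓕⁻ ((hm.toLp _) • 𝓕 f : L2 n) : L2 n)‖ = ‖((hm.toLp _) • 𝓕 f : L2 n)‖ :=
      (Lp.fourierTransformₗᵢ (Space n) ℂ).symm.norm_map _
    rw [h1]
    refine (Lp.norm_smul_le _ _).trans ?_
    rw [Lp.norm_fourier_eq]
    refine mul_le_of_le_one_left (norm_nonneg _) ?_
    rw [Lp.norm_toLp]
    refine ENNReal.toReal_le_of_le_ofReal zero_le_one ?_
    rw [eLpNorm_exponent_top]
    exact eLpNormEssSup_le_of_ae_bound (ae_of_all _ hb)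

/-- The element of `L²` defined by a Schwartz function. -/
def toL2 (s : 𝓢(Space n, ℂ)) : L2 n := s.toLp 2 volume

theorem embed_toL2 (s : 𝓢(Space n, ℂ)) :
    embed n (toL2 s) = s.toTemperedDistributionCLM (Space n) ℂ volume :=
  Lp.toTemperedDistribution_toLp_eq s

theorem toL2_mem_sobolevTwo (s : 𝓢(Space n, ℂ)) : toL2 s ∈ sobolevTwo n := by
  change MemSobolev 2 2 (embed n (toL2 s))
  rw [embed_toL2]
  exact s.memSobolev

theorem laplacian_embed_toL2 (s : 𝓢(Space n, ℂ)) :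
    Δ (embed n (toL2 s)) = embed n (toL2 (Δ s)) := by
  rw [embed_toL2, embed_toL2]
  exact laplacian_toTemperedDistributionCLM_eq s

theorem laplacianFun_eq {v : sobolevTwo n} {g : L2 n} (h : Δ (embed n v) = embed n g) :
    laplacianFun v = g :=
  embed_injective ((laplacianFun_spec v).symm.trans h)

theorem laplacianFun_toL2 (s : 𝓢(Space n, ℂ)) :
    laplacianFun ⟨toL2 s, toL2_mem_sobolevTwo s⟩ = toL2 (Δ s) :=
  laplacianFun_eq (laplacian_embed_toL2 s)

/-- The Laplacian is closed. -/
theorem exists_laplacianFun_eq_of_tendsto {v : ℕ → sobolevTwo n} {w g : L2 n}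
    (hv : Tendsto (fun k => (v k : L2 n)) atTop (𝓝 w))
    (hg : Tendsto (fun k => laplacianFun (v k)) atTop (𝓝 g)) :
    ∃ h : w ∈ sobolevTwo n, laplacianFun ⟨w, h⟩ = g := by
  have h1 : Δ (embed n w) = embed n g := by
    refine tendsto_nhds_unique (f := fun k => Δ (embed n (v k))) (l := atTop) ?_ ?_
    · simp only [← laplacianCLM_apply]
      exact (((LineDeriv.laplacianCLM ℂ (Space n) 𝓢'(Space n, ℂ)).continuous.comp
        continuous_embed).tendsto w).comp hv
    · simp only [laplacianFun_spec]
      exact (continuous_embed.tendsto g).comp hg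
  -- Membership in `H²` is witnessed by the `L²` function representing the Bessel potential of order
  -- 2.
  refine ⟨⟨w - ((2 * Real.pi) ^ 2)⁻¹ • g, ?_⟩, laplacianFun_eq h1⟩
  rw [besselPotential_two_apply, h1, ← embed_apply, map_sub]
  congr 1
  have := (embed n).map_smul_of_tower ((2 * Real.pi) ^ 2)⁻¹ g
  exact this.symm

/-- Schwartz functions are dense in `H²` for the graph norm. -/
theorem exists_schwartz_tendsto (v : sobolevTwo n) :
    ∃ s : ℕ → 𝓢(Space n, ℂ), Tendsto (fun k => toL2 (s k)) atTop (𝓝 (v : L2 n)) ∧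
      Tendsto (fun k => toL2 (Δ (s k))) atTop (𝓝 (laplacianFun v)) := by
  obtain ⟨f, hf⟩ := v.2
  rw [← embed_apply] at hf
  -- The Bessel potential `f` of `v` is approximated in `L²` by Schwartz functions; the inverse
  -- potential keeps them Schwartz and contracts `L²`.
  obtain ⟨y, hy, hlim⟩ := mem_closure_iff_seq_limit.mp
    (SchwartzMap.denseRange_toLpCLM (F := ℂ) (μ := (volume : Measure (Space n)))
      ENNReal.ofNat_ne_top f)
  choose s hs using hy
  have hs' (k : ℕ) : y k = toL2 (s k) := (hs k).symm
  set G : Space n → ℂ := fun x => (((1 + ‖x‖ ^ 2) ^ ((-2 : ℝ) / 2) : ℝ) : ℂ) with hGdef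
  have hG : G.HasTemperateGrowth := by rw [hGdef]; fun_prop
  set σ : ℕ → 𝓢(Space n, ℂ) := fun k => SchwartzMap.fourierMultiplierCLM ℂ G (s k) with hσ
  have hb (k : ℕ) : embed n (toL2 (σ k)) = besselPotential (Space n) ℂ (-2) (embed n (y k)) := by
    rw [hs', embed_toL2, embed_toL2]
    exact (fourierMultiplierCLM_toTemperedDistributionCLM_eq hG (s k)).symm
  have h1 : Tendsto (fun k => toL2 (σ k)) atTop (𝓝 (v : L2 n)) := by
    rw [tendsto_iff_norm_sub_tendsto_zero]
    refine squeeze_zero (fun _ => norm_nonneg _) (fun k => ?_)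
      (tendsto_iff_norm_sub_tendsto_zero.mp hlim)
    obtain ⟨g, hg, hgn⟩ := exists_besselPotential_neg_two (y k - f)
    have : toL2 (σ k) - (v : L2 n) = g := by
      apply embed_injective
      rw [hg, map_sub, map_sub, map_sub, hb, ← hf, besselPotential_besselPotential_apply]
      simp
    rw [this]
    exact hgn
  refine ⟨σ, h1, ?_⟩
  have hp : (2 * Real.pi) ^ 2 ≠ 0 := by positivity
  -- `Δ` is an affine combination of the identity and the Bessel potential, so convergence of
  -- Laplacians follows from two `L²` limits.
  have key (w : sobolevTwo n) (φ : L2 n) (h : besselPotential (Space n) ℂ 2 (embed n w) =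
      embed n φ) : laplacianFun w = ((2 * Real.pi) ^ 2) • ((w : L2 n) - φ) := by
    apply laplacianFun_eq
    have e := (embed n).map_smul_of_tower ((2 * Real.pi) ^ 2) ((w : L2 n) - φ)
    rw [e, map_sub, ← h, besselPotential_two_apply, sub_sub_cancel, smul_smul, mul_inv_cancel₀ hp,
      one_smul]
  rw [key v f hf]
  have h2 (k : ℕ) : toL2 (Δ (σ k)) = ((2 * Real.pi) ^ 2) • (toL2 (σ k) - y k) := by
    rw [← laplacianFun_toL2]
    refine key _ _ ?_
    simp only
    rw [hb, besselPotential_besselPotential_apply]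
    simp
  simp only [h2]
  exact (h1.sub hlim).const_smul _

end

/-! ### Vanishing sequences, relative bounds and symmetry -/

/-- The sequence `f` tends to zero in `L²`. -/
def Vanishes {F : Type*} [NormedAddCommGroup F] (f : ℕ → Space n → F) : Prop :=
  Tendsto (fun k => eLpNorm (f k) 2 volume) atTop (𝓝 0)

section Vanishes

variable {F G : Type*} [NormedAddCommGroup F] [NormedAddCommGroup G]

theorem Vanishes.of_le {f : ℕ → Space n → F} {g : ℕ → Space n → G} (hf : Vanishes f) (K : ℝ)
    (h : ∀ k, ∀ᵐ x, ‖g k x‖ ≤ K * ‖f k x‖) : Vanishes g := by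
  have h1 : Tendsto (fun k => ENNReal.ofReal K * eLpNorm (f k) 2 volume) atTop (𝓝 0) := by
    simpa using ENNReal.Tendsto.const_mul hf (Or.inr ENNReal.ofReal_ne_top)
  exact tendsto_of_tendsto_of_tendsto_of_le_of_le tendsto_const_nhds h1 (fun _ => zero_le)
    fun k => eLpNorm_le_mul_eLpNorm_of_ae_le_mul (h k) 2

theorem Vanishes.congr {f g : ℕ → Space n → F} (hf : Vanishes f) (h : ∀ k, f k =ᵐ[volume] g k) :
    Vanishes g :=
  Tendsto.congr (fun k => eLpNorm_congr_ae (h k)) hf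

theorem Vanishes.add {f g : ℕ → Space n → F} (hf : Vanishes f) (hg : Vanishes g)
    (hfm : ∀ k, AEStronglyMeasurable (f k)) (hgm : ∀ k, AEStronglyMeasurable (g k)) :
    Vanishes fun k x => f k x + g k x := by
  have h1 : Tendsto (fun k => eLpNorm (f k) 2 volume + eLpNorm (g k) 2 volume) atTop (𝓝 0) := by
    simpa using Tendsto.add hf hg
  exact tendsto_of_tendsto_of_tendsto_of_le_of_le tendsto_const_nhds h1 (fun _ => zero_le)
    fun k => eLpNorm_add_le (hfm k) (hgm k) (by norm_num)

theorem Vanishes.sum {ι : Type*} (S : Finset ι) {f : ι → ℕ → Space n → F}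
    (hf : ∀ i ∈ S, Vanishes (f i)) (hfm : ∀ i ∈ S, ∀ k, AEStronglyMeasurable (f i k)) :
    Vanishes fun k x => ∑ i ∈ S, f i k x := by
  classical
  induction S using Finset.induction_on with
  | empty => simp [Vanishes]
  | insert a S ha ih =>
    simp only [Finset.sum_insert ha]
    refine Vanishes.add (hf a (by simp)) (ih (fun i hi => hf i (by simp [hi]))
      fun i hi => hfm i (by simp [hi])) (hfm a (by simp)) fun k => ?_
    exact Finset.aestronglyMeasurable_fun_sum S fun i hi => hfm i (by simp [hi]) k

end Vanishes

theorem tendsto_iff_vanishes {u : ℕ → L2 n} {v : L2 n} :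
    Tendsto u atTop (𝓝 v) ↔ Vanishes fun k x => u k x - v x :=
  Lp.tendsto_Lp_iff_tendsto_eLpNorm' u v

theorem vanishes_iff_integral {f : ℕ → Space n → ℝ} (hf : ∀ k, MemLp (f k) 2 volume) :
    Vanishes f ↔ Tendsto (fun k => ∫ x, f k x ^ 2) atTop (𝓝 0) := by
  have h (k : ℕ) : eLpNorm (f k) 2 volume = ENNReal.ofReal (√(∫ x, f k x ^ 2)) := by
    rw [(hf k).eLpNorm_eq_integral_rpow_norm two_ne_zero ENNReal.ofNat_ne_top, Real.sqrt_eq_rpow]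
    simp
  rw [Vanishes]
  simp only [h]
  constructor
  · intro h'
    have h1 := ((ENNReal.tendsto_toReal ENNReal.zero_ne_top).comp h').pow 2
    simp only [ENNReal.toReal_zero, ne_eq, two_ne_zero, not_false_eq_true, zero_pow] at h1
    refine h1.congr fun k => ?_
    simp only [Function.comp]
    rw [ENNReal.toReal_ofReal (Real.sqrt_nonneg _),
      Real.sq_sqrt (integral_nonneg fun x => sq_nonneg _)]
  · intro h'
    have h1 := (ENNReal.continuous_ofReal.tendsto _).comp ((Real.continuous_sqrt.tendsto _).comp h')
    simpa [Function.comp_def] using h1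

/-- Multiplication operators are closed. -/
theorem ae_eq_mul_of_tendsto {g : Space n → ℝ} {u f : ℕ → L2 n} {u' f' : L2 n}
    (hu : Tendsto u atTop (𝓝 u')) (hf : Tendsto f atTop (𝓝 f'))
    (h : ∀ k, f k =ᵐ[volume] fun x => (g x : ℂ) * u k x) :
    f' =ᵐ[volume] fun x => (g x : ℂ) * u' x := by
  obtain ⟨φ, hφ, hφu⟩ := (tendstoInMeasure_of_tendsto_Lp hu).exists_seq_tendsto_ae
  obtain ⟨ψ, hψ, hψf⟩ :=
    (tendstoInMeasure_of_tendsto_Lp (hf.comp hφ.tendsto_atTop)).exists_seq_tendsto_ae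
  filter_upwards [hφu, hψf, ae_all_iff.mpr h] with x h1 h2 h3
  refine tendsto_nhds_unique h2 ?_
  simp only [Function.comp, h3]
  exact (h1.comp hψ.tendsto_atTop).const_mul _

theorem mulOp_ae_eq (g : Space n → ℝ) (u : (mulOp g).domain) :
    mulOp g u =ᵐ[volume] fun x => (g x : ℂ) * (u : L2 n) x :=
  (memLp_of_mem_mulDomain u).coeFn_toLp

/-- A `Δ`-compact multiplication operator has relative bound zero. -/
theorem exists_relative_bound {V : Space n → ℝ}
    (hV : IsRelativelyCompact (mulOp V) (laplacian n)) {ε : ℝ} (hε : 0 < ε) :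
    ∃ C : ℝ, 0 ≤ C ∧ ∀ v : (laplacian n).domain, ∀ f : L2 n,
      (f =ᵐ[volume] fun x => (V x : ℂ) * (v : L2 n) x) →
      ‖f‖ ≤ ε * ‖laplacian n v‖ + C * ‖(v : L2 n)‖ := by
  obtain ⟨hD, hcpt⟩ := hV
  -- Otherwise, after normalising `‖V w_k‖ = 1`, one has `w_k → 0` with `Δ w_k` bounded. A
  -- subsequence of `V w_k` converges by compactness, and its limit is zero because multiplication
  -- is closed, against norm one.
  by_contra! hcon
  have hcon' (k : ℕ) := hcon (k + 1) (by positivity)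
  choose v f hf hlt using hcon'
  have hfv (k : ℕ) : mulOp V ⟨v k, hD (v k).2⟩ = f k :=
    Lp.ext ((mulOp_ae_eq V ⟨v k, hD (v k).2⟩).trans (hf k).symm)
  have hpos (k : ℕ) : 0 < ‖f k‖ := lt_of_le_of_lt (by positivity) (hlt k)
  set c : ℕ → ℂ := fun k => ((‖f k‖⁻¹ : ℝ) : ℂ) with hc
  have hcn (k : ℕ) : ‖c k‖ = ‖f k‖⁻¹ := by
    rw [hc, Complex.norm_real, Real.norm_of_nonneg (by positivity)]
  set w : ℕ → (laplacian n).domain := fun k => c k • v k with hw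
  have hLw (k : ℕ) : laplacian n (w k) = c k • laplacian n (v k) := (laplacian n).map_smul _ _
  have hVw (k : ℕ) : mulOp V ⟨w k, hD (w k).2⟩ = c k • f k := by
    rw [← hfv, ← (mulOp V).map_smul]
    rfl
  have h1 (k : ℕ) : ε * ‖laplacian n (w k)‖ + (k + 1) * ‖(w k : L2 n)‖ < 1 := by
    have : (w k : L2 n) = c k • (v k : L2 n) := rfl
    rw [hLw, this, norm_smul, norm_smul, hcn]
    have := mul_lt_mul_of_pos_left (hlt k) (inv_pos.mpr (hpos k))
    rw [inv_mul_cancel₀ (hpos k).ne'] at this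
    linarith
  have h2 (k : ℕ) : ‖(w k : L2 n)‖ ≤ 1 / ((k : ℝ) + 1) := by
    rw [le_div_iff₀ (by positivity)]
    have := h1 k
    have : 0 ≤ ε * ‖laplacian n (w k)‖ := by positivity
    linarith
  obtain ⟨φ, g, hφ, hg⟩ := hcpt w ⟨1 + 1 / ε, fun k => by
    have a1 : ‖(w k : L2 n)‖ ≤ 1 := (h2 k).trans (by
      rw [div_le_one (by positivity)]
      linarith [(k.cast_nonneg : (0 : ℝ) ≤ k)])
    have a2 : ‖laplacian n (w k)‖ ≤ 1 / ε := by
      rw [le_div_iff₀ hε]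
      have := h1 k
      have : 0 ≤ ((k : ℝ) + 1) * ‖(w k : L2 n)‖ := by positivity
      linarith
    linarith⟩
  have hw0 : Tendsto (fun k => (w (φ k) : L2 n)) atTop (𝓝 0) :=
    (squeeze_zero_norm h2 tendsto_one_div_add_atTop_nhds_zero_nat).comp hφ.tendsto_atTop
  have hg0 : g = 0 := by
    apply Lp.ext
    refine (ae_eq_mul_of_tendsto hw0 hg fun k =>
      mulOp_ae_eq V ⟨w (φ k), hD (w (φ k)).2⟩).trans ?_
    filter_upwards [Lp.coeFn_zero ℂ 2 (volume : Measure (Space n))] with x hx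
    rw [hx, Pi.zero_apply, mul_zero]
  have hn1 (k : ℕ) : ‖mulOp V ⟨w (φ k), hD (w (φ k)).2⟩‖ = 1 := by
    rw [hVw, norm_smul, hcn, inv_mul_cancel₀ (hpos _).ne']
  have := hg.norm
  simp only [hn1, hg0, norm_zero] at this
  exact one_ne_zero (tendsto_nhds_unique tendsto_const_nhds this)

theorem inner_mul_im_eq_zero {g : Space n → ℝ} {v f : L2 n}
    (h : f =ᵐ[volume] fun x => (g x : ℂ) * v x) : (inner ℂ v f).im = 0 := by
  have e : inner ℂ v f = ∫ x, ((g x * ‖v x‖ ^ 2 : ℝ) : ℂ) := by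
    rw [L2.inner_def]
    refine integral_congr_ae ?_
    filter_upwards [h] with x hx
    rw [hx, RCLike.inner_apply, mul_assoc, Complex.mul_conj, Complex.normSq_eq_norm_sq]
    push_cast
    rfl
  rw [e, integral_complex_ofReal, Complex.ofReal_im]

theorem inner_laplacian_im_eq_zero (v : (laplacian n).domain) :
    (inner ℂ (v : L2 n) (laplacian n v)).im = 0 := by
  obtain ⟨s, hs, hs'⟩ := exists_schwartz_tendsto v
  have key (k : ℕ) : (inner ℂ (toL2 (s k)) (toL2 (Δ (s k)))).im = 0 := by
    rw [← Complex.conj_eq_iff_im, inner_conj_symm]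
    simp only [toL2]
    rw [SchwartzMap.inner_toL2_toL2_eq _ _ volume, SchwartzMap.inner_toL2_toL2_eq _ _ volume]
    have := SchwartzMap.integral_bilinear_laplacian_right_eq_left (μ := volume) (s k) (s k)
      ((ContinuousLinearMap.mul ℝ ℂ).comp (Complex.conjCLE : ℂ →L[ℝ] ℂ))
    simpa [RCLike.inner_apply, mul_comm] using this.symm
  have h1 := (Complex.continuous_im.tendsto _).comp (hs.inner (𝕜 := ℂ) hs')
  refine tendsto_nhds_unique h1 ?_
  simp only [Function.comp_def, key]
  exact tendsto_const_nhds

/-! ### Approximating an eigenvector -/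

theorem bracket_rpow (α : ℝ) (x : Space n) : bracket x ^ α = (1 + ‖x‖ ^ 2) ^ (α / 2) := by
  rw [bracket, Real.sqrt_eq_rpow, ← Real.rpow_mul (by positivity)]
  congr 1
  ring

theorem MemLp.exists_bound {V : Space n → ℝ} (hV : MemLp V ⊤ volume) :
    ∃ M : ℝ, 0 ≤ M ∧ ∀ᵐ x, |V x| ≤ M := by
  refine ⟨(eLpNormEssSup V volume).toReal, ENNReal.toReal_nonneg, ?_⟩
  have hfin : eLpNormEssSup V volume ≠ ⊤ := by
    have := hV.eLpNorm_lt_top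
    rw [eLpNorm_exponent_top] at this
    exact this.ne
  filter_upwards [ae_le_eLpNormEssSup (f := V) (μ := volume)] with x hx
  rw [← Real.norm_eq_abs, ← toReal_enorm]
  exact ENNReal.toReal_mono hfin hx

/-- When `H` is not closable, `H.closure` is `H` by convention and the claim is trivial; closability
need not be established. -/
theorem mem_closure_graph_of_closure {H : L2 n →ₗ.[ℂ] L2 n} (u : H.closure.domain) :
    ((u : L2 n), H.closure u) ∈ _root_.closure (H.graph : Set (L2 n × L2 n)) := by
  have key (p : L2 n × L2 n) (hp : p ∈ H.closure.graph) :
      p ∈ _root_.closure (H.graph : Set (L2 n × L2 n)) := by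
    by_cases hc : H.IsClosable
    · rw [← hc.graph_closure_eq_closure_graph] at hp
      exact hp
    · rw [LinearPMap.closure_def' hc] at hp
      exact subset_closure hp
  exact key _ (H.closure.mem_graph u)

theorem vanishes_of_tendsto_zero {u : ℕ → L2 n} (hu : Tendsto u atTop (𝓝 0)) :
    Vanishes fun k x => u k x := by
  refine (tendsto_iff_vanishes.mp hu).congr fun k => ?_
  filter_upwards [Lp.coeFn_zero ℂ 2 (volume : Measure (Space n))] with x hx
  rw [hx, Pi.zero_apply, sub_zero]

theorem coeFn_toL2 (s : 𝓢(Space n, ℂ)) : toL2 s =ᵐ[volume] s := s.coeFn_toLp 2 volume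

theorem schrodinger_apply (W : Space n → ℝ) (w : (schrodinger W).domain) :
    schrodinger W w = -laplacian n ⟨w, w.2.1⟩ + mulOp W ⟨w, w.2.2⟩ :=
  LinearPMap.add_apply (-laplacian n) (mulOp W) w

theorem exists_of_mem_graph {W : Space n → ℝ} {S : Submodule ℂ (L2 n)} {p : L2 n × L2 n}
    (hp : p ∈ ((schrodinger W).domRestrict S).graph) :
    ∃ (v : (laplacian n).domain) (m : L2 n), (m =ᵐ[volume] fun x => (W x : ℂ) * (v : L2 n) x) ∧
      (v : L2 n) = p.1 ∧ -laplacian n v + m = p.2 := by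
  obtain ⟨w, hw1, hw2⟩ := (LinearPMap.mem_graph_iff _).mp hp
  have hS : (w : L2 n) ∈ (schrodinger W).domain := w.2.2
  refine ⟨⟨w, hS.1⟩, mulOp W ⟨w, hS.2⟩, mulOp_ae_eq _ _, hw1, ?_⟩
  rw [← hw2]
  exact (schrodinger_apply W ⟨w, hS⟩).symm.trans
    (LinearPMap.domRestrict_apply (x := w) (y := ⟨w, hS⟩) rfl).symm

/-- An eigenvector is a limit of elements of `H²` whose images converge. -/
theorem exists_seq_of_isEigenvalue {α : ℝ} {V : Space n → ℝ} {lam : ℂ}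
    (h : IsEigenvalue (hamiltonian α V) lam) :
    ∃ u : L2 n, u ≠ 0 ∧ ∃ (v : ℕ → (laplacian n).domain) (m : ℕ → L2 n),
      (∀ k, m k =ᵐ[volume] fun x => ((-bracket x ^ α + V x : ℝ) : ℂ) * (v k : L2 n) x) ∧
      Tendsto (fun k => (v k : L2 n)) atTop (𝓝 u) ∧
      Tendsto (fun k => -laplacian n (v k) + m k) atTop (𝓝 (lam • u)) := by
  obtain ⟨u, hu0, hu⟩ := h
  have hcl := mem_closure_graph_of_closure u
  change ((u : L2 n), hamiltonian α V u) ∈ _ at hcl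
  rw [hu] at hcl
  obtain ⟨y, hy, hlim⟩ := mem_closure_iff_seq_limit.mp hcl
  choose v m hm hv hl using fun k => exists_of_mem_graph (hy k)
  refine ⟨u, hu0, v, m, hm, ?_, ?_⟩
  · simp only [hv]
    exact (continuous_fst.tendsto _).comp hlim
  · simp only [hl]
    exact (continuous_snd.tendsto _).comp hlim

/-- The forms `⟨v_k, H v_k⟩` are real and converge to `lam ‖u‖²`. -/
theorem im_eq_zero_of_tendsto {g : Space n → ℝ} {u : L2 n} (hu : u ≠ 0) {lam : ℂ}
    {v : ℕ → (laplacian n).domain} {m : ℕ → L2 n}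
    (hm : ∀ k, m k =ᵐ[volume] fun x => (g x : ℂ) * (v k : L2 n) x)
    (hv : Tendsto (fun k => (v k : L2 n)) atTop (𝓝 u))
    (hl : Tendsto (fun k => -laplacian n (v k) + m k) atTop (𝓝 (lam • u))) : lam.im = 0 := by
  have key (k : ℕ) : (inner ℂ (v k : L2 n) (-laplacian n (v k) + m k)).im = 0 := by
    rw [inner_add_right, inner_neg_right, Complex.add_im, Complex.neg_im,
      inner_laplacian_im_eq_zero, inner_mul_im_eq_zero (hm k)]
    simp
  have h1 := (Complex.continuous_im.tendsto _).comp (hv.inner (𝕜 := ℂ) hl)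
  have h2 : (inner ℂ u (lam • u)).im = 0 := by
    refine tendsto_nhds_unique h1 ?_
    simp only [Function.comp_def, key]
    exact tendsto_const_nhds
  rw [inner_smul_right, inner_self_eq_norm_sq_to_K] at h2
  have h3 : (lam * ((‖u‖ ^ 2 : ℝ) : ℂ)).im = 0 := by
    rw [← h2]; push_cast; rfl
  rw [Complex.im_mul_ofReal] at h3
  exact (mul_eq_zero.mp h3).resolve_right (by positivity)

/-- An eigenvector is approximated by Schwartz functions with locally vanishing residuals. -/
theorem exists_schwartz_residual {α : ℝ} (hα : 0 ≤ α) {V₁ V₂ : Space n → ℝ}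
    (hV₁ : IsRelativelyCompact (mulOp V₁) (laplacian n)) (hV₂ : MemLp V₂ ⊤ volume) {lam : ℂ}
    (h : IsEigenvalue (hamiltonian α fun x => V₁ x + V₂ x) lam) :
    ∃ u : L2 n, u ≠ 0 ∧ lam.im = 0 ∧ ∃ s : ℕ → 𝓢(Space n, ℂ),
      Tendsto (fun k => toL2 (s k)) atTop (𝓝 u) ∧
      ∀ R : ℝ, Vanishes fun k => (Metric.ball (0 : Space n) R).indicator fun x =>
        -(Δ (s k)) x + (((V₁ x + V₂ x - bracket x ^ α : ℝ) : ℂ) - lam) * s k x := by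
  obtain ⟨u, hu0, v, m, hm, hv, hl⟩ := exists_seq_of_isEigenvalue h
  refine ⟨u, hu0, im_eq_zero_of_tendsto hu0 hm hv hl, ?_⟩
  have hex (k : ℕ) : ∃ s : 𝓢(Space n, ℂ), ‖toL2 s - (v k : L2 n)‖ < 1 / ((k : ℝ) + 1) ∧
      ‖toL2 (Δ s) - laplacian n (v k)‖ < 1 / ((k : ℝ) + 1) := by
    obtain ⟨s, hs, hs'⟩ := exists_schwartz_tendsto (v k)
    have hpos : 0 < 1 / ((k : ℝ) + 1) := by positivity
    obtain ⟨j, h1, h2⟩ := (((tendsto_iff_norm_sub_tendsto_zero.mp hs).eventually_lt_const hpos).and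
      ((tendsto_iff_norm_sub_tendsto_zero.mp hs').eventually_lt_const hpos)).exists
    exact ⟨s j, h1, h2⟩
  choose s hs hs' using hex
  have hc : Tendsto (fun k => toL2 (s k) - (v k : L2 n)) atTop (𝓝 0) :=
    squeeze_zero_norm (fun k => (hs k).le) tendsto_one_div_add_atTop_nhds_zero_nat
  have ha : Tendsto (fun k => toL2 (Δ (s k)) - laplacian n (v k)) atTop (𝓝 0) :=
    squeeze_zero_norm (fun k => (hs' k).le) tendsto_one_div_add_atTop_nhds_zero_nat
  have hsu : Tendsto (fun k => toL2 (s k)) atTop (𝓝 u) := by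
    simpa using hc.add hv
  refine ⟨s, hsu, fun R => ?_⟩
  set σ : ℕ → (laplacian n).domain := fun k => ⟨toL2 (s k), toL2_mem_sobolevTwo (s k)⟩ with hσ
  have hLσ (k : ℕ) : laplacian n (σ k) = toL2 (Δ (s k)) := laplacianFun_toL2 (s k)
  obtain ⟨C, hC0, hC⟩ := exists_relative_bound hV₁ one_pos
  have hD := hV₁.choose
  set b : ℕ → L2 n := fun k => mulOp V₁ ⟨σ k - v k, hD (σ k - v k).2⟩ with hb
  have hbe (k : ℕ) : b k =ᵐ[volume] fun x => (V₁ x : ℂ) * (toL2 (s k) - (v k : L2 n) : L2 n) x :=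
    mulOp_ae_eq V₁ _
  -- `V₁` is unbounded but relatively bounded, so closeness in the graph norm of `Δ` controls it
  -- globally; only `⟨x⟩^α` forces the restriction to balls.
  have hb0 : Tendsto b atTop (𝓝 0) := by
    have h0 : Tendsto (fun k => 1 * ‖toL2 (Δ (s k)) - laplacian n (v k)‖ +
        C * ‖toL2 (s k) - (v k : L2 n)‖) atTop (𝓝 0) := by
      simpa using (ha.norm.const_mul 1).add (hc.norm.const_mul C)
    refine squeeze_zero_norm (fun k => ?_) h0
    have := hC (σ k - v k) (b k) (hbe k)
    rwa [(laplacian n).map_sub, hLσ] at this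
  have hd : Tendsto (fun k => -laplacian n (v k) + m k - lam • u) atTop (𝓝 0) := by
    simpa using hl.sub_const (lam • u)
  have he : Tendsto (fun k => toL2 (s k) - u) atTop (𝓝 0) := by
    simpa using hsu.sub_const u
  obtain ⟨M, hM0, hM⟩ := MemLp.exists_bound hV₂
  have hmeas (f : L2 n) : AEStronglyMeasurable fun x => ‖f x‖ := (Lp.aestronglyMeasurable f).norm
  have hn {f : ℕ → L2 n} (hf : Tendsto f atTop (𝓝 0)) : Vanishes fun k x => ‖f k x‖ :=
    (vanishes_of_tendsto_zero hf).of_le 1 fun k => ae_of_all _ fun x => by simp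
  have hsum := ((((hn ha).add (hn hb0) (fun k => hmeas _) fun k => hmeas _).add (hn hc)
    (fun k => (hmeas _).add (hmeas _)) fun k => hmeas _).add (hn hd)
    (fun k => ((hmeas _).add (hmeas _)).add (hmeas _)) fun k => hmeas _).add (hn he)
    (fun k => (((hmeas _).add (hmeas _)).add (hmeas _)).add (hmeas _)) fun k => hmeas _
  refine hsum.of_le (1 + M + (1 + R ^ 2) ^ (α / 2) + ‖lam‖) fun k => ?_
  filter_upwards [hM, hbe k, hm k, Lp.coeFn_sub (toL2 (Δ (s k))) (laplacian n (v k)),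
    Lp.coeFn_sub (toL2 (s k)) (v k : L2 n), Lp.coeFn_sub (-laplacian n (v k) + m k) (lam • u),
    Lp.coeFn_add (-laplacian n (v k)) (m k), Lp.coeFn_neg (laplacian n (v k)),
    Lp.coeFn_smul lam u, Lp.coeFn_sub (toL2 (s k)) u, coeFn_toL2 (s k), coeFn_toL2 (Δ (s k))]
    with x x1 x2 x3 x4 x5 x6 x7 x8 x9 x10 x11 x12
  set A := (toL2 (Δ (s k)) - laplacian n (v k) : L2 n) x with hA
  set B := b k x with hB
  set Γ := (toL2 (s k) - (v k : L2 n) : L2 n) x with hΓ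
  set D := (-laplacian n (v k) + m k - lam • u : L2 n) x with hDx
  set F := (toL2 (s k) - u : L2 n) x with hF
  rw [Real.norm_of_nonneg (r := ‖A‖ + ‖B‖ + ‖Γ‖ + ‖D‖ + ‖F‖) (by positivity)]
  by_cases hx : x ∈ Metric.ball (0 : Space n) R
  · rw [Set.indicator_of_mem hx]
    have hxR : ‖x‖ < R := by simpa using hx
    -- Five errors: the Laplacian and `V₁` applied to `s - v`, the locally bounded part of the
    -- potential applied to `s - v`, the defect of `v` in the eigenvalue equation, and `lam (s -
    -- u)`.
    have e : -(Δ (s k)) x + (((V₁ x + V₂ x - bracket x ^ α : ℝ) : ℂ) - lam) * s k x =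
        -A + B + ((V₂ x - bracket x ^ α : ℝ) : ℂ) * Γ + D - lam * F := by
      rw [x2, x6, x10, x4, x5]
      simp only [Pi.sub_apply, x7, Pi.add_apply, x8, Pi.neg_apply, x3, x9, Pi.smul_apply, x11, x12,
        smul_eq_mul]
      push_cast
      ring
    have hbr : bracket x ^ α ≤ (1 + R ^ 2) ^ (α / 2) := by
      rw [bracket_rpow]
      gcongr
    have hbr0 : 0 ≤ bracket x ^ α := by rw [bracket_rpow]; positivity
    have hcoef : ‖((V₂ x - bracket x ^ α : ℝ) : ℂ)‖ ≤ M + (1 + R ^ 2) ^ (α / 2) := by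
      rw [Complex.norm_real, Real.norm_eq_abs]
      refine (abs_sub _ _).trans ?_
      rw [abs_of_nonneg hbr0]
      gcongr
    have hY : 0 ≤ (1 + R ^ 2) ^ (α / 2) := by positivity
    rw [e]
    have h1 : ‖-A + B + ((V₂ x - bracket x ^ α : ℝ) : ℂ) * Γ + D - lam * F‖ ≤
        ‖A‖ + ‖B‖ + ‖((V₂ x - bracket x ^ α : ℝ) : ℂ)‖ * ‖Γ‖ + ‖D‖ + ‖lam‖ * ‖F‖ := by
      refine (norm_sub_le _ _).trans ?_
      rw [norm_mul lam]
      gcongr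
      refine (norm_add_le _ _).trans ?_
      gcongr
      refine (norm_add_le _ _).trans ?_
      rw [norm_mul]
      gcongr
      refine (norm_add_le _ _).trans ?_
      rw [norm_neg]
    have h2 : ‖((V₂ x - bracket x ^ α : ℝ) : ℂ)‖ * ‖Γ‖ ≤ (M + (1 + R ^ 2) ^ (α / 2)) * ‖Γ‖ := by
      gcongr
    have hl0 := norm_nonneg lam
    have nA := norm_nonneg A
    have nB := norm_nonneg B
    have nC := norm_nonneg Γ
    have nD := norm_nonneg D
    have nF := norm_nonneg F
    generalize (1 + R ^ 2) ^ (α / 2) = Y at *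
    generalize ‖lam‖ = l at *
    have h3 : 0 ≤ (M + Y + l) * (‖A‖ + ‖B‖ + ‖D‖) + (1 + l) * ‖Γ‖ + (1 + M + Y) * ‖F‖ := by
      positivity
    linarith
  · rw [Set.indicator_of_notMem hx]
    simp only [norm_zero]
    positivity

theorem exists_isShortRange {α : ℝ} {V : Space n → ℝ} (hV : MemLp V ⊤ volume)
    (hd : Tendsto (fun x => bracket x ^ (1 - α / 2) * Real.log (bracket x) * |V x|)
      (Bornology.cobounded (Space n) ⊓ ae volume) (𝓝 0)) :
    ∃ M : ℝ, IsShortRange α M V := by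
  obtain ⟨M, hM0, hM⟩ := MemLp.exists_bound hV
  refine ⟨M, hV.aestronglyMeasurable, hM, fun δ hδ => ?_⟩
  -- Its square is `δ / 4`, the 4 compensating `ln (1 + |x|²) = 2 ln⟨x⟩` after squaring.
  have hη : 0 < √δ / 2 := by positivity
  have h1 := (tendsto_order.mp hd).2 _ hη
  obtain ⟨s, hs, t, ht, hst⟩ := mem_inf_iff_superset.mp h1
  obtain ⟨r, -, hr⟩ := (hasBasis_cobounded_norm (E := Space n)).mem_iff.mp hs
  refine ⟨max r 0 ^ 2, ?_⟩
  filter_upwards [ht] with x hx hrx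
  have hxr : r ≤ ‖x‖ := (le_max_left r 0).trans
    (le_of_sq_le_sq hrx (norm_nonneg x))
  have h2 := hst ⟨hr hxr, hx⟩
  simp only [Set.mem_ofPred_eq] at h2
  have hs0 : 0 < 1 + ‖x‖ ^ 2 := by positivity
  have hlog : Real.log (bracket x) = Real.log (1 + ‖x‖ ^ 2) / 2 := by
    rw [bracket, Real.log_sqrt hs0.le]
  have hl0 : 0 ≤ Real.log (1 + ‖x‖ ^ 2) := Real.log_nonneg (by
    have : 0 ≤ ‖x‖ ^ 2 := by positivity
    linarith)
  rw [hlog, bracket_rpow] at h2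
  set p := (1 + ‖x‖ ^ 2) ^ ((1 - α / 2) / 2) with hp
  have hp0 : 0 < p := by positivity
  have hpp : p ^ 2 * (1 + ‖x‖ ^ 2) ^ (α / 2) = 1 + ‖x‖ ^ 2 := by
    rw [hp, ← Real.rpow_natCast, ← Real.rpow_mul hs0.le, ← Real.rpow_add hs0]
    norm_num
  have h3 : (p * (Real.log (1 + ‖x‖ ^ 2) / 2) * |V x|) ^ 2 ≤ (√δ / 2) ^ 2 := by
    gcongr
  rw [div_pow, Real.sq_sqrt hδ.le, mul_pow, sq_abs] at h3
  calc V x ^ 2 * (1 + ‖x‖ ^ 2) * Real.log (1 + ‖x‖ ^ 2) ^ 2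
      = V x ^ 2 * (p ^ 2 * (1 + ‖x‖ ^ 2) ^ (α / 2)) * Real.log (1 + ‖x‖ ^ 2) ^ 2 := by rw [hpp]
    _ = 4 * ((p * (Real.log (1 + ‖x‖ ^ 2) / 2)) ^ 2 * V x ^ 2) * (1 + ‖x‖ ^ 2) ^ (α / 2) := by ring
    _ ≤ 4 * (δ / 2 ^ 2) * (1 + ‖x‖ ^ 2) ^ (α / 2) := by gcongr
    _ = _ := by ring

/-! ### Real and imaginary parts as approximate solutions -/

theorem pd_comp (ℓ : ℂ →L[ℝ] ℝ) (s : 𝓢(Space n, ℂ)) (i : Fin n) :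
    pd i (fun x => ℓ (s x)) =
      fun x => ℓ ((∂_{(EuclideanSpace.single i (1 : ℝ) : Space n)} s) x) := by
  ext x
  rw [pd, SchwartzMap.lineDerivOp_apply_eq_fderiv]
  have h : HasFDerivAt (fun x => ℓ (s x)) (ℓ.comp (fderiv ℝ s x)) x :=
    ℓ.hasFDerivAt.comp x (s.differentiableAt (x := x)).hasFDerivAt
  rw [h.fderiv]
  rfl

theorem lap_comp (ℓ : ℂ →L[ℝ] ℝ) (s : 𝓢(Space n, ℂ)) (x : Space n) :
    lap (fun x => ℓ (s x)) x = ℓ ((Δ s) x) := by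
  rw [SchwartzMap.laplacian_eq_sum (EuclideanSpace.basisFun (Fin n) ℝ), _root_.sum_apply,
    map_sum, lap]
  refine Finset.sum_congr rfl fun i _ => ?_
  rw [pd_comp, pd_comp, EuclideanSpace.basisFun_apply]

theorem contDiff_comp (ℓ : ℂ →L[ℝ] ℝ) (s : 𝓢(Space n, ℂ)) : ContDiff ℝ ∞ fun x => ℓ (s x) :=
  ℓ.contDiff.comp (s.smooth ⊤)

theorem map_ofReal_mul (ℓ : ℂ →L[ℝ] ℝ) (r : ℝ) (z : ℂ) : ℓ ((r : ℂ) * z) = r * ℓ z := by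
  rw [← Complex.real_smul, map_smul, smul_eq_mul]

/-- The coefficients are real, so a real-linear functional commutes with the operator. -/
theorem residual_comp (ℓ : ℂ →L[ℝ] ℝ) (s : 𝓢(Space n, ℂ)) (α E : ℝ) (V : Space n → ℝ)
    (x : Space n) : residual V (potential α E) (fun x => ℓ (s x)) x =
      ℓ (-(Δ s) x + (((V x - bracket x ^ α : ℝ) : ℂ) - E) * s x) := by
  rw [residual, lap_comp, ← Complex.ofReal_sub, map_add, map_neg, map_ofReal_mul, bracket_rpow,
    potential]
  ring

theorem tendsto_integral_sq {f : ℕ → Space n → ℝ} {g : Space n → ℝ}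
    (hf : ∀ k, MemLp (f k) 2 volume) (hg : MemLp g 2 volume)
    (h : Vanishes fun k x => f k x - g x) :
    Tendsto (fun k => ∫ x, f k x ^ 2) atTop (𝓝 (∫ x, g x ^ 2)) := by
  have key {φ : Space n → ℝ} (hφ : MemLp φ 2 volume) : ‖hφ.toLp φ‖ ^ 2 = ∫ x, φ x ^ 2 := by
    rw [Lp.norm_toLp, hφ.eLpNorm_eq_integral_rpow_norm two_ne_zero ENNReal.ofNat_ne_top,
      ENNReal.toReal_ofReal (by positivity)]
    simp only [ENNReal.toReal_ofNat, Real.rpow_ofNat, Real.norm_eq_abs, sq_abs]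
    rw [← Real.rpow_natCast, ← Real.rpow_mul (integral_nonneg fun x => sq_nonneg _)]
    simp
  have h1 := (Lp.tendsto_Lp_iff_tendsto_eLpNorm'' f hf g hg).mpr h
  simpa only [key] using h1.norm.pow 2

/-- The real and imaginary parts of the approximating functions form approximate solutions. -/
theorem isApproxSolution_comp (ℓ : ℂ →L[ℝ] ℝ) {α E M : ℝ} {V₁ V₂ : Space n → ℝ}
    (hV : IsShortRange α M V₂) {R₀ : ℝ} (hR₀ : 0 ≤ R₀) (hV₁ : ∀ᵐ x, R₀ ≤ ‖x‖ → V₁ x = 0)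
    {u : L2 n} {s : ℕ → 𝓢(Space n, ℂ)} (hs : Tendsto (fun k => toL2 (s k)) atTop (𝓝 u))
    (hr : ∀ R : ℝ, Vanishes fun k => (Metric.ball (0 : Space n) R).indicator fun x =>
        -(Δ (s k)) x + (((V₁ x + V₂ x - bracket x ^ α : ℝ) : ℂ) - E) * s k x) :
    IsApproxSolution α E (R₀ ^ 2) V₂ (fun k x => ℓ (s k x)) (fun x => ℓ (u x)) where
  contDiff k := contDiff_comp ℓ (s k)
  integrable := ((ℓ.comp_memLp' (Lp.memLp u)).integrable_sq)
  tendsto a b := by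
    have hm := measurableSet_shell (n := n) a b
    have h1 (k : ℕ) : MemLp ((shell n a b).indicator fun x => ℓ (s k x)) 2 volume :=
      (ℓ.comp_memLp' ((s k).memLp 2 volume)).indicator hm
    have h2 : MemLp ((shell n a b).indicator fun x => ℓ (u x)) 2 volume :=
      (ℓ.comp_memLp' (Lp.memLp u)).indicator hm
    have h3 := tendsto_integral_sq h1 h2 ((tendsto_iff_vanishes.mp hs).of_le ‖ℓ‖ fun k => by
      filter_upwards [coeFn_toL2 (s k)] with x hx
      rw [hx]
      by_cases hxs : x ∈ shell n a b
      · rw [Set.indicator_of_mem hxs, Set.indicator_of_mem hxs, ← map_sub]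
        exact ℓ.le_opNorm _
      · rw [Set.indicator_of_notMem hxs, Set.indicator_of_notMem hxs, sub_zero, norm_zero]
        positivity)
    have e (φ : Space n → ℝ) : ∫ x, (shell n a b).indicator φ x ^ 2 =
        ∫ x in shell n a b, φ x ^ 2 := by
      rw [← integral_indicator hm]
      refine integral_congr_ae (ae_of_all _ fun x => ?_)
      by_cases hxs : x ∈ shell n a b <;> simp [hxs]
    simpa only [e] using h3
  residual a b ha := by
    have hm := measurableSet_shell (n := n) a b
    have hu (k : ℕ) := contDiff_comp ℓ (s k)
    have h1 (k : ℕ) : MemLp ((shell n a b).indicator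
        (residual V₂ (potential α E) fun x => ℓ (s k x))) 2 volume := by
      rw [memLp_indicator_iff_restrict hm, memLp_two_iff_integrable_sq]
      · exact integrableOn_residual_sq (hu k) hV.aestronglyMeasurable hV.bound
          (continuousOn_potential α E) a b
      · refine AEStronglyMeasurable.restrict ?_
        have c1 := (hu k).continuous
        have c2 := lap_continuous (hu k)
        have c3 : Continuous fun x : Space n => potential α E (‖x‖ ^ 2) :=
          continuous_comp_normSq (continuousOn_potential α E)
        exact (hV.aestronglyMeasurable.mul c1.aestronglyMeasurable).sub
          (c2.add (c3.mul c1)).aestronglyMeasurable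
    have h2 : Vanishes fun k => (shell n a b).indicator
        (residual V₂ (potential α E) fun x => ℓ (s k x)) := by
      refine (hr (|b| + 1)).of_le ‖ℓ‖ fun k => ?_
      filter_upwards [hV₁] with x hx
      by_cases hxs : x ∈ shell n a b
      -- The shell lies beyond the support of `V₁`, where the residuals for `V₂` and for the full
      -- potential agree.
      · have hx1 : R₀ ≤ ‖x‖ := le_of_sq_le_sq (ha.trans hxs.1) (norm_nonneg x)
        have hx2 : x ∈ Metric.ball (0 : Space n) (|b| + 1) := by
          rw [mem_ball_zero_iff]
          have h3 : ‖x‖ ^ 2 ≤ b := hxs.2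
          have := le_abs_self b
          nlinarith [norm_nonneg x]
        rw [Set.indicator_of_mem hxs, Set.indicator_of_mem hx2, residual_comp, hx hx1, zero_add]
        exact ℓ.le_opNorm _
      · rw [Set.indicator_of_notMem hxs]
        simp only [norm_zero]
        positivity
    have h3 := (vanishes_iff_integral h1).mp h2
    refine h3.congr fun k => ?_
    rw [← integral_indicator hm]
    refine integral_congr_ae (ae_of_all _ fun x => ?_)
    by_cases hxs : x ∈ shell n a b <;> simp [hxs]

/-! ### Regularity of the compactly supported limit and unique continuation -/

/-- The operator `-Δ + V` with `V` a `Δ`-compact potential is closed on `H²`. -/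
theorem exists_laplacian_eq_of_tendsto {V : Space n → ℝ}
    (hV : IsRelativelyCompact (mulOp V) (laplacian n)) {w : ℕ → (laplacian n).domain}
    {m : ℕ → L2 n} (hm : ∀ k, m k =ᵐ[volume] fun x => (V x : ℂ) * (w k : L2 n) x) {u F : L2 n}
    (hw : Tendsto (fun k => (w k : L2 n)) atTop (𝓝 u))
    (hF : Tendsto (fun k => -laplacian n (w k) + m k) atTop (𝓝 F)) :
    ∃ (h : u ∈ (laplacian n).domain) (f : L2 n), (f =ᵐ[volume] fun x => (V x : ℂ) * u x) ∧
      -laplacian n ⟨u, h⟩ + f = F := by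
  -- A relative bound below 1 lets `V` be absorbed: the differences of `Δ w_k` are at most `2` times
  -- those of the images plus `2C` times those of `w_k`.
  obtain ⟨C, hC0, hC⟩ := exists_relative_bound hV (ε := 1 / 2) (by norm_num)
  have hcau : CauchySeq fun k => laplacian n (w k) := by
    rw [cauchySeq_iff_tendsto_dist_atTop_0]
    have h1 := cauchySeq_iff_tendsto_dist_atTop_0.mp hw.cauchySeq
    have h2 := cauchySeq_iff_tendsto_dist_atTop_0.mp hF.cauchySeq
    have h3 := (h2.const_mul 2).add (h1.const_mul (2 * C))
    simp only [mul_zero, add_zero] at h3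
    refine squeeze_zero (fun _ => dist_nonneg) (fun p => ?_) h3
    rw [dist_eq_norm, dist_eq_norm, dist_eq_norm]
    have e : m p.1 - m p.2 =ᵐ[volume] fun x => (V x : ℂ) * ((w p.1 - w p.2 :
        (laplacian n).domain) : L2 n) x := by
      have e0 : ((w p.1 - w p.2 : (laplacian n).domain) : L2 n) = (w p.1 : L2 n) - w p.2 := rfl
      rw [e0]
      filter_upwards [hm p.1, hm p.2, Lp.coeFn_sub (m p.1) (m p.2),
        Lp.coeFn_sub (w p.1 : L2 n) (w p.2)] with x x1 x2 x3 x4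
      rw [x3, x4, Pi.sub_apply, Pi.sub_apply, x1, x2, mul_sub]
    have h4 := hC (w p.1 - w p.2) (m p.1 - m p.2) e
    rw [(laplacian n).map_sub] at h4
    have h5 : ‖laplacian n (w p.1) - laplacian n (w p.2)‖ ≤
        ‖(-laplacian n (w p.1) + m p.1) - (-laplacian n (w p.2) + m p.2)‖ + ‖m p.1 - m p.2‖ := by
      rw [← norm_neg (laplacian n (w p.1) - laplacian n (w p.2))]
      refine le_of_eq_of_le (congrArg norm ?_) (norm_sub_le _ _)
      abel
    have h6 : ‖((w p.1 - w p.2 : (laplacian n).domain) : L2 n)‖ = ‖(w p.1 : L2 n) - w p.2‖ := rfl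
    rw [h6] at h4
    linarith
  obtain ⟨g, hg⟩ := cauchySeq_tendsto_of_complete hcau
  obtain ⟨h, hL⟩ := exists_laplacianFun_eq_of_tendsto hw hg
  have hmlim : Tendsto m atTop (𝓝 (F + g)) := by
    simpa using hF.add hg
  refine ⟨h, F + g, ae_eq_mul_of_tendsto hw hmlim hm, ?_⟩
  have : laplacian n ⟨u, h⟩ = g := hL
  rw [this]
  abel

/-- On a wider shell both the residuals and the masses tend to zero, the limit being zero there, and
the energy estimate passes this on to the gradients. It disposes of the commutator with a cutoff. -/
theorem IsApproxSolution.vanishes_pd {α M : ℝ} (hα₀ : 0 < α) (hα₂ : α ≤ 2) {E T₀ : ℝ}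
    {V : Space n → ℝ} (hV : IsShortRange α M V) {u : ℕ → Space n → ℝ} {U : Space n → ℝ}
    (h : IsApproxSolution α E T₀ V u U) {ρ : ℝ} (hρ : 0 ≤ ρ) (hT₀ : T₀ ≤ ρ)
    (hU : ∀ᵐ x, ρ ≤ ‖x‖ ^ 2 → U x = 0) (i : Fin n) :
    Vanishes fun k => (shell n (ρ + 1) (ρ + 2)).indicator (pd i (u k)) := by
  have hm := measurableSet_shell (n := n) (ρ + 1) (ρ + 2)
  have hint (k : ℕ) : IntegrableOn (fun x => pd i (u k) x ^ 2) (shell n (ρ + 1) (ρ + 2)) :=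
    (((pd_contDiff (h.contDiff k) i).continuous).pow 2).continuousOn.integrableOn_compact
      (isCompact_shell _ _)
  have h1 (k : ℕ) : MemLp ((shell n (ρ + 1) (ρ + 2)).indicator (pd i (u k))) 2 volume := by
    rw [memLp_indicator_iff_restrict hm, memLp_two_iff_integrable_sq]
    · exact hint k
    · exact (pd_contDiff (h.contDiff k) i).continuous.aestronglyMeasurable
  rw [vanishes_iff_integral h1]
  have hL : 0 < ρ + 2 := by linarith
  obtain ⟨C, hC0, hC⟩ := exists_energy_le hα₀ hα₂ E hV hρ
  have hres := h.tendsto_integral_weight hV (continuousOn_sq_cutoff_mul_rpow α ρ (ρ + 2))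
    (a := ρ) (b := 2 * (ρ + 2)) hT₀ (fun t _ ht => by
      rw [(cutoff_eq_zero hL ht).1]; simp)
  have hUz : ∫ x in shell n ρ (2 * (ρ + 2)), U x ^ 2 = 0 := by
    rw [← integral_zero (Space n) ℝ (μ := volume.restrict (shell n ρ (2 * (ρ + 2))))]
    refine integral_congr_ae ?_
    rw [Filter.EventuallyEq, ae_restrict_iff' (measurableSet_shell _ _)]
    filter_upwards [hU] with x hx hxs
    rw [hx hxs.1]
    simp
  have hu := h.tendsto ρ (2 * (ρ + 2))
  rw [hUz] at hu
  have hlim := (hres.add (hu.const_mul C)).const_mul ((ρ + 3) ^ (α / 2))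
  simp only [mul_zero, add_zero] at hlim
  refine squeeze_zero (fun k => integral_nonneg fun x => sq_nonneg _) (fun k => ?_) hlim
  refine le_trans ?_ (mul_le_mul_of_nonneg_left (hC (ρ + 2) (by linarith) (u k) (h.contDiff k))
    (by positivity))
  rw [← integral_const_mul]
  have hgc := gradSq_continuous (h.contDiff k)
  have hψc := continuous_cutoff ρ (ρ + 2)
  have hYc : Continuous fun x : Space n => (1 + ‖x‖ ^ 2) ^ (-(α / 2)) :=
    continuous_comp_normSq (A := fun t => (1 + t) ^ (-(α / 2))) (continuousOn_rpow_one_add _)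
  refine integral_mono ((h1 k).integrable_sq) ((integrable_of_normSq (T := 2 * (ρ + 2) + 1)
    (by fun_prop) fun x hx => ?_).const_mul _) fun x => ?_
  · rw [(cutoff_eq_zero hL fun h => by linarith [h.2]).1]
    simp
  have hG := gradSq_nonneg (u k) x
  by_cases hx : x ∈ shell n (ρ + 1) (ρ + 2)
  · have hx1 : ρ + 1 ≤ ‖x‖ ^ 2 := hx.1
    have hx2 : ‖x‖ ^ 2 ≤ ρ + 2 := hx.2
    simp only [Set.indicator_of_mem hx]
    rw [cutoff_eq_one hL hx1 hx2]
    have hpd : pd i (u k) x ^ 2 ≤ gradSq (u k) x :=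
      Finset.single_le_sum (f := fun i => pd i (u k) x ^ 2) (fun _ _ => sq_nonneg _)
        (Finset.mem_univ i)
    have hY1 : 1 ≤ (ρ + 3) ^ (α / 2) * (1 + ‖x‖ ^ 2) ^ (-(α / 2)) := by
      rw [Real.rpow_neg (by positivity), ← div_eq_mul_inv, one_le_div (by positivity)]
      exact Real.rpow_le_rpow (by positivity) (by linarith) (by positivity)
    calc pd i (u k) x ^ 2 ≤ gradSq (u k) x := hpd
      _ ≤ ((ρ + 3) ^ (α / 2) * (1 + ‖x‖ ^ 2) ^ (-(α / 2))) * gradSq (u k) x :=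
          le_mul_of_one_le_left hG hY1
      _ = _ := by ring
  · simp only [Set.indicator_of_notMem hx, zero_pow two_ne_zero]
    positivity

/-- The product of two Schwartz functions. -/
def schwartzMul (χ s : 𝓢(Space n, ℂ)) : 𝓢(Space n, ℂ) := SchwartzMap.smulLeftCLM ℂ χ s

theorem schwartzMul_apply (χ s : 𝓢(Space n, ℂ)) (x : Space n) :
    schwartzMul χ s x = χ x * s x :=
  SchwartzMap.smulLeftCLM_apply_apply χ.hasTemperateGrowth s x

theorem lineDerivOp_schwartzMul (χ s : 𝓢(Space n, ℂ)) (m : Space n) :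
    ∂_{m} (schwartzMul χ s) = schwartzMul (∂_{m} χ) s + schwartzMul χ (∂_{m} s) := by
  ext x
  rw [_root_.add_apply, schwartzMul_apply, schwartzMul_apply]
  simp only [SchwartzMap.lineDerivOp_apply_eq_fderiv]
  have h : HasFDerivAt (schwartzMul χ s) (χ x • fderiv ℝ s x + s x • fderiv ℝ χ x) x := by
    have h1 := (χ.differentiableAt (x := x)).hasFDerivAt.mul
      (s.differentiableAt (x := x)).hasFDerivAt
    refine h1.congr_of_eventuallyEq (Eventually.of_forall fun y => ?_)
    exact schwartzMul_apply χ s y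
  rw [h.fderiv]
  simp only [_root_.add_apply, _root_.smul_apply, smul_eq_mul]
  ring

theorem laplacian_schwartzMul (χ s : 𝓢(Space n, ℂ)) (x : Space n) :
    (Δ (schwartzMul χ s)) x = (Δ χ) x * s x + 2 * (∑ i : Fin n,
      (∂_{(EuclideanSpace.single i (1 : ℝ) : Space n)} χ) x *
        (∂_{(EuclideanSpace.single i (1 : ℝ) : Space n)} s) x) + χ x * (Δ s) x := by
  simp only [SchwartzMap.laplacian_eq_sum (EuclideanSpace.basisFun (Fin n) ℝ), _root_.sum_apply,
    EuclideanSpace.basisFun_apply, Finset.sum_mul, Finset.mul_sum]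
  rw [← Finset.sum_add_distrib, ← Finset.sum_add_distrib]
  refine Finset.sum_congr rfl fun i _ => ?_
  rw [lineDerivOp_schwartzMul, LineDeriv.lineDerivOp_add, lineDerivOp_schwartzMul,
    lineDerivOp_schwartzMul]
  simp only [_root_.add_apply, schwartzMul_apply]
  ring

/-- A smooth cutoff which is `1` on `|x|² ≤ ρ + 1` and vanishes for `|x|² ≥ ρ + 2`. -/
theorem exists_schwartz_cutoff (ρ : ℝ) : ∃ χ : 𝓢(Space n, ℂ), (∀ x, ‖χ x‖ ≤ 1) ∧
    (∀ x, ‖x‖ ^ 2 ≤ ρ + 1 → χ x = 1) ∧ (∀ x, ρ + 2 ≤ ‖x‖ ^ 2 → χ x = 0) := by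
  set f : Space n → ℂ := fun x => (Real.smoothTransition (ρ + 2 - ‖x‖ ^ 2) : ℂ) with hf
  have hc : HasCompactSupport f := .of_support_subset_isCompact (isCompact_shell 0 (ρ + 2)) fun x hx => by
    refine ⟨by positivity, not_lt.mp fun h => hx ?_⟩
    simp only [hf]
    rw [Real.smoothTransition.zero_of_nonpos (by linarith), Complex.ofReal_zero]
  have hs : ContDiff ℝ ∞ f := Complex.ofRealCLM.contDiff.comp
    (Real.smoothTransition.contDiff.comp (contDiff_const.sub (contDiff_norm_sq ℝ)))
  refine ⟨hc.toSchwartzMap hs, fun x => ?_, fun x hx => ?_, fun x hx => ?_⟩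
  · change ‖f x‖ ≤ 1
    rw [hf, Complex.norm_real, Real.norm_of_nonneg (Real.smoothTransition.nonneg _)]
    exact Real.smoothTransition.le_one _
  · change f x = 1
    rw [hf]
    simp only
    rw [Real.smoothTransition.one_of_one_le (by linarith), Complex.ofReal_one]
  · change f x = 0
    rw [hf]
    simp only
    rw [Real.smoothTransition.zero_of_nonpos (by linarith), Complex.ofReal_zero]

theorem lineDerivOp_eq_zero {f : 𝓢(Space n, ℂ)} {x : Space n} {c : ℂ} (h : ∀ᶠ y in 𝓝 x, f y = c)
    (m : Space n) : ∀ᶠ y in 𝓝 x, (∂_{m} f) y = 0 := by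
  filter_upwards [h.eventually_nhds] with y hy
  have : (f : Space n → ℂ) =ᶠ[𝓝 y] fun _ => c := hy
  rw [SchwartzMap.lineDerivOp_apply_eq_fderiv, this.fderiv_eq]
  simp

theorem laplacian_eq_zero {f : 𝓢(Space n, ℂ)} {x : Space n} {c : ℂ} (h : ∀ᶠ y in 𝓝 x, f y = c) :
    (Δ f) x = 0 := by
  rw [SchwartzMap.laplacian_eq_sum (EuclideanSpace.basisFun (Fin n) ℝ), _root_.sum_apply]
  exact Finset.sum_eq_zero fun i _ =>
    (lineDerivOp_eq_zero (lineDerivOp_eq_zero h _) _).self_of_nhds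

theorem eventually_eq_of_notMem_shell {ρ : ℝ} {χ : 𝓢(Space n, ℂ)}
    (h₁ : ∀ x, ‖x‖ ^ 2 ≤ ρ + 1 → χ x = 1) (h₀ : ∀ x, ρ + 2 ≤ ‖x‖ ^ 2 → χ x = 0) {x : Space n}
    (hx : x ∉ shell n (ρ + 1) (ρ + 2)) : ∃ c : ℂ, ∀ᶠ y in 𝓝 x, χ y = c := by
  have hc : Continuous fun y : Space n => ‖y‖ ^ 2 := by fun_prop
  by_cases h : ‖x‖ ^ 2 < ρ + 1
  · refine ⟨1, ?_⟩
    filter_upwards [hc.continuousAt.eventually_lt_const h] with y hy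
    exact h₁ y hy.le
  · refine ⟨0, ?_⟩
    have h' : ρ + 2 < ‖x‖ ^ 2 := by
      by_contra hcon
      exact hx ⟨not_lt.mp h, not_lt.mp hcon⟩
    filter_upwards [hc.continuousAt.eventually_const_lt h'] with y hy
    exact h₀ y hy.le

theorem exists_norm_le (f : 𝓢(Space n, ℂ)) : ∃ C : ℝ, 0 ≤ C ∧ ∀ x, ‖f x‖ ≤ C :=
  ⟨SchwartzMap.seminorm ℝ 0 0 f, apply_nonneg _ _, fun x => SchwartzMap.norm_le_seminorm ℝ f x⟩

/-- The `i`-th partial derivative of a Schwartz function. -/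
abbrev coordDeriv (i : Fin n) (s : 𝓢(Space n, ℂ)) : 𝓢(Space n, ℂ) :=
  ∂_{(EuclideanSpace.single i (1 : ℝ) : Space n)} s

theorem continuous_bracket_rpow (α : ℝ) : Continuous fun x : Space n => bracket x ^ α := by
  simp only [bracket_rpow]
  exact continuous_comp_normSq (A := fun t => (1 + t) ^ (α / 2)) (continuousOn_rpow_one_add _)

/-- A compactly supported limit of Schwartz functions with locally vanishing residuals belongs to
`H²` and solves the equation. -/
theorem exists_laplacian_ae_eq {α E M ρ : ℝ} (hα : 0 ≤ α) {V₁ V₂ : Space n → ℝ}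
    (hV₁m : AEMeasurable V₁ volume) (hV₁ : IsRelativelyCompact (mulOp V₁) (laplacian n))
    (hV₂m : AEStronglyMeasurable V₂ volume) (hV₂ : ∀ᵐ x, |V₂ x| ≤ M) (hM : 0 ≤ M) (hρ : 0 ≤ ρ)
    {u : L2 n} {s : ℕ → 𝓢(Space n, ℂ)} (hs : Tendsto (fun k => toL2 (s k)) atTop (𝓝 u))
    (hr : ∀ R : ℝ, Vanishes fun k => (Metric.ball (0 : Space n) R).indicator fun x =>
        -(Δ (s k)) x + (((V₁ x + V₂ x - bracket x ^ α : ℝ) : ℂ) - E) * s k x)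
    (hU : ∀ᵐ x, ρ ≤ ‖x‖ ^ 2 → u x = 0)
    (hg : ∀ i : Fin n, Vanishes fun k => (shell n (ρ + 1) (ρ + 2)).indicator
      (coordDeriv i (s k))) :
    ∃ h : u ∈ (laplacian n).domain, laplacian n ⟨u, h⟩ =ᵐ[volume]
      fun x => (((V₁ x + V₂ x - bracket x ^ α : ℝ) : ℂ) - E) * u x := by
  obtain ⟨χ, hχ, hχ₁, hχ₀⟩ := exists_schwartz_cutoff (n := n) ρ
  choose C hC0 hC using fun i : Fin n =>
    exists_norm_le (coordDeriv i χ)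
  obtain ⟨C', hC'0, hC'⟩ := exists_norm_le (Δ χ)
  have hbc := continuous_bracket_rpow (n := n) α
  set Y := (1 + (ρ + 2)) ^ (α / 2) with hY
  have hY0 : 0 ≤ Y := by positivity
  have hbY {x : Space n} (hx : ‖x‖ ^ 2 ≤ ρ + 2) : bracket x ^ α ≤ Y := by
    rw [bracket_rpow, hY]
    gcongr
  have hb0 (x : Space n) : 0 ≤ bracket x ^ α := by rw [bracket_rpow]; positivity
  have hcoef {x : Space n} (h2 : |V₂ x| ≤ M) (hx : ‖x‖ ^ 2 ≤ ρ + 2) :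
      ‖((bracket x ^ α - V₂ x + E : ℝ) : ℂ)‖ ≤ Y + M + |E| := by
    rw [Complex.norm_real, Real.norm_eq_abs]
    refine (abs_add_le _ _).trans ?_
    gcongr
    refine (abs_sub _ _).trans ?_
    rw [abs_of_nonneg (hb0 x)]
    gcongr
    exact hbY hx
  -- `u` has bounded support, on which the coefficient is bounded.
  have hFm : MemLp (fun x => ((bracket x ^ α - V₂ x + E : ℝ) : ℂ) * u x) 2 volume := by
    refine MemLp.of_le_mul (c := Y + M + |E|) (Lp.memLp u) ?_ ?_
    · exact (Complex.continuous_ofReal.comp_aestronglyMeasurable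
        ((hbc.aestronglyMeasurable.sub hV₂m).add aestronglyMeasurable_const)).mul
        (Lp.aestronglyMeasurable u)
    · filter_upwards [hU, hV₂] with x hx h2
      rw [norm_mul]
      by_cases hxρ : ρ ≤ ‖x‖ ^ 2
      · rw [hx hxρ]
        simp
      · gcongr
        exact hcoef h2 (by linarith)
  set w : ℕ → (laplacian n).domain := fun k =>
    ⟨toL2 (schwartzMul χ (s k)), toL2_mem_sobolevTwo _⟩ with hw
  have hLw (k : ℕ) : laplacian n (w k) = toL2 (Δ (schwartzMul χ (s k))) := laplacianFun_toL2 _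
  have hD := hV₁.choose
  set m : ℕ → L2 n := fun k => mulOp V₁ ⟨w k, hD (w k).2⟩ with hmdef
  have hm (k : ℕ) : m k =ᵐ[volume] fun x => (V₁ x : ℂ) * (w k : L2 n) x := mulOp_ae_eq V₁ _
  have hχu : ∀ᵐ x, χ x * u x = u x := by
    filter_upwards [hU] with x hx
    by_cases hxρ : ρ ≤ ‖x‖ ^ 2
    · rw [hx hxρ, mul_zero]
    · rw [hχ₁ x (by linarith), one_mul]
  have hsV := tendsto_iff_vanishes.mp hs
  have hwlim : Tendsto (fun k => (w k : L2 n)) atTop (𝓝 u) := by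
    rw [tendsto_iff_vanishes]
    refine hsV.of_le 1 fun k => ?_
    filter_upwards [hχu, coeFn_toL2 (s k), coeFn_toL2 (schwartzMul χ (s k))] with x h1 h2 h3
    rw [h2, h3, schwartzMul_apply]
    nth_rewrite 1 [← h1]
    rw [← mul_sub, norm_mul]
    gcongr
    exact hχ x
  -- Here `(-Δ + V₁)(χ s_k)` is `χ` times the residual, plus `χ (⟨x⟩^α - V₂ + E) s_k`, minus `2
  -- ∇χ·∇s_k` and `Δχ s_k`. The gradient term vanishes in the limit by `hg`, and the last because `u
  -- = 0` where `Δχ` is nonzero.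
  have hFlim : Tendsto (fun k => -laplacian n (w k) + m k) atTop (𝓝 (hFm.toLp _)) := by
    rw [tendsto_iff_vanishes]
    have hrm (k : ℕ) : AEStronglyMeasurable (fun x =>
        -(Δ (s k)) x + (((V₁ x + V₂ x - bracket x ^ α : ℝ) : ℂ) - E) * s k x) volume := by
      refine ((Δ (s k)).continuous.aestronglyMeasurable.neg).add
        (AEStronglyMeasurable.mul ?_ (s k).continuous.aestronglyMeasurable)
      exact (Complex.continuous_ofReal.comp_aestronglyMeasurable
        ((hV₁m.aestronglyMeasurable.add hV₂m).sub hbc.aestronglyMeasurable)).sub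
        aestronglyMeasurable_const
    have m0 (i : Fin n) (k : ℕ) : AEStronglyMeasurable (fun x =>
        ‖(shell n (ρ + 1) (ρ + 2)).indicator (coordDeriv i (s k)) x‖) volume :=
      ((coordDeriv i (s k)).continuous.aestronglyMeasurable.indicator
        (measurableSet_shell _ _)).norm
    have g1 : Vanishes fun k x => ‖(Metric.ball (0 : Space n) (ρ + 3)).indicator (fun x =>
        -(Δ (s k)) x + (((V₁ x + V₂ x - bracket x ^ α : ℝ) : ℂ) - E) * s k x) x‖ :=
      (hr (ρ + 3)).of_le 1 fun k => ae_of_all _ fun x => by simp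
    have g2 : Vanishes fun k x => ‖toL2 (s k) x - u x‖ :=
      hsV.of_le 1 fun k => ae_of_all _ fun x => by simp
    have g3 : Vanishes fun k x => ∑ i : Fin n, ‖(shell n (ρ + 1) (ρ + 2)).indicator
        (coordDeriv i (s k)) x‖ :=
      Vanishes.sum Finset.univ (fun i _ => (hg i).of_le 1 fun k => ae_of_all _ fun x => by simp)
        fun i _ k => m0 i k
    have m1 (k : ℕ) := ((hrm k).indicator (measurableSet_ball (x := (0 : Space n)) (ε := ρ + 3))).norm
    have m2 (k : ℕ) : AEStronglyMeasurable (fun x => ‖toL2 (s k) x - u x‖) volume :=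
      ((Lp.aestronglyMeasurable _).sub (Lp.aestronglyMeasurable _)).norm
    have m3 (k : ℕ) : AEStronglyMeasurable (fun x => ∑ i : Fin n,
        ‖(shell n (ρ + 1) (ρ + 2)).indicator
        (coordDeriv i (s k)) x‖) volume :=
      Finset.aestronglyMeasurable_fun_sum _ fun i _ => m0 i k
    refine ((g1.add g2 m1 m2).add g3 (fun k => (m1 k).add (m2 k)) m3).of_le
      (1 + (Y + M + |E|) + C' + 2 * ∑ i, C i) fun k => ?_
    filter_upwards [hχu, hU, hV₂, hm k, coeFn_toL2 (s k), coeFn_toL2 (schwartzMul χ (s k)),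
      coeFn_toL2 (Δ (schwartzMul χ (s k))), Lp.coeFn_add (-laplacian n (w k)) (m k),
      Lp.coeFn_neg (laplacian n (w k)), hFm.coeFn_toLp] with x x1 x2 x3 x4 x5 x6 x7 x8 x9 x10
    have hΔu : (Δ χ) x * u x = 0 := by
      by_cases hxs : x ∈ shell n (ρ + 1) (ρ + 2)
      · have := hxs.1
        rw [x2 (by linarith), mul_zero]
      · obtain ⟨c, hc⟩ := eventually_eq_of_notMem_shell hχ₁ hχ₀ hxs
        rw [laplacian_eq_zero hc, zero_mul]
    rw [x8, Pi.add_apply, x9, Pi.neg_apply, hLw, x7, x4, x6, x10, x5, schwartzMul_apply,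
      laplacian_schwartzMul]
    set r := -(Δ (s k)) x + (((V₁ x + V₂ x - bracket x ^ α : ℝ) : ℂ) - E) * s k x with hrx
    set S := ∑ i : Fin n, (coordDeriv i χ) x *
        (coordDeriv i (s k)) x with hS
    set I := (Metric.ball (0 : Space n) (ρ + 3)).indicator (fun x =>
        -(Δ (s k)) x + (((V₁ x + V₂ x - bracket x ^ α : ℝ) : ℂ) - E) * s k x) x with hI
    set J := ∑ i : Fin n, ‖(shell n (ρ + 1) (ρ + 2)).indicator
        (coordDeriv i (s k)) x‖ with hJ
    have e : -((Δ χ) x * s k x + 2 * S + χ x * (Δ (s k)) x) + (V₁ x : ℂ) * (χ x * s k x) -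
        ((bracket x ^ α - V₂ x + E : ℝ) : ℂ) * u x =
        χ x * r + χ x * ((bracket x ^ α - V₂ x + E : ℝ) : ℂ) * (s k x - u x) - 2 * S -
          (Δ χ) x * (s k x - u x) := by
      rw [hrx]
      push_cast
      linear_combination (((bracket x ^ α : ℝ) : ℂ) - V₂ x + E) * x1 - hΔu
    rw [e]
    have n1 : ‖χ x * r‖ ≤ ‖I‖ := by
      by_cases hx : x ∈ Metric.ball (0 : Space n) (ρ + 3)
      · rw [hI, Set.indicator_of_mem hx, norm_mul]
        exact mul_le_of_le_one_left (norm_nonneg _) (hχ x)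
      · rw [hχ₀ x, zero_mul, norm_zero]
        · positivity
        · rw [mem_ball_zero_iff, not_lt] at hx
          nlinarith
    have n2 : ‖χ x * ((bracket x ^ α - V₂ x + E : ℝ) : ℂ) * (s k x - u x)‖ ≤
        (Y + M + |E|) * ‖s k x - u x‖ := by
      rw [norm_mul]
      gcongr
      by_cases hx : ‖x‖ ^ 2 ≤ ρ + 2
      · rw [norm_mul]
        exact (mul_le_of_le_one_left (norm_nonneg _) (hχ x)).trans (hcoef x3 hx)
      · rw [hχ₀ x (by linarith), zero_mul, norm_zero]
        positivity
    have n3 : ‖S‖ ≤ (∑ i, C i) * J := by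
      rw [hJ, Finset.mul_sum]
      refine (norm_sum_le _ _).trans (Finset.sum_le_sum fun i _ => ?_)
      have hCi : C i ≤ ∑ i, C i := Finset.single_le_sum (fun i _ => hC0 i) (Finset.mem_univ i)
      by_cases hxs : x ∈ shell n (ρ + 1) (ρ + 2)
      · rw [Set.indicator_of_mem hxs, norm_mul]
        gcongr
        exact (hC i x).trans hCi
      · obtain ⟨c, hc⟩ := eventually_eq_of_notMem_shell hχ₁ hχ₀ hxs
        rw [(lineDerivOp_eq_zero hc _).self_of_nhds, zero_mul, norm_zero]
        exact mul_nonneg ((hC0 i).trans hCi) (norm_nonneg _)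
    have n4 : ‖(Δ χ) x * (s k x - u x)‖ ≤ C' * ‖s k x - u x‖ := by
      rw [norm_mul]
      gcongr
      exact hC' x
    have n5 : ‖(2 : ℂ) * S‖ = 2 * ‖S‖ := by rw [norm_mul]; norm_num
    have hJ0 : 0 ≤ J := Finset.sum_nonneg fun i _ => norm_nonneg _
    have hCs : 0 ≤ ∑ i, C i := Finset.sum_nonneg fun i _ => hC0 i
    rw [Real.norm_of_nonneg (by positivity)]
    refine (norm_sub_le _ _).trans ?_
    refine (add_le_add_left ((norm_sub_le _ _).trans (add_le_add_left (norm_add_le _ _) _)) _).trans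
      ?_
    rw [n5]
    have nI := norm_nonneg I
    have nd := norm_nonneg (s k x - u x)
    have hE := abs_nonneg E
    generalize ‖s k x - u x‖ = d at *
    generalize ‖I‖ = i at *
    generalize ∑ i, C i = c at *
    have h3 : 0 ≤ ((Y + M + |E|) + C' + 2 * c) * i + (1 + 2 * c) * d +
        (1 + (Y + M + |E|) + C') * J := by positivity
    linarith
  obtain ⟨h, f, hf, hfF⟩ := exists_laplacian_eq_of_tendsto hV₁ hm hwlim hFlim
  refine ⟨h, ?_⟩
  have e : laplacian n ⟨u, h⟩ = f - hFm.toLp _ := by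
    rw [← hfF]; abel
  rw [e]
  filter_upwards [hf, hFm.coeFn_toLp, Lp.coeFn_sub f (hFm.toLp _)] with x h1 h2 h3
  rw [h3, Pi.sub_apply, h1, h2]
  push_cast
  ring

theorem norm_le_abs_re_add_abs_im (z : ℂ) : ‖z‖ ≤ |Complex.reCLM z| + |Complex.imCLM z| :=
  Complex.norm_le_abs_re_add_abs_im z

theorem vanishes_coordDeriv {s : ℕ → 𝓢(Space n, ℂ)} {a b : ℝ} {i : Fin n}
    (hre : Vanishes fun k => (shell n a b).indicator (pd i fun x => Complex.reCLM (s k x)))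
    (him : Vanishes fun k => (shell n a b).indicator (pd i fun x => Complex.imCLM (s k x))) :
    Vanishes fun k => (shell n a b).indicator (coordDeriv i (s k)) := by
  have hm := measurableSet_shell (n := n) a b
  have key (ℓ : ℂ →L[ℝ] ℝ)
      (h : Vanishes fun k => (shell n a b).indicator (pd i fun x => ℓ (s k x))) :
      (Vanishes fun k x => |(shell n a b).indicator (pd i fun x => ℓ (s k x)) x|) ∧
      ∀ k, AEStronglyMeasurable
        (fun x => |(shell n a b).indicator (pd i fun x => ℓ (s k x)) x|) volume :=
    ⟨h.of_le 1 fun k => ae_of_all _ fun x => by simp, fun k =>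
      ((pd_contDiff (contDiff_comp ℓ (s k)) i).continuous.aestronglyMeasurable.indicator hm).norm⟩
  obtain ⟨h1, m1⟩ := key _ hre
  obtain ⟨h2, m2⟩ := key _ him
  refine (h1.add h2 m1 m2).of_le 1 fun k => ae_of_all _ fun x => ?_
  rw [one_mul, Real.norm_of_nonneg (by positivity)]
  by_cases hx : x ∈ shell n a b
  · simp only [Set.indicator_of_mem hx, pd_comp]
    exact norm_le_abs_re_add_abs_im _
  · simp [Set.indicator_of_notMem hx]

/-- An `H²` solution supported in the ball where the potential is not truncated is ruled out by
unique continuation. -/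
theorem eq_zero_of_uniqueContinuation {W : Space n → ℝ} {R ρ : ℝ} (hR : ρ + 1 ≤ R) (hρ : 0 ≤ ρ)
    (hUCP : UniqueContinuation (schrodinger ((Metric.ball (0 : Space n) R).indicator W)))
    {u : L2 n} (hU : ∀ᵐ x, ρ ≤ ‖x‖ ^ 2 → u x = 0) (hd : u ∈ (laplacian n).domain)
    (hL : laplacian n ⟨u, hd⟩ =ᵐ[volume] fun x => (W x : ℂ) * u x) : u = 0 := by
  set W' := (Metric.ball (0 : Space n) R).indicator W with hW'
  -- Outside the ball `|x|² ≥ (ρ + 1)² ≥ ρ`, so the truncation of the potential is not felt by `u`.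
  have hWu : (fun x => (W' x : ℂ) * u x) =ᵐ[volume] fun x => (W x : ℂ) * u x := by
    filter_upwards [hU] with x hx
    by_cases hxR : x ∈ Metric.ball (0 : Space n) R
    · rw [hW', Set.indicator_of_mem hxR]
    · rw [mem_ball_zero_iff, not_lt] at hxR
      rw [hx (by nlinarith), mul_zero, mul_zero]
  have hmem : u ∈ mulDomain W' := (Lp.memLp (laplacian n ⟨u, hd⟩)).ae_eq (hL.trans hWu.symm)
  refine hUCP ⟨u, hd, hmem⟩ ?_ ⟨Metric.closedBall 0 (ρ + 1), isCompact_closedBall _ _, ?_⟩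
  · rw [schrodinger_apply]
    have : mulOp W' ⟨u, hmem⟩ = laplacian n ⟨u, hd⟩ :=
      Lp.ext ((mulOp_ae_eq W' ⟨u, hmem⟩).trans (hWu.trans hL.symm))
    simp only [this, neg_add_cancel]
  · filter_upwards [hU] with x hx hxK
    refine hx ?_
    rw [mem_closedBall_zero_iff, not_le] at hxK
    nlinarith

theorem not_isEigenvalue (hn : 1 ≤ n) {α : ℝ} (hα₀ : 0 < α) (hα₂ : α ≤ 2)
    {V₁ V₂ : Space n → ℝ} (hV₁_meas : AEMeasurable V₁ volume)
    (hV₁_supp : ∃ K : Set (Space n), IsCompact K ∧ ∀ᵐ x, x ∉ K → V₁ x = 0)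
    (hV₁_cpt : IsRelativelyCompact (mulOp V₁) (laplacian n)) (hV₂_bdd : MemLp V₂ ⊤ volume)
    (hUCP : ∀ E : ℝ, ∀ᶠ R : ℝ in atTop, UniqueContinuation (schrodinger
        ((Metric.ball (0 : Space n) R).indicator fun x => V₁ x + V₂ x - bracket x ^ α - E)))
    (hV₂_decay : Tendsto (fun x => bracket x ^ (1 - α / 2) * Real.log (bracket x) * |V₂ x|)
      (Bornology.cobounded (Space n) ⊓ ae volume) (𝓝 0)) (lam : ℂ) :
    ¬ IsEigenvalue (hamiltonian α fun x => V₁ x + V₂ x) lam := by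
  intro hlam
  obtain ⟨u, hu0, him, s, hs, hr⟩ := exists_schwartz_residual hα₀.le hV₁_cpt hV₂_bdd hlam
  obtain ⟨E, rfl⟩ : ∃ E : ℝ, lam = E := ⟨lam.re, Complex.ext rfl him⟩
  obtain ⟨M, hM⟩ := exists_isShortRange hV₂_bdd hV₂_decay
  obtain ⟨R₀, hR₀, hV₁⟩ : ∃ R₀ : ℝ, 0 ≤ R₀ ∧ ∀ᵐ x, R₀ ≤ ‖x‖ → V₁ x = 0 := by
    obtain ⟨K, hK, hKV⟩ := hV₁_supp
    obtain ⟨r, hr⟩ := hK.isBounded.exists_norm_le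
    refine ⟨max r 0 + 1, by positivity, ?_⟩
    filter_upwards [hKV] with x hx hxr
    refine hx fun hxK => ?_
    linarith [hr x hxK, le_max_left r 0]
  have hsol (ℓ : ℂ →L[ℝ] ℝ) := isApproxSolution_comp ℓ hM hR₀ hV₁ hs hr
  obtain ⟨T₁, hT₁⟩ := (hsol Complex.reCLM).ae_eq_zero hn hα₀ hα₂ hM
  obtain ⟨T₂, hT₂⟩ := (hsol Complex.imCLM).ae_eq_zero hn hα₀ hα₂ hM
  -- Besides both vanishing radii, `ρ` dominates `R₀²`, since the residuals for `V₂` alone are small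
  -- only beyond the support of `V₁`.
  set ρ := max (max T₁ T₂) (R₀ ^ 2) with hρ
  have hρ₀ : R₀ ^ 2 ≤ ρ := le_max_right _ _
  have hρ_nonneg : 0 ≤ ρ := (sq_nonneg R₀).trans hρ₀
  have h1 : T₁ ≤ ρ := (le_max_left _ _).trans (le_max_left _ _)
  have h2 : T₂ ≤ ρ := (le_max_right _ _).trans (le_max_left _ _)
  have hre : ∀ᵐ x, ρ ≤ ‖x‖ ^ 2 → Complex.reCLM (u x) = 0 := by
    filter_upwards [hT₁] with x hx hxρ using hx (h1.trans hxρ)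
  have him : ∀ᵐ x, ρ ≤ ‖x‖ ^ 2 → Complex.imCLM (u x) = 0 := by
    filter_upwards [hT₂] with x hx hxρ using hx (h2.trans hxρ)
  have hU : ∀ᵐ x, ρ ≤ ‖x‖ ^ 2 → u x = 0 := by
    filter_upwards [hre, him] with x h1 h2 hxρ using Complex.ext (h1 hxρ) (h2 hxρ)
  obtain ⟨M₀, hM₀, hbound⟩ := MemLp.exists_bound hV₂_bdd
  obtain ⟨hd, hL⟩ := exists_laplacian_ae_eq hα₀.le hV₁_meas hV₁_cpt hV₂_bdd.aestronglyMeasurable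
    hbound hM₀ hρ_nonneg hs hr hU fun i => vanishes_coordDeriv
      ((hsol Complex.reCLM).vanishes_pd hα₀ hα₂ hM hρ_nonneg hρ₀ hre i)
      ((hsol Complex.imCLM).vanishes_pd hα₀ hα₂ hM hρ_nonneg hρ₀ him i)
  obtain ⟨R, hUR, hR⟩ := ((hUCP E).and (eventually_ge_atTop (ρ + 1))).exists
  refine hu0 (eq_zero_of_uniqueContinuation hR hρ_nonneg hUR hU hd (hL.trans (ae_of_all _ ?_)))
  intro x
  push_cast
  ring

end Repulsive

end

theorem theorem2p8 (n : ℕ) (hn : 1 ≤ n) (α : ℝ) (hα₀ : 0 < α) (hα₂ : α ≤ 2)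
    (V₁ V₂ : Repulsive.Space n → ℝ)
    -- `V₁` is measurable, compactly supported and `Δ`-compact
    (hV₁_meas : AEMeasurable V₁ volume)
    (hV₁_supp : ∃ K : Set (Repulsive.Space n), IsCompact K ∧ ∀ᵐ x, x ∉ K → V₁ x = 0)
    (hV₁_cpt : Repulsive.IsRelativelyCompact (Repulsive.mulOp V₁) (Repulsive.laplacian n))
    -- `V₂` is bounded and of short range
    (hV₂_bdd : MemLp V₂ ∞ volume)
    (hV₂_short : ∃ ε > (0 : ℝ), ∃ C : ℝ,
      ∀ᵐ x, |V₂ x| ≤ C * Repulsive.position α x ^ (-1 - ε))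
    -- unique continuation for the truncations of `H_α - E`
    (hUCP : ∀ E : ℝ, ∀ᶠ R : ℝ in atTop,
      Repulsive.UniqueContinuation (Repulsive.schrodinger
        ((Metric.ball (0 : Repulsive.Space n) R).indicator
          fun x => V₁ x + V₂ x - Repulsive.bracket x ^ α - E)))
    -- decay of `V₂` at infinity (essential limit)
    (hV₂_decay : Tendsto
      (fun x => Repulsive.bracket x ^ (1 - α / 2) * Real.log (Repulsive.bracket x) * |V₂ x|)
      (Bornology.cobounded (Repulsive.Space n) ⊓ ae volume) (𝓝 0)) :
    ∀ lam : ℂ, ¬ Repulsive.IsEigenvalue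
      (Repulsive.hamiltonian α fun x => V₁ x + V₂ x) lam := by
  exact Repulsive.not_isEigenvalue hn hα₀ hα₂ hV₁_meas hV₁_supp hV₁_cpt hV₂_bdd hUCP hV₂_decay
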